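/- **Corollary (general digraphs).** All digraphs are finite, non-empty and simple (no loops, no multiple edges; antiparallel edges $(u,v),(v,u)$ are allowed). For a digraph $G$ with a vertex weighting $\mathbf a\colon V(G)\to\mathbb R$, let $R_G(v)$ be the set of vertices reachable from $v$ by a directed path (including $v$ itself). *Weighted Descendant Counting* is the problem of computing, given $G$ and $\mathbf a$, the number $r_{G,\mathbf a}(v)=\sum_{w\in R_G(v)}a_w$ for every vertex $v$ of $G$. The *feedback edge number* $f$ of $G$ is the minimum number of edges whose deletion turns $G$ into a polyforest, that is, a digraph whose underlying undirected graph is a forest (where every directed edge contributes one undirected edge, so that a pair of antiparallel edges forms a cycle); equivalently, $f=|E(G)|-|V(G)|+c$, where $c$ is the number of weakly connected components of $G$. There is a single deterministic algorithm that solves Weighted Descendant Counting on every digraph $G$ with arbitrary real vertex weights in $\mathcal O(\max(1,f)^3\,n)$ time and $\mathcal O(\max(1,f)\,n)$ space, where $n=|V(G)|$ and $f$ is the feedback edge number of $G$; in particular in $\mathcal O(f^3n)$ time and $\mathcal O(fn)$ space whenever $f\ge 1$. The algorithm is not given $f$, and the implied constants are absolute. The model is a random access machine with unit-cost operations on machine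 words and on exact real numbers; the input consists of $n$, the number of edges, the list of edges in arbitrary order, and the weights. Words are natural numbers of size $\mathcal O(\max(1,f)\,n)$, and real numbers can only be stored, added and subtracted. -/

import Mathlib

namespace Digraph

/-- A polyforest: the underlying undirected graph, in which every directed edge gives one
undirected edge, has no cycle. A loop or a pair of antiparallel edges would be a cycle of length
one or two, so both are excluded (first clause); cycles of length at least three are
cycles of the simple graph that forgets orientations (second clause). -/
def IsPolyforest {V : Type*} (G : Digraph V) : Prop :=
  (∀ u v, G.Adj u v → ¬ G.Adj v u) ∧ G.toSimpleGraphInclusive.IsAcyclic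

/-- The digraph obtained by deleting the edges in `F`. -/
def removeEdges {V : Type*} (G : Digraph V) (F : Finset (V × V)) : Digraph V :=
  ⟨fun u v => G.Adj u v ∧ (u, v) ∉ F⟩

/-- `F` is a set of edges of `G` whose deletion leaves a polyforest. -/
def IsFeedbackEdgeSet {V : Type*} (G : Digraph V) (F : Finset (V × V)) : Prop :=
  (∀ p ∈ F, G.Adj p.1 p.2) ∧ (G.removeEdges F).IsPolyforest

/-- The minimum size of a feedback edge set. -/
noncomputable def feedbackEdgeNumber {V : Type*} (G : Digraph V) : ℕ :=
  sInf {k | ∃ F : Finset (V × V), G.IsFeedbackEdgeSet F ∧ F.card = k}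

/-- In a finite digraph a feedback edge set exists, so the minimum is attained. -/
theorem exists_isFeedbackEdgeSet_card {V : Type*} [Finite V] (G : Digraph V) :
    ∃ F : Finset (V × V), G.IsFeedbackEdgeSet F ∧ F.card = G.feedbackEdgeNumber := by
  classical
  have : Fintype V := Fintype.ofFinite V
  refine Nat.sInf_mem (s := {k | ∃ F : Finset (V × V), G.IsFeedbackEdgeSet F ∧ F.card = k})
    ⟨_, Finset.univ.filter (fun p : V × V => G.Adj p.1 p.2), ⟨by simp, ?_⟩, rfl⟩
  have h : G.removeEdges (Finset.univ.filter (fun p : V × V => G.Adj p.1 p.2)) = ⊥ := by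
    ext u v
    simp [removeEdges]
  rw [h]
  exact ⟨fun u v huv => by simp at huv, by simp⟩

/-- `w` is reachable from `v` by a directed path, possibly of length zero. -/
def Reaches {V : Type*} (G : Digraph V) (v w : V) : Prop :=
  Relation.ReflTransGen G.Adj v w

open Classical in
/-- The total weight of the vertices reachable from `v` (including `v` itself). -/
noncomputable def weightedReachability {V : Type*} [Fintype V] (G : Digraph V) (a : V → ℝ)
    (v : V) : ℝ :=
  ∑ w ∈ Finset.univ.filter (fun w => G.Reaches v w), a w

end Digraph

/-! A random access machine with two kinds of memory cells: cells for natural numbers of bounded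
size (machine words) and cells for exact real numbers. A program names, by literal constants,
finitely many variables and finitely many arrays of each kind. -/

namespace RealRAM

structure State where
  /-- the values of the word variables -/
  nvar : ℕ → ℕ
  /-- `narr A i` is the `i`-th cell of the word array `A` -/
  narr : ℕ → ℕ → ℕ
  /-- the values of the real variables -/
  rvar : ℕ → ℝ
  /-- `rarr A i` is the `i`-th cell of the real array `A` -/
  rarr : ℕ → ℕ → ℝ

/-- Operations on words; subtraction is truncated, comparisons return `1` or `0`. -/
inductive WordOp where
  | add | sub | mul | lt | eq

def WordOp.eval : WordOp → ℕ → ℕ → ℕ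
  | add, x, y => x + y
  | sub, x, y => x - y
  | mul, x, y => x * y
  | lt, x, y => if x < y then 1 else 0
  | eq, x, y => if x = y then 1 else 0

/-- Word expressions; `get A e` reads the cell of array `A` whose index is the value of `e`. -/
inductive WordExpr where
  | const (k : ℕ)
  | var (x : ℕ)
  | get (A : ℕ) (e : WordExpr)
  | op (o : WordOp) (e₁ e₂ : WordExpr)

namespace WordExpr

def eval (s : State) : WordExpr → ℕ
  | const k => k
  | var x => s.nvar x
  | get A e => s.narr A (e.eval s)
  | op o e₁ e₂ => o.eval (e₁.eval s) (e₂.eval s)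

/-- Every value that occurs in the evaluation is less than `N`. In particular, only array cells
with indices less than `N` are read. -/
def Fits (N : ℕ) (s : State) : WordExpr → Prop
  | const k => k < N
  | var x => s.nvar x < N
  | get A e => e.Fits N s ∧ s.narr A (e.eval s) < N
  | op o e₁ e₂ => e₁.Fits N s ∧ e₂.Fits N s ∧ o.eval (e₁.eval s) (e₂.eval s) < N

/-- The number of elementary operations in an evaluation. -/
def cost : WordExpr → ℕ
  | const _ => 1
  | var _ => 1
  | get _ e => e.cost + 1
  | op _ e₁ e₂ => e₁.cost + e₂.cost + 1

end WordExpr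

/-- Real expressions. Real numbers can be added and subtracted exactly; they cannot be
compared, rounded, or converted into words. -/
inductive RealExpr where
  | zero
  | var (x : ℕ)
  | get (A : ℕ) (e : WordExpr)
  | add (e₁ e₂ : RealExpr)
  | sub (e₁ e₂ : RealExpr)

namespace RealExpr

def eval (s : State) : RealExpr → ℝ
  | zero => 0
  | var x => s.rvar x
  | get A e => s.rarr A (e.eval s)
  | add e₁ e₂ => e₁.eval s + e₂.eval s
  | sub e₁ e₂ => e₁.eval s - e₂.eval s

/-- All array indices in the evaluation are computed with words less than `N` and are themselves
less than `N`. -/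
def Fits (N : ℕ) (s : State) : RealExpr → Prop
  | zero => True
  | var _ => True
  | get _ e => e.Fits N s
  | add e₁ e₂ => e₁.Fits N s ∧ e₂.Fits N s
  | sub e₁ e₂ => e₁.Fits N s ∧ e₂.Fits N s

/-- The number of elementary operations in an evaluation. -/
def cost : RealExpr → ℕ
  | zero => 1
  | var _ => 1
  | get _ e => e.cost + 1
  | add e₁ e₂ => e₁.cost + e₂.cost + 1
  | sub e₁ e₂ => e₁.cost + e₂.cost + 1

end RealExpr

inductive Prog where
  | skip
  | setN (x : ℕ) (e : WordExpr)
  | putN (A : ℕ) (i e : WordExpr)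
  | setR (x : ℕ) (e : RealExpr)
  | putR (A : ℕ) (i : WordExpr) (e : RealExpr)
  | seq (P Q : Prog)
  | ite (c : WordExpr) (P Q : Prog)
  | loop (c : WordExpr) (P : Prog)

/-- `Run N P s t s'`: started in state `s`, the program `P` halts in state `s'` after exactly `t`
elementary steps, all words computed are less than `N`, and only array cells with indices less
than `N` are accessed. A condition holds when its value is not zero. A run that leaves these
bounds is not a run. As `P` names only finitely many variables and arrays, such a run uses `O(N)`
memory cells, where the constant depends on `P` only. -/
inductive Run (N : ℕ) : Prog → State → ℕ → State → Prop
  | skip (s : State) : Run N .skip s 1 s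
  | setN (x : ℕ) (e : WordExpr) (s : State) (he : e.Fits N s) :
      Run N (.setN x e) s (e.cost + 1)
        { s with nvar := Function.update s.nvar x (e.eval s) }
  | putN (A : ℕ) (i e : WordExpr) (s : State) (hi : i.Fits N s) (he : e.Fits N s) :
      Run N (.putN A i e) s (i.cost + e.cost + 1)
        { s with narr :=
            Function.update s.narr A (Function.update (s.narr A) (i.eval s) (e.eval s)) }
  | setR (x : ℕ) (e : RealExpr) (s : State) (he : e.Fits N s) :
      Run N (.setR x e) s (e.cost + 1)
        { s with rvar := Function.update s.rvar x (e.eval s) }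
  | putR (A : ℕ) (i : WordExpr) (e : RealExpr) (s : State) (hi : i.Fits N s) (he : e.Fits N s) :
      Run N (.putR A i e) s (i.cost + e.cost + 1)
        { s with rarr :=
            Function.update s.rarr A (Function.update (s.rarr A) (i.eval s) (e.eval s)) }
  | seq {P Q : Prog} {s s' s'' : State} {t t' : ℕ} (h : Run N P s t s') (h' : Run N Q s' t' s'') :
      Run N (.seq P Q) s (t + t') s''
  | ite_true {c : WordExpr} {P Q : Prog} {s s' : State} {t : ℕ} (hc : c.Fits N s)
      (h0 : c.eval s ≠ 0) (h : Run N P s t s') :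
      Run N (.ite c P Q) s (c.cost + 1 + t) s'
  | ite_false {c : WordExpr} {P Q : Prog} {s s' : State} {t : ℕ} (hc : c.Fits N s)
      (h0 : c.eval s = 0) (h : Run N Q s t s') :
      Run N (.ite c P Q) s (c.cost + 1 + t) s'
  | loop_true {c : WordExpr} {P : Prog} {s s' s'' : State} {t t' : ℕ} (hc : c.Fits N s)
      (h0 : c.eval s ≠ 0) (h : Run N P s t s') (h' : Run N (.loop c P) s' t' s'') :
      Run N (.loop c P) s (c.cost + 1 + t + t') s''
  | loop_false {c : WordExpr} {P : Prog} {s : State} (hc : c.Fits N s) (h0 : c.eval s = 0) :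
      Run N (.loop c P) s (c.cost + 1) s

/-- The initial state on a vertex-weighted digraph with vertices `0, …, n - 1`, whose `m` edges
are listed (without repetition, in some order) by `e`. Word variables `0` and `1` hold `n` and
`m`, cell `i` of the word arrays `0` and `1` holds the tail and the head of the `i`-th edge, and
cell `v` of the real array `0` holds the weight of `v`. Everything else is zero. -/
noncomputable def initialState {n m : ℕ} {G : Digraph (Fin n)}
    (e : Fin m ≃ {p : Fin n × Fin n // G.Adj p.1 p.2}) (a : Fin n → ℝ) : State where
  nvar x := if x = 0 then n else if x = 1 then m else 0
  narr A i :=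
    if h : i < m then
      if A = 0 then (e ⟨i, h⟩).1.1 else if A = 1 then (e ⟨i, h⟩).1.2 else 0
    else 0
  rvar _ := 0
  rarr A i := if h : i < n then (if A = 0 then a ⟨i, h⟩ else 0) else 0

end RealRAM

/-!
The algorithm divides the edges into a forest and a set of at most `2 * f` extra edges, and then
works in time `O((k + 1) ^ 2 * n)`, where `k` is the number of extra edges.

*Forest and extra edges.* As long as some vertex has degree one, it is deleted together with its
edge; when there is no such vertex, an arbitrary remaining edge is deleted and called an extra edge.
The edges of the first kind form a forest, given by an elimination order (`ElimForest`). Let `F` be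
a smallest feedback edge set. Between two choices of extra edges, the remaining edge set `A` has no
vertex of degree one, and the potential `|A| - |V(A)| + |A ∩ F|` decreases strictly with every
choice (`EdgeList.Leafless.potential_lt`): if the lost edges are not more than the lost vertices,
they form a 2-regular graph, so one of them lies in `F`, as the edges outside of `F` form a forest.
Since the potential is at most `2 * |F|` (`EdgeList.potential_le`) and is zero at the end, there are
at most `2 * f` extra edges, although the algorithm does not know `f`. The edge at a leaf is found
in constant time: its number is the sum of the numbers of all edges at that vertex, and these sums
are easy to maintain modulo `m`.

*Sums along the forest.* Two passes over the elimination order, one in each direction, replace an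
array by the array of its sums over the sets reachable inside the forest (`ElimForest.Pass₁`,
`ElimForest.Pass₂`). Only additions are used, so this works for words as well as for reals.

*Extra edges.* With `k` such summations the algorithm finds, for every extra edge, the vertices
which reach its tail inside the forest; a transitive closure over the extra edges then gives, for
every vertex `v`, the set of all extra edges whose tails are reachable from `v`, the column of `v`
(`exec_closeRows`). Splitting a path after its last extra edge (`ElimForest.extReach_last`) shows
that `w` is reachable from `v` if and only if it is reachable inside the forest from `v`, or from
the head of an edge in the column of `v`. For all vertices with the same column, the second part is
the same set, so the answers are obtained together in time `O(n + k)` by one summation of words and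
one of reals, and they are stored in time `O(k * n)`.

*Few columns.* There are at most `2 * k + 1` different columns (`ElimForest.exists_card_column_le`).
A column is determined by the set of extra edges whose tails are reachable inside the forest, and
labels on `z` vertices of a forest give rise to at most `2 * z` nonempty sets of reachable labels,
by induction along the elimination order (`ElimForest.exists_card_trace_le`).

For the programs, `Exec` is a total correctness judgement which keeps track of the running time and
of the size of the words. Pieces without loops are handled by weakest preconditions (`wp`), loops by
invariants which may mention the time that has elapsed (`Exec.for`), so that amortized bounds can be
proved.
-/

/-! ### A record view of the machine state -/

namespace RealRAM

/-- The part of a machine state which the algorithm uses, with names for the cells. The word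
variables are `n`, `m` (input sizes), `q` (number of forest edges), `k` (number of extra edges),
the counters `i`, `j`, `l`, and the scratch variables `u`, `e`, `w`, `b`, `flip`, `flag`.
The word arrays are `tl`, `hd` (tails and heads of the edges), `deg`, `xs`, `dead` (for stripping
leaves), `cu`, `cw`, `cd` (the forest), `es`, `et` (the extra edges), `B` (rows of `n` bits) and
`fin` (vertices which are already solved). The real arrays are `a` (weights), `res` (output)
and `D`, and `W` is the only real variable. -/
structure Memory where
  n : ℕ
  m : ℕ
  q : ℕ
  k : ℕ
  i : ℕ
  j : ℕ
  l : ℕ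
  u : ℕ
  e : ℕ
  w : ℕ
  b : ℕ
  flip : ℕ
  flag : ℕ
  tl : ℕ → ℕ
  hd : ℕ → ℕ
  deg : ℕ → ℕ
  xs : ℕ → ℕ
  dead : ℕ → ℕ
  cu : ℕ → ℕ
  cw : ℕ → ℕ
  cd : ℕ → ℕ
  es : ℕ → ℕ
  et : ℕ → ℕ
  B : ℕ → ℕ
  fin : ℕ → ℕ
  a : ℕ → ℝ
  res : ℕ → ℝ
  D : ℕ → ℝ
  W : ℝ

namespace Memory

/-- The machine state described by a memory record; all other cells are zero. -/
def toState (μ : Memory) : State where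
  nvar
    | 0 => μ.n
    | 1 => μ.m
    | 2 => μ.q
    | 3 => μ.k
    | 4 => μ.i
    | 5 => μ.j
    | 6 => μ.l
    | 7 => μ.u
    | 8 => μ.e
    | 9 => μ.w
    | 10 => μ.b
    | 11 => μ.flip
    | 12 => μ.flag
    | _ => 0
  narr
    | 0 => μ.tl
    | 1 => μ.hd
    | 2 => μ.deg
    | 3 => μ.xs
    | 4 => μ.dead
    | 5 => μ.cu
    | 6 => μ.cw
    | 7 => μ.cd
    | 8 => μ.es
    | 9 => μ.et
    | 10 => μ.B
    | 11 => μ.fin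
    | _ => fun _ => 0
  rvar
    | 0 => μ.W
    | _ => 0
  rarr
    | 0 => μ.a
    | 1 => μ.res
    | 2 => μ.D
    | _ => fun _ => 0

section

variable (μ : Memory)

@[simp] theorem toState_nvar_n : μ.toState.nvar 0 = μ.n := rfl
@[simp] theorem toState_nvar_m : μ.toState.nvar 1 = μ.m := rfl
@[simp] theorem toState_nvar_q : μ.toState.nvar 2 = μ.q := rfl
@[simp] theorem toState_nvar_k : μ.toState.nvar 3 = μ.k := rfl
@[simp] theorem toState_nvar_i : μ.toState.nvar 4 = μ.i := rfl
@[simp] theorem toState_nvar_j : μ.toState.nvar 5 = μ.j := rfl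
@[simp] theorem toState_nvar_l : μ.toState.nvar 6 = μ.l := rfl
@[simp] theorem toState_nvar_u : μ.toState.nvar 7 = μ.u := rfl
@[simp] theorem toState_nvar_e : μ.toState.nvar 8 = μ.e := rfl
@[simp] theorem toState_nvar_w : μ.toState.nvar 9 = μ.w := rfl
@[simp] theorem toState_nvar_b : μ.toState.nvar 10 = μ.b := rfl
@[simp] theorem toState_nvar_flip : μ.toState.nvar 11 = μ.flip := rfl
@[simp] theorem toState_nvar_flag : μ.toState.nvar 12 = μ.flag := rfl
@[simp] theorem toState_narr_tl : μ.toState.narr 0 = μ.tl := rfl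
@[simp] theorem toState_narr_hd : μ.toState.narr 1 = μ.hd := rfl
@[simp] theorem toState_narr_deg : μ.toState.narr 2 = μ.deg := rfl
@[simp] theorem toState_narr_xs : μ.toState.narr 3 = μ.xs := rfl
@[simp] theorem toState_narr_dead : μ.toState.narr 4 = μ.dead := rfl
@[simp] theorem toState_narr_cu : μ.toState.narr 5 = μ.cu := rfl
@[simp] theorem toState_narr_cw : μ.toState.narr 6 = μ.cw := rfl
@[simp] theorem toState_narr_cd : μ.toState.narr 7 = μ.cd := rfl
@[simp] theorem toState_narr_es : μ.toState.narr 8 = μ.es := rfl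
@[simp] theorem toState_narr_et : μ.toState.narr 9 = μ.et := rfl
@[simp] theorem toState_narr_B : μ.toState.narr 10 = μ.B := rfl
@[simp] theorem toState_narr_fin : μ.toState.narr 11 = μ.fin := rfl
@[simp] theorem toState_rvar_W : μ.toState.rvar 0 = μ.W := rfl
@[simp] theorem toState_rarr_a : μ.toState.rarr 0 = μ.a := rfl
@[simp] theorem toState_rarr_res : μ.toState.rarr 1 = μ.res := rfl
@[simp] theorem toState_rarr_D : μ.toState.rarr 2 = μ.D := rfl

end

/-- Assignment to a word variable. -/
def setN (μ : Memory) (x v : ℕ) : Memory :=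
  match x with
  | 0 => { μ with n := v }
  | 1 => { μ with m := v }
  | 2 => { μ with q := v }
  | 3 => { μ with k := v }
  | 4 => { μ with i := v }
  | 5 => { μ with j := v }
  | 6 => { μ with l := v }
  | 7 => { μ with u := v }
  | 8 => { μ with e := v }
  | 9 => { μ with w := v }
  | 10 => { μ with b := v }
  | 11 => { μ with flip := v }
  | 12 => { μ with flag := v }
  | _ => μ

/-- Assignment to a cell of a word array. -/
def putN (μ : Memory) (A i v : ℕ) : Memory :=
  match A with
  | 0 => { μ with tl := Function.update μ.tl i v }
  | 1 => { μ with hd := Function.update μ.hd i v }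
  | 2 => { μ with deg := Function.update μ.deg i v }
  | 3 => { μ with xs := Function.update μ.xs i v }
  | 4 => { μ with dead := Function.update μ.dead i v }
  | 5 => { μ with cu := Function.update μ.cu i v }
  | 6 => { μ with cw := Function.update μ.cw i v }
  | 7 => { μ with cd := Function.update μ.cd i v }
  | 8 => { μ with es := Function.update μ.es i v }
  | 9 => { μ with et := Function.update μ.et i v }
  | 10 => { μ with B := Function.update μ.B i v }
  | 11 => { μ with fin := Function.update μ.fin i v }
  | _ => μ

/-- Assignment to a real variable. -/
def setR (μ : Memory) (x : ℕ) (v : ℝ) : Memory :=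
  match x with
  | 0 => { μ with W := v }
  | _ => μ

/-- Assignment to a cell of a real array. -/
def putR (μ : Memory) (A i : ℕ) (v : ℝ) : Memory :=
  match A with
  | 0 => { μ with a := Function.update μ.a i v }
  | 1 => { μ with res := Function.update μ.res i v }
  | 2 => { μ with D := Function.update μ.D i v }
  | _ => μ

theorem toState_setN (μ : Memory) {x : ℕ} (hx : x < 13) (v : ℕ) :
    { μ.toState with nvar := Function.update μ.toState.nvar x v } = (μ.setN x v).toState := by
  interval_cases x <;> simp only [toState, setN, State.mk.injEq, and_true] <;> funext y <;>
    rcases y with _|_|_|_|_|_|_|_|_|_|_|_|_|_ <;> simp [Function.update]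

theorem toState_putN (μ : Memory) {A : ℕ} (hA : A < 12) (i v : ℕ) :
    { μ.toState with narr :=
        (Function.update μ.toState.narr A (Function.update (μ.toState.narr A) i v)) } =
      (μ.putN A i v).toState := by
  interval_cases A <;> simp only [toState, putN, State.mk.injEq, and_true, true_and] <;>
    funext y <;> rcases y with _|_|_|_|_|_|_|_|_|_|_|_|_ <;> simp [Function.update]

theorem toState_setR (μ : Memory) {x : ℕ} (hx : x < 1) (v : ℝ) :
    { μ.toState with rvar := Function.update μ.toState.rvar x v } = (μ.setR x v).toState := by
  interval_cases x
  simp only [toState, setR, State.mk.injEq, and_true, true_and]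
  funext y
  rcases y with _|_ <;> simp [Function.update]

theorem toState_putR (μ : Memory) {A : ℕ} (hA : A < 3) (i : ℕ) (v : ℝ) :
    { μ.toState with rarr :=
        (Function.update μ.toState.rarr A (Function.update (μ.toState.rarr A) i v)) } =
      (μ.putR A i v).toState := by
  interval_cases A <;> simp only [toState, putR, State.mk.injEq, true_and] <;>
    funext y <;> rcases y with _|_|_|_ <;> simp [Function.update]

end Memory

/-! ### Program logic -/

/-- `Exec N P μ Q`: started in `μ`, the program `P` halts, within the bounds given by `N`, after
some number `t` of steps in a state described by some `μ'` such that `Q t μ'`. -/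
def Exec (N : ℕ) (P : Prog) (μ : Memory) (Q : ℕ → Memory → Prop) : Prop :=
  ∃ t μ', Run N P μ.toState t μ'.toState ∧ Q t μ'

theorem Exec.mono {N : ℕ} {P : Prog} {μ : Memory} {Q Q' : ℕ → Memory → Prop}
    (h : Exec N P μ Q) (hQ : ∀ t μ', Q t μ' → Q' t μ') : Exec N P μ Q' := by
  obtain ⟨t, μ', h1, h2⟩ := h
  exact ⟨t, μ', h1, hQ _ _ h2⟩

theorem Exec.setN {N x : ℕ} {e : WordExpr} {μ : Memory} {Q : ℕ → Memory → Prop} (hx : x < 13)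
    (he : e.Fits N μ.toState) (hQ : Q (e.cost + 1) (μ.setN x (e.eval μ.toState))) :
    Exec N (.setN x e) μ Q :=
  ⟨_, _, Memory.toState_setN μ hx _ ▸ Run.setN x e _ he, hQ⟩

theorem Exec.seq {N : ℕ} {P P' : Prog} {μ : Memory} {Q : ℕ → Memory → Prop}
    (h : Exec N P μ fun t μ' => Exec N P' μ' fun t' μ'' => Q (t + t') μ'') :
    Exec N (.seq P P') μ Q := by
  obtain ⟨t, μ', h1, t', μ'', h2, h3⟩ := h
  exact ⟨_, _, h1.seq h2, h3⟩

theorem Exec.ite {N : ℕ} {c : WordExpr} {P P' : Prog} {μ : Memory} {Q : ℕ → Memory → Prop}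
    (hc : c.Fits N μ.toState)
    (h1 : c.eval μ.toState ≠ 0 → Exec N P μ fun t μ' => Q (c.cost + 1 + t) μ')
    (h2 : c.eval μ.toState = 0 → Exec N P' μ fun t μ' => Q (c.cost + 1 + t) μ') :
    Exec N (.ite c P P') μ Q := by
  by_cases h0 : c.eval μ.toState = 0
  · obtain ⟨t, μ', h3, h4⟩ := h2 h0
    exact ⟨_, _, .ite_false hc h0 h3, h4⟩
  · obtain ⟨t, μ', h3, h4⟩ := h1 h0
    exact ⟨_, _, .ite_true hc h0 h3, h4⟩

/-- An upper bound for the number of steps of a program without loops. The value `0` for loops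
means nothing; `wp` excludes them. -/
def Prog.size : Prog → ℕ
  | .skip => 1
  | .setN _ e => e.cost + 1
  | .putN _ i e => i.cost + e.cost + 1
  | .setR _ e => e.cost + 1
  | .putR _ i e => i.cost + e.cost + 1
  | .seq P P' => P.size + P'.size
  | .ite c P P' => c.cost + 1 + (P.size + P'.size)
  | .loop _ _ => 0

/-- The weakest precondition of a program without loops. -/
def wp (N : ℕ) : Prog → (Memory → Prop) → Memory → Prop
  | .skip, Q, μ => Q μ
  | .setN x e, Q, μ => x < 13 ∧ e.Fits N μ.toState ∧ Q (μ.setN x (e.eval μ.toState))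
  | .putN A i e, Q, μ => A < 12 ∧ i.Fits N μ.toState ∧ e.Fits N μ.toState ∧
      Q (μ.putN A (i.eval μ.toState) (e.eval μ.toState))
  | .setR x e, Q, μ => x < 1 ∧ e.Fits N μ.toState ∧ Q (μ.setR x (e.eval μ.toState))
  | .putR A i e, Q, μ => A < 3 ∧ i.Fits N μ.toState ∧ e.Fits N μ.toState ∧
      Q (μ.putR A (i.eval μ.toState) (e.eval μ.toState))
  | .seq P P', Q, μ => wp N P (wp N P' Q) μ
  | .ite c P P', Q, μ => c.Fits N μ.toState ∧
      (c.eval μ.toState ≠ 0 → wp N P Q μ) ∧ (c.eval μ.toState = 0 → wp N P' Q μ)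
  | .loop _ _, _, _ => False

theorem wp_mono {N : ℕ} {P : Prog} {Q Q' : Memory → Prop} (hQ : ∀ μ, Q μ → Q' μ) :
    ∀ {μ : Memory}, wp N P Q μ → wp N P Q' μ := by
  induction P generalizing Q Q' with
  | skip => exact fun {μ} h => hQ μ h
  | setN x e => exact fun {μ} h => ⟨h.1, h.2.1, hQ _ h.2.2⟩
  | putN A i e => exact fun {μ} h => ⟨h.1, h.2.1, h.2.2.1, hQ _ h.2.2.2⟩
  | setR x e => exact fun {μ} h => ⟨h.1, h.2.1, hQ _ h.2.2⟩
  | putR A i e => exact fun {μ} h => ⟨h.1, h.2.1, h.2.2.1, hQ _ h.2.2.2⟩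
  | seq P P' ih ih' => exact fun {μ} h => ih (fun μ' => ih' hQ) h
  | ite c P P' ih ih' => exact fun {μ} h => ⟨h.1, fun h0 => ih hQ (h.2.1 h0),
      fun h0 => ih' hQ (h.2.2 h0)⟩
  | loop => exact fun {μ} h => h.elim

theorem exec_of_wp {N : ℕ} {P : Prog} : ∀ {Q : Memory → Prop} {μ : Memory}, wp N P Q μ →
    Exec N P μ fun t μ' => t ≤ P.size ∧ Q μ' := by
  induction P with
  | skip => exact fun h => ⟨_, _, .skip _, le_rfl, h⟩
  | setN x e =>
    rintro Q μ ⟨h1, h2, h3⟩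
    exact ⟨_, _, Memory.toState_setN μ h1 _ ▸ Run.setN x e _ h2, le_rfl, h3⟩
  | putN A i e =>
    rintro Q μ ⟨h1, h2, h3, h4⟩
    exact ⟨_, _, Memory.toState_putN μ h1 _ _ ▸ Run.putN A i e _ h2 h3, le_rfl, h4⟩
  | setR x e =>
    rintro Q μ ⟨h1, h2, h3⟩
    exact ⟨_, _, Memory.toState_setR μ h1 _ ▸ Run.setR x e _ h2, le_rfl, h3⟩
  | putR A i e =>
    rintro Q μ ⟨h1, h2, h3, h4⟩
    exact ⟨_, _, Memory.toState_putR μ h1 _ _ ▸ Run.putR A i e _ h2 h3, le_rfl, h4⟩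
  | seq P P' ih ih' =>
    intro Q μ h
    refine Exec.seq ((ih h).mono fun t μ' ⟨h1, h2⟩ => (ih' h2).mono fun t' μ'' ⟨h3, h4⟩ =>
      ⟨Nat.add_le_add h1 h3, h4⟩)
  | ite c P P' ih ih' =>
    rintro Q μ ⟨h1, h2, h3⟩
    refine Exec.ite h1 (fun h0 => (ih (h2 h0)).mono fun t μ' h => ?_)
      (fun h0 => (ih' (h3 h0)).mono fun t μ' h => ?_)
    · exact ⟨by simp only [Prog.size]; omega, h.2⟩
    · exact ⟨by simp only [Prog.size]; omega, h.2⟩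
  | loop => exact fun h => h.elim

/-- The rule for loops. The invariant `I` may speak of the time `t` elapsed so far, which is what
amortized time bounds need; `φ` is a variant that only ensures termination. -/
theorem Exec.loop {N : ℕ} {c : WordExpr} {P : Prog} (I : ℕ → Memory → Prop) (φ : Memory → ℕ)
    (hI : ∀ t μ, I t μ → c.Fits N μ.toState ∧ (c.eval μ.toState ≠ 0 →
      Exec N P μ fun t' μ' => φ μ' < φ μ ∧ I (t + (c.cost + 1 + t')) μ')) :
    ∀ {μ : Memory} {t₀ : ℕ}, I t₀ μ → Exec N (.loop c P) μ fun t μ' =>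
      c.eval μ'.toState = 0 ∧ ∃ t₁, I t₁ μ' ∧ t₀ + t = t₁ + (c.cost + 1) := by
  suffices ∀ d μ t₀, φ μ ≤ d → I t₀ μ → Exec N (.loop c P) μ fun t μ' =>
      c.eval μ'.toState = 0 ∧ ∃ t₁, I t₁ μ' ∧ t₀ + t = t₁ + (c.cost + 1) from
    fun {μ t₀} h => this _ μ t₀ le_rfl h
  intro d
  induction d with
  | zero =>
    intro μ t₀ hd h
    obtain ⟨hc, hs⟩ := hI _ _ h
    by_cases h0 : c.eval μ.toState = 0
    · exact ⟨_, _, .loop_false hc h0, h0, t₀, h, rfl⟩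
    · obtain ⟨t, μ', -, h2, -⟩ := hs h0
      omega
  | succ d ih =>
    intro μ t₀ hd h
    obtain ⟨hc, hs⟩ := hI _ _ h
    by_cases h0 : c.eval μ.toState = 0
    · exact ⟨_, _, .loop_false hc h0, h0, t₀, h, rfl⟩
    · obtain ⟨t, μ', h1, h2, h3⟩ := hs h0
      obtain ⟨t', μ'', h4, h5, t₁, h6, h7⟩ := ih μ' _ (by omega) h3
      exact ⟨_, _, .loop_true hc h0 h1 h4, h5, t₁, h6, by omega⟩

instance : Add WordExpr := ⟨.op .add⟩
instance : Sub WordExpr := ⟨.op .sub⟩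
instance : Mul WordExpr := ⟨.op .mul⟩

namespace WordExpr

/-- The test `e₁ < e₂`. -/
abbrev lt (e₁ e₂ : WordExpr) : WordExpr := .op .lt e₁ e₂

/-- The test `e₁ = e₂`. -/
abbrev eq (e₁ e₂ : WordExpr) : WordExpr := .op .eq e₁ e₂

variable {N : ℕ} {s : State} (e₁ e₂ : WordExpr)

@[simp] theorem eval_add : (e₁ + e₂).eval s = e₁.eval s + e₂.eval s := rfl
@[simp] theorem eval_sub : (e₁ - e₂).eval s = e₁.eval s - e₂.eval s := rfl
@[simp] theorem eval_mul : (e₁ * e₂).eval s = e₁.eval s * e₂.eval s := rfl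

@[simp] theorem fits_add : (e₁ + e₂).Fits N s ↔
    e₁.Fits N s ∧ e₂.Fits N s ∧ e₁.eval s + e₂.eval s < N := Iff.rfl
@[simp] theorem fits_sub : (e₁ - e₂).Fits N s ↔
    e₁.Fits N s ∧ e₂.Fits N s ∧ e₁.eval s - e₂.eval s < N := Iff.rfl
@[simp] theorem fits_mul : (e₁ * e₂).Fits N s ↔
    e₁.Fits N s ∧ e₂.Fits N s ∧ e₁.eval s * e₂.eval s < N := Iff.rfl

end WordExpr

/-- `for x in [0, y) do P`, for word variables `x` and `y`. -/
def Prog.for (x y : ℕ) (P : Prog) : Prog :=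
  .seq (.setN x (.const 0))
    (.loop (.lt (.var x) (.var y)) (.seq P (.setN x (.var x + .const 1))))

/-- The rule for counted loops. The invariant `I i t` speaks of the situation after `i` rounds,
when `t` steps have elapsed; every round costs `8` steps in addition to those of the body. -/
theorem Exec.for {N x y d : ℕ} {P : Prog} {μ : Memory} (I : ℕ → ℕ → Memory → Prop)
    (hx : x < 13) (hd : d < N)
    (hI : ∀ i t μ, I i t μ → i ≤ d ∧ μ.toState.nvar x = i ∧ μ.toState.nvar y = d)
    (h0 : I 0 2 (μ.setN x 0))
    (hP : ∀ i < d, ∀ t μ, I i t μ → Exec N P μ fun t' μ' => μ'.toState.nvar x = i ∧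
      I (i + 1) (t + t' + 8) (μ'.setN x (i + 1))) :
    Exec N (.for x y P) μ fun t μ' => ∃ t' ≤ t, t = t' + 4 ∧ I d t' μ' := by
  refine Exec.seq (Exec.setN hx (by simp only [WordExpr.Fits]; omega) ?_)
  refine (Exec.loop (fun t μ => ∃ i, I i t μ) (fun μ => d - μ.toState.nvar x) ?_ ⟨0, h0⟩).mono ?_
  · rintro t μ ⟨i, hi⟩
    obtain ⟨h1, h2, h3⟩ := hI _ _ _ hi
    refine ⟨?_, ?_⟩
    · simp only [WordExpr.Fits, WordExpr.eval, WordOp.eval, h2, h3]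
      split_ifs <;> omega
    · intro h
      have hid : i < d := by
        by_contra hid
        simp [WordExpr.eval, WordOp.eval, h2, h3, hid] at h
      refine Exec.seq ((hP i hid t μ hi).mono ?_)
      rintro t' μ' ⟨h4, h5⟩
      refine Exec.setN hx ?_ ?_
      · simp only [WordExpr.Fits, WordExpr.eval, WordOp.eval, h4]
        omega
      · have h6 : (WordExpr.var x + WordExpr.const 1).eval μ'.toState = i + 1 := by
          simp [WordExpr.eval, WordOp.eval, h4]
        rw [h6]
        obtain ⟨-, h7, -⟩ := hI _ _ _ h5
        refine ⟨by rw [h7, h2]; omega, i + 1, ?_⟩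
        simp only [WordExpr.cost]
        convert h5 using 1
        omega
  · rintro t μ' ⟨h1, t₁, ⟨i, hi⟩, h2⟩
    obtain ⟨h3, h4, h5⟩ := hI _ _ _ hi
    have hid : i = d := by
      by_contra hid
      have : i < d := by omega
      simp [WordExpr.eval, WordOp.eval, h4, h5, this] at h1
    subst hid
    simp only [WordExpr.cost] at h2
    simp only [WordExpr.cost]
    exact ⟨t₁, by omega, by omega, hi⟩

/-- The rule for counted loops whose body takes at most `T` steps. -/
theorem Exec.for_const {N x y d T : ℕ} {P : Prog} {μ : Memory} (I : ℕ → Memory → Prop)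
    (hx : x < 13) (hd : d < N)
    (hI : ∀ i μ, I i μ → μ.toState.nvar x = i ∧ μ.toState.nvar y = d)
    (h0 : I 0 (μ.setN x 0))
    (hP : ∀ i < d, ∀ μ, I i μ → Exec N P μ fun t' μ' => t' ≤ T ∧ μ'.toState.nvar x = i ∧
      I (i + 1) (μ'.setN x (i + 1))) :
    Exec N (.for x y P) μ fun t μ' => t ≤ d * (T + 8) + 6 ∧ I d μ' := by
  refine (Exec.for (d := d) (fun i t μ => i ≤ d ∧ t ≤ i * (T + 8) + 2 ∧ I i μ)
    hx hd ?_ ?_ ?_).mono ?_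
  · rintro i t μ ⟨h1, h2, h3⟩
    exact ⟨h1, hI _ _ h3⟩
  · exact ⟨by omega, by omega, h0⟩
  · rintro i hi t μ ⟨h1, h2, h3⟩
    refine (hP i hi μ h3).mono ?_
    rintro t' μ' ⟨h4, h5, h6⟩
    exact ⟨h5, hi, by rw [Nat.succ_mul]; omega, h6⟩
  · rintro t μ' ⟨t', -, rfl, -, h2, h3⟩
    exact ⟨by omega, h3⟩

end RealRAM

/-! ### Reachability along an elimination order -/

open Relation

/-- Reachability after the edge from `s` to `t` is added. -/
theorem reflTransGen_add_edge {α : Type*} {R R' : α → α → Prop} {s t : α}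
    (h : ∀ x y, R' x y ↔ R x y ∨ (x = s ∧ y = t)) (x y : α) :
    ReflTransGen R' x y ↔ ReflTransGen R x y ∨ (ReflTransGen R x s ∧ ReflTransGen R t y) := by
  have hmono : ∀ {a b}, ReflTransGen R a b → ReflTransGen R' a b := fun hab =>
    ReflTransGen.mono (fun a b hr => (h a b).2 (.inl hr)) _ _ hab
  refine ⟨fun hxy => ?_, ?_⟩
  · induction hxy with
    | refl => exact .inl .refl
    | tail _ hbc ih =>
      rcases (h _ _).1 hbc with hbc | ⟨rfl, rfl⟩
      · exact ih.imp (·.tail hbc) (fun ⟨h1, h2⟩ => ⟨h1, h2.tail hbc⟩)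
      · exact ih.elim (fun h1 => .inr ⟨h1, .refl⟩) (fun h1 => .inr ⟨h1.1, .refl⟩)
  · rintro (h1 | ⟨h1, h2⟩)
    · exact hmono h1
    · exact ((hmono h1).tail ((h _ _).2 (.inr ⟨rfl, rfl⟩))).trans (hmono h2)

theorem reflTransGen_eq_of_not_left {α : Type*} {R : α → α → Prop} {u y : α}
    (h : ∀ y, ¬ R u y) (huy : ReflTransGen R u y) : y = u := by
  rcases huy.cases_head with h1 | ⟨c, h1, -⟩
  · exact h1.symm
  · exact (h _ h1).elim

theorem reflTransGen_eq_of_not_right {α : Type*} {R : α → α → Prop} {u x : α}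
    (h : ∀ x, ¬ R x u) (hxu : ReflTransGen R x u) : x = u := by
  rcases hxu.cases_tail with h1 | ⟨c, -, h1⟩
  · exact h1.symm
  · exact (h _ h1).elim

/-- An oriented forest on `0, …, n - 1` in the form of an elimination order: in round `i < q` a
vertex `cu i` of degree one is deleted together with its edge, whose other end is `cw i`. The edge
is directed from `cu i` to `cw i` if `up i`, and from `cw i` to `cu i` otherwise. -/
structure ElimForest where
  n : ℕ
  q : ℕ
  cu : ℕ → ℕ
  cw : ℕ → ℕ
  up : ℕ → Prop
  cu_lt : ∀ i < q, cu i < n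
  cw_lt : ∀ i < q, cw i < n
  cu_ne_cu : ∀ i j, i < j → j < q → cu i ≠ cu j
  cu_ne_cw : ∀ i j, i ≤ j → j < q → cu i ≠ cw j

namespace ElimForest

variable (T : ElimForest)

/-- The edges which remain after `i` rounds. -/
def Edge (i x y : ℕ) : Prop :=
  ∃ j, i ≤ j ∧ j < T.q ∧ ((T.up j ∧ x = T.cu j ∧ y = T.cw j) ∨
    (¬ T.up j ∧ x = T.cw j ∧ y = T.cu j))

/-- Reachability in the forest which remains after `i` rounds. -/
def Reach (i : ℕ) : ℕ → ℕ → Prop := ReflTransGen (T.Edge i)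

/-- The forest with all edges reversed. -/
def reverse : ElimForest := { T with up := fun i => ¬ T.up i }

theorem reverse_edge (i x y : ℕ) : T.reverse.Edge i x y ↔ T.Edge i y x := by
  simp only [Edge, reverse, not_not]
  constructor <;> rintro ⟨j, h1, h2, h3⟩ <;> exact ⟨j, h1, h2, by tauto⟩

theorem reverse_reach (i x y : ℕ) : T.reverse.Reach i x y ↔ T.Reach i y x := by
  have h : T.reverse.Edge i = Function.swap (T.Edge i) := by
    funext x y
    exact propext (T.reverse_edge i x y)
  rw [Reach, h, reflTransGen_swap, Reach]

variable {T} {i : ℕ}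

theorem card_le : T.q ≤ T.n := by
  have h : ((Finset.range T.q).image T.cu).card = T.q := by
    rw [Finset.card_image_of_injOn, Finset.card_range]
    intro a ha b hb hab
    simp only [Finset.coe_range, Set.mem_Iio] at ha hb
    rcases lt_trichotomy a b with h | h | h
    · exact (T.cu_ne_cu a b h hb hab).elim
    · exact h
    · exact (T.cu_ne_cu b a h ha hab.symm).elim
  rw [← h, ← Finset.card_range T.n]
  refine Finset.card_le_card fun x hx => ?_
  obtain ⟨j, hj, rfl⟩ := Finset.mem_image.1 hx
  exact Finset.mem_range.2 (T.cu_lt j (Finset.mem_range.1 hj))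

theorem not_edge_cu_left (y : ℕ) : ¬ T.Edge (i + 1) (T.cu i) y := by
  rintro ⟨j, h1, h2, ⟨-, h3, -⟩ | ⟨-, h3, -⟩⟩
  · exact T.cu_ne_cu i j h1 h2 h3
  · exact T.cu_ne_cw i j (by omega) h2 h3

theorem not_edge_cu_right (x : ℕ) : ¬ T.Edge (i + 1) x (T.cu i) := by
  rintro ⟨j, h1, h2, ⟨-, -, h3⟩ | ⟨-, -, h3⟩⟩
  · exact T.cu_ne_cw i j (by omega) h2 h3
  · exact T.cu_ne_cu i j h1 h2 h3

theorem reach_cu_left (y : ℕ) : T.Reach (i + 1) (T.cu i) y ↔ y = T.cu i :=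
  ⟨reflTransGen_eq_of_not_left (not_edge_cu_left), fun h => h ▸ .refl⟩

theorem reach_cu_right (x : ℕ) : T.Reach (i + 1) x (T.cu i) ↔ x = T.cu i :=
  ⟨reflTransGen_eq_of_not_right (not_edge_cu_right), fun h => h ▸ .refl⟩

theorem edge_last (h : T.q ≤ i) (x y : ℕ) : ¬ T.Edge i x y := by
  rintro ⟨j, h1, h2, -⟩
  omega

theorem reach_last (h : T.q ≤ i) (x y : ℕ) : T.Reach i x y ↔ y = x :=
  ⟨reflTransGen_eq_of_not_left (edge_last h x), fun h => h ▸ .refl⟩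

theorem reach_up (hi : i < T.q) (hu : T.up i) (x y : ℕ) :
    T.Reach i x y ↔ T.Reach (i + 1) x y ∨ (x = T.cu i ∧ T.Reach (i + 1) (T.cw i) y) := by
  rw [← reach_cu_right x]
  refine reflTransGen_add_edge (fun a b => ⟨?_, ?_⟩) x y
  · rintro ⟨j, h1, h2, h3⟩
    rcases Nat.eq_or_lt_of_le h1 with rfl | h1
    · exact .inr (by tauto)
    · exact .inl ⟨j, h1, h2, h3⟩
  · rintro (⟨j, h1, h2, h3⟩ | ⟨rfl, rfl⟩)
    · exact ⟨j, by omega, h2, h3⟩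
    · exact ⟨i, le_rfl, hi, .inl ⟨hu, rfl, rfl⟩⟩

theorem reach_down (hi : i < T.q) (hu : ¬ T.up i) (x y : ℕ) :
    T.Reach i x y ↔ T.Reach (i + 1) x y ∨ (T.Reach (i + 1) x (T.cw i) ∧ y = T.cu i) := by
  rw [← reach_cu_left y]
  refine reflTransGen_add_edge (fun a b => ⟨?_, ?_⟩) x y
  · rintro ⟨j, h1, h2, h3⟩
    rcases Nat.eq_or_lt_of_le h1 with rfl | h1
    · exact .inr (by tauto)
    · exact .inl ⟨j, h1, h2, h3⟩
  · rintro (⟨j, h1, h2, h3⟩ | ⟨rfl, rfl⟩)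
    · exact ⟨j, by omega, h2, h3⟩
    · exact ⟨i, le_rfl, hi, .inr ⟨hu, rfl, rfl⟩⟩

/-! ### Sums over reachable sets in a forest -/

section Sum

variable {M : Type*} [AddCommMonoid M]

open Classical in
/-- The sum of `D` over the vertices reachable from `v` after `i` rounds. -/
noncomputable def val (T : ElimForest) (i : ℕ) (D : ℕ → M) (v : ℕ) : M :=
  ∑ y ∈ (Finset.range T.n).filter (fun y => T.Reach i v y), D y

theorem val_last (D : ℕ → M) {v : ℕ} (hv : v < T.n) : T.val T.q D v = D v := by
  classical
  rw [val, Finset.sum_eq_single_of_mem v]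
  · simpa using ⟨hv, .refl⟩
  · intro b hb hbv
    exact (hbv ((reach_last le_rfl _ _).1 (Finset.mem_filter.1 hb).2)).elim

theorem val_cu_up (D : ℕ → M) (hi : i < T.q) (hu : T.up i) :
    T.val i D (T.cu i) = D (T.cu i) + T.val (i + 1) D (T.cw i) := by
  classical
  have h : (Finset.range T.n).filter (fun y => T.Reach i (T.cu i) y) =
      insert (T.cu i) ((Finset.range T.n).filter fun y => T.Reach (i + 1) (T.cw i) y) := by
    ext y
    have := T.cu_lt i hi
    simp only [Finset.mem_filter, Finset.mem_range, Finset.mem_insert, reach_up hi hu,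
      reach_cu_left, true_and]
    constructor
    · tauto
    · rintro (rfl | h) <;> tauto
  rw [val, h, Finset.sum_insert, val]
  simp only [Finset.mem_filter, reach_cu_right, not_and]
  exact fun _ h => T.cu_ne_cw i i le_rfl hi h.symm

theorem val_cu_down (D : ℕ → M) (hi : i < T.q) (hu : ¬ T.up i) :
    T.val i D (T.cu i) = D (T.cu i) := by
  classical
  rw [val, Finset.sum_eq_single_of_mem (T.cu i)]
  · simpa using ⟨T.cu_lt i hi, .refl⟩
  · intro b hb hbv
    rw [Finset.mem_filter, reach_down hi hu, reach_cu_left] at hb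
    tauto

theorem val_up (D : ℕ → M) (hi : i < T.q) (hu : T.up i) {v : ℕ} (hv : v ≠ T.cu i) :
    T.val i D v = T.val (i + 1) D v := by
  classical
  rw [val, val]
  refine Finset.sum_congr (Finset.filter_congr fun y _ => ?_) fun _ _ => rfl
  rw [reach_up hi hu]
  tauto

theorem val_down (D : ℕ → M) (hi : i < T.q) (hu : ¬ T.up i) {v : ℕ} (hv : v ≠ T.cu i) :
    T.val i D v = T.val (i + 1)
      (Function.update D (T.cw i) (D (T.cw i) + D (T.cu i))) v := by
  classical
  have hcw := T.cw_lt i hi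
  have hcu := T.cu_lt i hi
  have hne := T.cu_ne_cw i i le_rfl hi
  have hvu : ¬ T.Reach (i + 1) v (T.cu i) := by rwa [reach_cu_right]
  by_cases h : T.Reach (i + 1) v (T.cw i)
  · have h1 : (Finset.range T.n).filter (fun y => T.Reach i v y) =
        insert (T.cu i) ((Finset.range T.n).filter fun y => T.Reach (i + 1) v y) := by
      ext y
      simp only [Finset.mem_filter, Finset.mem_range, Finset.mem_insert, reach_down hi hu]
      constructor
      · tauto
      · rintro (rfl | h) <;> tauto
    rw [val, h1, Finset.sum_insert (by simp [hvu]), val,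
      Finset.sum_update_of_mem (by simp [hcw, h]),
      ← Finset.add_sum_erase _ _ (a := T.cw i) (by simp [hcw, h]), Finset.sdiff_singleton_eq_erase]
    abel
  · rw [val, val]
    have h1 : (Finset.range T.n).filter (fun y => T.Reach i v y) =
        (Finset.range T.n).filter fun y => T.Reach (i + 1) v y := by
      refine Finset.filter_congr fun y _ => ?_
      rw [reach_down hi hu]
      tauto
    rw [h1]
    refine Finset.sum_congr rfl fun y hy => ?_
    rw [Function.update_of_ne]
    rintro rfl
    exact h (Finset.mem_filter.1 hy).2

/-- The invariant of the first of two passes which turn the array `a` in place into the array of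
sums over reachable sets: after `i` rounds, the weights of deleted vertices have been moved so that
the sums can be recovered. -/
def Pass₁ (T : ElimForest) (a : ℕ → M) (i : ℕ) (D : ℕ → M) : Prop :=
  (∀ v < T.n, (∀ j < i, v ≠ T.cu j) → T.val 0 a v = T.val i D v) ∧
  (∀ j < i, (T.up j → T.val 0 a (T.cu j) = D (T.cu j) + T.val 0 a (T.cw j)) ∧
    (¬ T.up j → T.val 0 a (T.cu j) = D (T.cu j)))

/-- The invariant of the second pass, which runs through the rounds in reverse order: when
the rounds from `i` on have been treated, the vertices that are not deleted before round `i` carry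
their final values. -/
def Pass₂ (T : ElimForest) (a : ℕ → M) (i : ℕ) (D : ℕ → M) : Prop :=
  (∀ v < T.n, (∀ j < i, v ≠ T.cu j) → D v = T.val 0 a v) ∧
  (∀ j < i, (T.up j → T.val 0 a (T.cu j) = D (T.cu j) + T.val 0 a (T.cw j)) ∧
    (¬ T.up j → T.val 0 a (T.cu j) = D (T.cu j)))

theorem pass₁_zero (a : ℕ → M) : T.Pass₁ a 0 a :=
  ⟨fun _ _ _ => rfl, fun _ h => absurd h (Nat.not_lt_zero _)⟩

theorem Pass₁.up {a D : ℕ → M} (h : T.Pass₁ a i D) (hi : i < T.q) (hu : T.up i) :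
    T.Pass₁ a (i + 1) D := by
  refine ⟨fun v hv hj => ?_, fun j hj => ?_⟩
  · rw [h.1 v hv fun j hj' => hj j (by omega), val_up D hi hu (hj i (by omega))]
  · rcases Nat.lt_succ_iff_lt_or_eq.1 hj with hj | rfl
    · exact h.2 j hj
    · refine ⟨fun _ => ?_, fun h' => absurd hu h'⟩
      rw [h.1 _ (T.cu_lt j hi) fun l hl => (T.cu_ne_cu l j hl hi).symm,
        h.1 _ (T.cw_lt j hi) fun l hl => (T.cu_ne_cw l j hl.le hi).symm, val_cu_up D hi hu,
        val_up D hi hu (T.cu_ne_cw j j le_rfl hi).symm]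

theorem Pass₁.down {a D : ℕ → M} (h : T.Pass₁ a i D) (hi : i < T.q) (hu : ¬ T.up i) :
    T.Pass₁ a (i + 1) (Function.update D (T.cw i) (D (T.cw i) + D (T.cu i))) := by
  refine ⟨fun v hv hj => ?_, fun j hj => ?_⟩
  · rw [h.1 v hv fun j hj' => hj j (by omega), val_down D hi hu (hj i (by omega))]
  · have hne : T.cu j ≠ T.cw i := T.cu_ne_cw j i (by omega) hi
    rw [Function.update_of_ne hne]
    rcases Nat.lt_succ_iff_lt_or_eq.1 hj with hj | rfl
    · exact h.2 j hj
    · refine ⟨fun h' => absurd h' hu, fun _ => ?_⟩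
      rw [h.1 _ (T.cu_lt j hi) fun l hl => (T.cu_ne_cu l j hl hi).symm, val_cu_down D hi hu]

theorem Pass₁.pass₂ {a D : ℕ → M} (h : T.Pass₁ a T.q D) : T.Pass₂ a T.q D :=
  ⟨fun v hv hj => by rw [h.1 v hv hj, val_last D hv], h.2⟩

theorem Pass₂.up {a D : ℕ → M} (h : T.Pass₂ a (i + 1) D) (hi : i < T.q) (hu : T.up i) :
    T.Pass₂ a i (Function.update D (T.cu i) (D (T.cu i) + D (T.cw i))) := by
  refine ⟨fun v hv hj => ?_, fun j hj => ?_⟩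
  · by_cases hvi : v = T.cu i
    · subst hvi
      rw [Function.update_self, (h.2 i (by omega)).1 hu, h.1 _ (T.cw_lt i hi)]
      exact fun j hj => (T.cu_ne_cw j i (by omega) hi).symm
    · rw [Function.update_of_ne hvi, h.1 v hv]
      intro j hj'
      rcases Nat.lt_succ_iff_lt_or_eq.1 hj' with hj' | rfl
      · exact hj j hj'
      · exact hvi
  · rw [Function.update_of_ne (T.cu_ne_cu j i hj hi)]
    exact h.2 j (by omega)

theorem Pass₂.down {a D : ℕ → M} (h : T.Pass₂ a (i + 1) D) (hi : i < T.q) (hu : ¬ T.up i) :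
    T.Pass₂ a i D := by
  refine ⟨fun v hv hj => ?_, fun j hj => h.2 j (by omega)⟩
  by_cases hvi : v = T.cu i
  · subst hvi
    exact ((h.2 i (by omega)).2 hu).symm
  · refine h.1 v hv ?_
    intro j hj'
    rcases Nat.lt_succ_iff_lt_or_eq.1 hj' with hj' | rfl
    · exact hj j hj'
    · exact hvi

/-- During both passes no cell exceeds the largest final value. This keeps the machine words
small. -/
theorem le_of_add_bound {a D : ℕ → ℕ} {b : ℕ} (hb : ∀ v < T.n, T.val 0 a v ≤ b)
    (h : T.Pass₁ a i D ∨ T.Pass₂ a i D) {v : ℕ} (hv : v < T.n) : D v ≤ b := by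
  classical
  have key : (∀ j < i, (T.up j → T.val 0 a (T.cu j) = D (T.cu j) + T.val 0 a (T.cw j)) ∧
    (¬ T.up j → T.val 0 a (T.cu j) = D (T.cu j))) → (∃ j < i, v = T.cu j) → D v ≤ b := by
    rintro h ⟨j, hj, rfl⟩
    have h1 := hb _ hv
    by_cases hu : T.up j
    · have := (h j hj).1 hu; omega
    · have := (h j hj).2 hu; omega
  by_cases hj : ∃ j < i, v = T.cu j
  · exact h.elim (fun h => key h.2 hj) (fun h => key h.2 hj)
  · push Not at hj
    rcases h with h | h
    · refine le_trans ?_ (hb v hv)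
      rw [h.1 v hv hj]
      exact Finset.single_le_sum (f := D) (fun _ _ => Nat.zero_le _)
        (Finset.mem_filter.2 ⟨Finset.mem_range.2 hv, .refl⟩)
    · rw [h.1 v hv hj]
      exact hb v hv

end Sum

/-! ### The number of traces of reachable sets -/

/-- The labels which are carried by some vertex reachable from `v`. -/
def trace (T : ElimForest) (i : ℕ) (L : ℕ → Set ℕ) (v : ℕ) : Set ℕ :=
  {j | ∃ y, T.Reach i v y ∧ j ∈ L y}

theorem subset_trace (L : ℕ → Set ℕ) (v : ℕ) : L v ⊆ T.trace i L v :=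
  fun _ hj => ⟨v, .refl, hj⟩

/-- If only the vertices in `Z` carry labels, then at most `2 * Z.card` nonempty label sets
are reached. The induction follows the elimination of a leaf `u` with neighbour `w`: the labels of
`u` are erased if the edge points to `w`, and moved to `w` otherwise. Each round in which new sets
have to be counted decreases the number of labelled vertices. The sets `L v` are counted as
well, since they are the sets reached from vertices which have become isolated. -/
theorem exists_card_trace_le (T : ElimForest) (i : ℕ) (hi : i ≤ T.q) (L : ℕ → Set ℕ)
    (Z : Finset ℕ) (hZ : ∀ v, v ∉ Z → L v = ∅) :
    ∃ C : Finset (Set ℕ), C.card ≤ 2 * Z.card ∧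
      ∀ v, (T.trace i L v = ∅ ∨ T.trace i L v ∈ C) ∧ (L v = ∅ ∨ L v ∈ C) := by
  classical
  obtain ⟨d, hd⟩ : ∃ d, i + d = T.q := ⟨T.q - i, by omega⟩
  induction d generalizing i L Z with
  | zero =>
    refine ⟨Z.image L, ?_, fun v => ?_⟩
    · have : (Z.image L).card ≤ Z.card := Finset.card_image_le
      omega
    · have h1 : T.trace i L v = L v := by
        ext j
        simp [trace, reach_last (T := T) (i := i) (by omega)]
      have h2 : L v = ∅ ∨ L v ∈ Z.image L := by
        by_cases hv : v ∈ Z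
        · exact .inr (Finset.mem_image_of_mem _ hv)
        · exact .inl (hZ v hv)
      rw [h1]
      exact ⟨h2, h2⟩
  | succ d ih =>
    have hi' : i < T.q := by omega
    have hne := T.cu_ne_cw i i le_rfl hi'
    set u := T.cu i with hu
    set w := T.cw i with hw
    by_cases hup : T.up i
    · have htr : ∀ v, v ≠ u → T.trace i L v = T.trace (i + 1) (Function.update L u ∅) v := by
        intro v hv
        ext j
        simp only [trace, reach_up hi' hup, Set.mem_ofPred_eq]
        refine exists_congr fun y => ?_
        by_cases hy : y = u
        · subst hy
          rw [reach_cu_right]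
          simp [hv, ← hu]
        · rw [Function.update_of_ne hy]
          tauto
      by_cases huZ : u ∈ Z
      · obtain ⟨C, hC, h⟩ := ih (i + 1) (by omega) (Function.update L u ∅) (Z.erase u) (by
          intro v hv
          by_cases hvu : v = u
          · simp [hvu]
          · rw [Function.update_of_ne hvu]
            exact hZ v (by simpa [hvu] using hv)) (by omega)
        refine ⟨insert (L u) (insert (T.trace i L u) C), ?_, fun v => ?_⟩
        · have h1 := Finset.card_insert_le (L u) (insert (T.trace i L u) C)
          have h2 := Finset.card_insert_le (T.trace i L u) C
          have h3 := Finset.card_erase_of_mem huZ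
          have h4 := Finset.card_pos.2 ⟨u, huZ⟩
          omega
        · by_cases hvu : v = u
          · subst hvu
            simp
          · have h1 := h v
            rw [Function.update_of_ne hvu, ← htr v hvu] at h1
            simp only [Finset.mem_insert]
            tauto
      · have hLu : L u = ∅ := hZ u huZ
        have hL : Function.update L u ∅ = L := by rw [← hLu, Function.update_eq_self]
        rw [hL] at htr
        obtain ⟨C, hC, h⟩ := ih (i + 1) (by omega) L Z hZ (by omega)
        refine ⟨C, hC, fun v => ?_⟩
        by_cases hvu : v = u
        · subst hvu
          have h1 : T.trace i L (T.cu i) = T.trace (i + 1) L w := by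
            ext j
            simp only [trace, reach_up hi' hup, reach_cu_left, Set.mem_ofPred_eq]
            refine exists_congr fun y => ?_
            constructor
            · rintro ⟨rfl | ⟨-, h1⟩, h2⟩
              · simp [← hu, hLu] at h2
              · exact ⟨h1, h2⟩
            · exact fun h => ⟨.inr ⟨trivial, h.1⟩, h.2⟩
          rw [← hu] at h1
          rw [h1]
          exact ⟨(h w).1, .inl hLu⟩
        · rw [htr v hvu]
          exact h v
    · set L' := Function.update (Function.update L w (L w ∪ L u)) u ∅ with hL'
      have hL'u : L' u = ∅ := by simp [hL']
      have hL'w : L' w = L w ∪ L u := by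
        rw [hL', Function.update_of_ne hne.symm, Function.update_self]
      have hL'v : ∀ v, v ≠ u → v ≠ w → L' v = L v := fun v h1 h2 => by
        rw [hL', Function.update_of_ne h1, Function.update_of_ne h2]
      have htr : ∀ v, v ≠ u → T.trace i L v = T.trace (i + 1) L' v := by
        intro v hv
        have hvu : ¬ T.Reach (i + 1) v u := by rwa [hu, reach_cu_right]
        ext j
        simp only [trace, reach_down hi' hup, Set.mem_ofPred_eq]
        constructor
        · rintro ⟨y, h1 | ⟨h1, rfl⟩, h2⟩
          · have hyu : y ≠ u := fun h => hvu (h ▸ h1)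
            by_cases hyw : y = w
            · exact ⟨y, h1, by rw [hyw, hL'w]; exact .inl (hyw ▸ h2)⟩
            · exact ⟨y, h1, by rwa [hL'v y hyu hyw]⟩
          · exact ⟨w, h1, by rw [hL'w]; exact .inr h2⟩
        · rintro ⟨y, h1, h2⟩
          have hyu : y ≠ u := fun h => hvu (h ▸ h1)
          by_cases hyw : y = w
          · subst hyw
            rw [hL'w] at h2
            rcases h2 with h2 | h2
            · exact ⟨_, .inl h1, h2⟩
            · exact ⟨u, .inr ⟨h1, rfl⟩, h2⟩
          · exact ⟨y, .inl h1, by rwa [hL'v y hyu hyw] at h2⟩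
      have htu : T.trace i L u = L u := by
        refine Set.Subset.antisymm ?_ (subset_trace L u)
        rintro j ⟨y, h1, h2⟩
        rw [reach_down hi' hup, hu, reach_cu_left, reach_cu_left] at h1
        rcases h1 with rfl | ⟨-, rfl⟩ <;> exact h2
      by_cases huZ : u ∈ Z
      · obtain ⟨C, hC, h⟩ := ih (i + 1) (by omega) L' (insert w (Z.erase u)) (by
          intro v hv
          simp only [Finset.mem_insert, Finset.mem_erase, not_or, not_and] at hv
          by_cases hvu : v = u
          · rw [hvu, hL'u]
          · rw [hL'v v hvu hv.1]
            exact hZ v (hv.2 hvu)) (by omega)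
        have h3 := Finset.card_erase_of_mem huZ
        have h4 := Finset.card_pos.2 ⟨u, huZ⟩
        by_cases hwZ : w ∈ Z
        · refine ⟨insert (L u) (insert (L w) C), ?_, fun v => ?_⟩
          · have h1 := Finset.card_insert_le (L u) (insert (L w) C)
            have h2 := Finset.card_insert_le (L w) C
            rw [Finset.insert_eq_of_mem (by simp [hwZ, hne.symm])] at hC
            omega
          · simp only [Finset.mem_insert]
            by_cases hvu : v = u
            · subst hvu
              exact ⟨.inr (.inl htu), .inr (.inl rfl)⟩
            · rw [htr v hvu]
              have h1 := h v
              by_cases hvw : v = w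
              · rw [hvw] at h1 ⊢
                tauto
              · rw [hL'v v hvu hvw] at h1
                tauto
        · have hLw : L w = ∅ := hZ w hwZ
          have hLu : L' w = L u := by rw [hL'w, hLw, Set.empty_union]
          refine ⟨C, ?_, fun v => ?_⟩
          · have := Finset.card_insert_le w (Z.erase u)
            omega
          · by_cases hvu : v = u
            · rw [hvu, htu, ← hLu]
              exact ⟨(h w).2, (h w).2⟩
            · rw [htr v hvu]
              refine ⟨(h v).1, ?_⟩
              by_cases hvw : v = w
              · rw [hvw]
                exact .inl hLw
              · rw [← hL'v v hvu hvw]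
                exact (h v).2
      · have hLu : L u = ∅ := hZ u huZ
        have hLL : L' = L := by
          rw [hL', hLu, Set.union_empty, Function.update_eq_self, ← hLu, Function.update_eq_self]
        rw [hLL] at htr
        obtain ⟨C, hC, h⟩ := ih (i + 1) (by omega) L Z hZ (by omega)
        refine ⟨C, hC, fun v => ?_⟩
        by_cases hvu : v = u
        · rw [hvu, htu]
          exact ⟨.inl hLu, .inl hLu⟩
        · rw [htr v hvu]
          exact h v

end ElimForest

/-! ### A forest with extra edges -/

namespace ElimForest

variable {T : ElimForest} {es et : ℕ → ℕ} {k : ℕ}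

/-- Reachability by forest edges and the extra edges from `es j` to `et j` for `j < k`. -/
def ExtReach (T : ElimForest) (es et : ℕ → ℕ) (k : ℕ) : ℕ → ℕ → Prop :=
  ReflTransGen fun x y => T.Edge 0 x y ∨ ∃ j < k, x = es j ∧ y = et j

theorem extReach_zero (x y : ℕ) : T.ExtReach es et 0 x y ↔ T.Reach 0 x y := by
  simp [ExtReach, Reach]

theorem extReach_succ (x y : ℕ) : T.ExtReach es et (k + 1) x y ↔
    T.ExtReach es et k x y ∨ (T.ExtReach es et k x (es k) ∧ T.ExtReach es et k (et k) y) := by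
  refine reflTransGen_add_edge (fun a b => ?_) x y
  simp only [Nat.lt_succ_iff_lt_or_eq, or_and_right, exists_or, exists_eq_left, or_assoc]

theorem Reach.extReach {x y : ℕ} (h : T.Reach 0 x y) : T.ExtReach es et k x y :=
  ReflTransGen.mono (fun _ _ => .inl) _ _ h

theorem extReach_edge {j : ℕ} (hj : j < k) : T.ExtReach es et k (es j) (et j) :=
  .single (.inr ⟨j, hj, rfl, rfl⟩)

/-- Splitting a path after its last extra edge. -/
theorem extReach_last (x y : ℕ) : T.ExtReach es et k x y ↔
    T.Reach 0 x y ∨ ∃ j < k, T.ExtReach es et k x (es j) ∧ T.Reach 0 (et j) y := by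
  refine ⟨fun h => ?_, ?_⟩
  · induction h with
    | refl => exact .inl .refl
    | tail h1 h2 ih =>
      rcases h2 with h2 | ⟨j, hj, rfl, rfl⟩
      · rcases ih with ih | ⟨j, hj, h3, h4⟩
        · exact .inl (ih.tail h2)
        · exact .inr ⟨j, hj, h3, h4.tail h2⟩
      · exact .inr ⟨j, hj, h1, .refl⟩
  · rintro (h | ⟨j, hj, h1, h2⟩)
    · exact h.extReach
    · exact (h1.trans (extReach_edge hj)).trans h2.extReach

/-- Splitting a path before its first extra edge. -/
theorem extReach_first (x y : ℕ) : T.ExtReach es et k x y ↔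
    T.Reach 0 x y ∨ ∃ j < k, T.Reach 0 x (es j) ∧ T.ExtReach es et k (et j) y := by
  refine ⟨fun h => ?_, ?_⟩
  · induction h using ReflTransGen.head_induction_on with
    | refl => exact .inl .refl
    | head h2 h1 ih =>
      rcases h2 with h2 | ⟨j, hj, rfl, rfl⟩
      · rcases ih with ih | ⟨j, hj, h3, h4⟩
        · exact .inl (.head h2 ih)
        · exact .inr ⟨j, hj, .head h2 h3, h4⟩
      · exact .inr ⟨j, hj, .refl, h1⟩
  · rintro (h | ⟨j, hj, h1, h2⟩)
    · exact h.extReach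
    · exact (h1.extReach.trans (extReach_edge hj)).trans h2

/-- The extra edges whose tails are reachable from `v`. -/
def column (T : ElimForest) (es et : ℕ → ℕ) (k v : ℕ) : Set ℕ :=
  {j | j < k ∧ T.ExtReach es et k v (es j)}

/-- A column is determined by the extra edges whose tails are reachable inside the forest, and
these sets are few by `exists_card_trace_le`, applied with the extra edges as labels of their
tails. -/
theorem exists_card_column_le (T : ElimForest) (es et : ℕ → ℕ) (k : ℕ) :
    ∃ C : Finset (Set ℕ), C.card ≤ 2 * k + 1 ∧ ∀ v, T.column es et k v ∈ C := by
  classical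
  obtain ⟨C, hC, h⟩ := exists_card_trace_le T 0 (Nat.zero_le _) (fun y => {j | j < k ∧ es j = y})
    ((Finset.range k).image es) (by
      intro v hv
      ext j
      simp only [Finset.mem_image, Finset.mem_range, not_exists, not_and] at hv
      simpa using hv j)
  have hcard : ((Finset.range k).image es).card ≤ k :=
    Finset.card_image_le.trans (Finset.card_range k).le
  refine ⟨(insert ∅ C).image fun S => {j | j < k ∧ (j ∈ S ∨
    ∃ i ∈ S, T.ExtReach es et k (et i) (es j))}, ?_, fun v => ?_⟩
  · have h1 := Finset.card_insert_le ∅ C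
    have h2 := Finset.card_image_le (s := insert ∅ C) (f := fun S => {j | j < k ∧ (j ∈ S ∨
      ∃ i ∈ S, T.ExtReach es et k (et i) (es j))})
    omega
  · refine Finset.mem_image.2 ⟨_, Finset.mem_insert.2 (h v).1, ?_⟩
    ext j
    simp only [trace, column, Set.mem_ofPred_eq]
    refine and_congr_right fun hj => ?_
    rw [extReach_first v]
    constructor
    · rintro (⟨y, h1, -, rfl⟩ | ⟨i, ⟨y, h1, hi, rfl⟩, h2⟩)
      · exact .inl h1
      · exact .inr ⟨i, hi, h1, h2⟩
    · rintro (h1 | ⟨i, hi, h1, h2⟩)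
      · exact .inl ⟨_, h1, hj, rfl⟩
      · exact .inr ⟨i, ⟨_, h1, hi, rfl⟩, h2⟩

end ElimForest

/-! ### Degrees and forests -/

/-- An array representation of a loopless multigraph on `0, …, n - 1` with `m` directed edges. -/
structure EdgeList where
  n : ℕ
  m : ℕ
  tl : ℕ → ℕ
  hd : ℕ → ℕ
  tl_lt : ∀ e < m, tl e < n
  hd_lt : ∀ e < m, hd e < n
  ne : ∀ e < m, tl e ≠ hd e

namespace EdgeList

variable (G : EdgeList)

/-- The edges in `A` which are incident with `v`. -/
def star (A : Finset ℕ) (v : ℕ) : Finset ℕ := A.filter fun e => G.tl e = v ∨ G.hd e = v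

/-- The degree of `v` in the edge set `A`. -/
def degree (A : Finset ℕ) (v : ℕ) : ℕ := (G.star A v).card

/-- The vertices which are not isolated in the edge set `A`. -/
def support (A : Finset ℕ) : Finset ℕ := (Finset.range G.n).filter fun v => G.degree A v ≠ 0

/-- An edge set without vertices of degree one. -/
def Leafless (A : Finset ℕ) : Prop := ∀ v < G.n, G.degree A v ≠ 1

/-- Every nonempty set of edges outside of `F` has a vertex of degree one, that is, the edges
outside of `F` form a forest. -/
def IsFeedback (F : Finset ℕ) : Prop :=
  ∀ D ⊆ Finset.range G.m \ F, D.Nonempty → ∃ v < G.n, G.degree D v = 1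

variable {G} {A A' F : Finset ℕ}

theorem sum_degree (hA : A ⊆ Finset.range G.m) :
    ∑ v ∈ Finset.range G.n, G.degree A v = 2 * A.card := by
  refine (Finset.sum_card_bipartiteAbove_eq_sum_card_bipartiteBelow
    (fun v e => G.tl e = v ∨ G.hd e = v)).trans ?_
  rw [Finset.sum_congr rfl (g := fun _ => 2), Finset.sum_const, smul_eq_mul, mul_comm]
  intro e he
  have hm := Finset.mem_range.1 (hA he)
  have h : Finset.bipartiteBelow (fun v e => G.tl e = v ∨ G.hd e = v) (Finset.range G.n) e =
      {G.tl e, G.hd e} := by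
    ext v
    have h1 := G.tl_lt e hm
    have h2 := G.hd_lt e hm
    simp only [Finset.bipartiteBelow, Finset.mem_filter, Finset.mem_range, Finset.mem_insert,
      Finset.mem_singleton]
    constructor
    · rintro ⟨-, h | h⟩ <;> simp [h]
    · rintro (rfl | rfl) <;> simp [h1, h2]
  rw [h, Finset.card_pair (G.ne e hm)]

theorem degree_mono (h : A' ⊆ A) (v : ℕ) : G.degree A' v ≤ G.degree A v :=
  Finset.card_le_card (Finset.filter_subset_filter _ h)

theorem support_mono (h : A' ⊆ A) : G.support A' ⊆ G.support A := by
  intro v hv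
  simp only [support, Finset.mem_filter] at hv ⊢
  have := G.degree_mono h v
  exact ⟨hv.1, by omega⟩

theorem degree_sdiff (h : A' ⊆ A) (v : ℕ) :
    G.degree (A \ A') v + G.degree A' v = G.degree A v := by
  have h1 : G.star A v = G.star (A \ A') v ∪ G.star A' v := by
    rw [star, star, star, ← Finset.filter_union, Finset.sdiff_union_of_subset h]
  rw [degree, degree, degree, h1, Finset.card_union_of_disjoint]
  exact Finset.disjoint_filter_filter Finset.sdiff_disjoint

theorem card_le_card_support (hF : G.IsFeedback F) (hA : A ⊆ Finset.range G.m \ F) :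
    A.card ≤ (G.support A).card := by
  induction A using Finset.strongInduction with
  | H A ih =>
    rcases A.eq_empty_or_nonempty with rfl | hne
    · simp
    · obtain ⟨v, hv, h1⟩ := hF A hA hne
      obtain ⟨e, he⟩ := Finset.card_eq_one.1 h1
      have he' : e ∈ G.star A v := he ▸ Finset.mem_singleton_self e
      have heA : e ∈ A := (Finset.mem_filter.1 he').1
      have h2 := ih (A.erase e) (Finset.erase_ssubset heA)
        ((Finset.erase_subset _ _).trans hA)
      have h3 : G.degree (A.erase e) v = 0 := by
        rw [degree, star, Finset.filter_erase]
        exact Finset.card_eq_zero.2 (by rw [← star, he]; simp)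
      have h4 : (G.support (A.erase e)).card < (G.support A).card := by
        refine Finset.card_lt_card ⟨support_mono (Finset.erase_subset _ _), fun h => ?_⟩
        have h5 := h (Finset.mem_filter.2 ⟨Finset.mem_range.2 hv, by omega⟩)
        exact (Finset.mem_filter.1 h5).2 h3
      have h5 := Finset.card_erase_of_mem heA
      omega

/-- The potential `A.card - (support A).card + (A ∩ F).card` is at most `2 * F.card`. -/
theorem potential_le (hF : G.IsFeedback F) (hA : A ⊆ Finset.range G.m) :
    A.card + (A ∩ F).card ≤ 2 * F.card + (G.support A).card := by
  have h1 := card_le_card_support hF (A := A \ F) (Finset.sdiff_subset_sdiff hA le_rfl)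
  have h2 := Finset.card_le_card (G.support_mono (A' := A \ F) (A := A) Finset.sdiff_subset)
  have h3 := Finset.card_sdiff_add_card_inter A F
  have h4 := Finset.card_le_card (Finset.inter_subset_right (s₁ := A) (s₂ := F))
  omega

theorem Leafless.card_support_le (h : G.Leafless A) (hA : A ⊆ Finset.range G.m) :
    (G.support A).card ≤ A.card := by
  have h1 := G.sum_degree hA
  have h2 : ∑ v ∈ G.support A, 2 ≤ ∑ v ∈ Finset.range G.n, G.degree A v := by
    refine (Finset.sum_le_sum fun v hv => ?_).trans
      (Finset.sum_le_sum_of_subset (Finset.filter_subset _ _))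
    have h3 := Finset.mem_filter.1 hv
    have := h v (Finset.mem_range.1 h3.1)
    have := h3.2
    omega
  rw [Finset.sum_const, smul_eq_mul] at h2
  omega

/-- The potential decreases when a leafless edge set is replaced by a smaller one. If the number
of vertices lost is not smaller than the number of edges lost, then the edges lost form a 2-regular
graph, which cannot avoid `F`. -/
theorem Leafless.potential_lt (h : G.Leafless A) (hF : G.IsFeedback F)
    (hA : A ⊆ Finset.range G.m) (hAA : A' ⊂ A) :
    A'.card + (A' ∩ F).card + (G.support A).card + 1 ≤
      A.card + (A ∩ F).card + (G.support A').card := by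
  have hsub := hAA.1
  have h1 := Finset.card_sdiff_add_card_eq_card hsub
  have h2 := Finset.card_sdiff_add_card_eq_card (G.support_mono hsub)
  have h3 : ((A \ A') ∩ F).card + (A' ∩ F).card = (A ∩ F).card := by
    rw [← Finset.card_sdiff_add_card_eq_card (Finset.inter_subset_inter_right (u := F) hsub)]
    congr 2
    ext x
    simp only [Finset.mem_inter, Finset.mem_sdiff]
    tauto
  set Δ := G.support A \ G.support A' with hΔ
  set D := A \ A' with hD
  have hDm : D ⊆ Finset.range G.m := Finset.sdiff_subset.trans hA
  have hΔn : Δ ⊆ Finset.range G.n := Finset.sdiff_subset.trans (Finset.filter_subset _ _)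
  have h4 : ∀ v ∈ Δ, 2 ≤ G.degree D v := by
    intro v hv
    have hn := Finset.mem_range.1 (hΔn hv)
    have h5 := G.degree_sdiff hsub v
    rw [← hD] at h5
    have h6 := h v hn
    have h7 := Finset.mem_sdiff.1 hv
    have h8 := (Finset.mem_filter.1 h7.1).2
    have h9 : G.degree A' v = 0 := by
      by_contra h0
      exact h7.2 (Finset.mem_filter.2 ⟨hΔn hv, h0⟩)
    omega
  have h5 := G.sum_degree hDm
  rw [← Finset.sum_sdiff hΔn] at h5
  have h6 : ∑ v ∈ Δ, 2 ≤ ∑ v ∈ Δ, G.degree D v := Finset.sum_le_sum h4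
  rw [Finset.sum_const, smul_eq_mul] at h6
  by_cases hDF : (D ∩ F).card = 0
  · have hDne : D.Nonempty := Finset.sdiff_nonempty.2 hAA.2
    obtain ⟨v, hv, hv1⟩ := hF D (fun x hx => Finset.mem_sdiff.2 ⟨hDm hx, fun hxF => by
      have : x ∈ D ∩ F := Finset.mem_inter.2 ⟨hx, hxF⟩
      rw [Finset.card_eq_zero.1 hDF] at this
      simp at this⟩) hDne
    have hvΔ : v ∈ Finset.range G.n \ Δ := by
      refine Finset.mem_sdiff.2 ⟨Finset.mem_range.2 hv, fun hvΔ => ?_⟩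
      have := h4 v hvΔ
      omega
    have h7 := Finset.single_le_sum (f := G.degree D) (fun _ _ => Nat.zero_le _) hvΔ
    omega
  · omega

end EdgeList

/-! ### Polyforests have leaves -/

/-- A finite acyclic graph with an edge has a leaf, namely in the component of that edge. -/
theorem SimpleGraph.IsAcyclic.exists_existsUnique_adj {V : Type*} [Finite V] {H : SimpleGraph V}
    (hH : H.IsAcyclic) {x y : V} (hxy : H.Adj x y) : ∃ v, ∃! w, H.Adj v w := by
  classical
  have := Fintype.ofFinite V
  have : Nontrivial (H.connectedComponentMk x) := by
    refine ⟨⟨x, rfl⟩, ⟨y, ?_⟩, fun h => hxy.ne (congrArg Subtype.val h)⟩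
    exact (SimpleGraph.ConnectedComponent.sound hxy.reachable).symm
  obtain ⟨v, hv⟩ :=
    (hH.isTree_connectedComponent (H.connectedComponentMk x)).exists_vert_degree_one_of_nontrivial
  rw [SimpleGraph.degree_eq_one_iff_existsUnique_adj] at hv
  obtain ⟨w, hw, hw'⟩ := hv
  refine ⟨v, w, hw, fun z hz => ?_⟩
  have hz' : z ∈ (H.connectedComponentMk x).supp := by
    have h1 : H.connectedComponentMk v = H.connectedComponentMk x := v.2
    exact (SimpleGraph.ConnectedComponent.sound hz.symm.reachable).trans h1
  exact congrArg Subtype.val (hw' ⟨z, hz'⟩ hz)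

/-- The arrays which represent an enumeration of the edges of a digraph. -/
def EdgeList.ofDigraph {n m : ℕ} {G : Digraph (Fin n)}
    (e : Fin m ≃ {p : Fin n × Fin n // G.Adj p.1 p.2}) (hG : ∀ v, ¬ G.Adj v v) : EdgeList where
  n := n
  m := m
  tl i := if h : i < m then (e ⟨i, h⟩).1.1 else 0
  hd i := if h : i < m then (e ⟨i, h⟩).1.2 else 0
  tl_lt i h := by simp [h]
  hd_lt i h := by simp [h]
  ne i h h' := by
    simp only [h, dif_pos] at h'
    have h1 := (e ⟨i, h⟩).2
    rw [← Fin.ext h'] at h1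
    exact hG _ h1

/-- A smallest feedback edge set, seen as a set of edge numbers. -/
theorem EdgeList.exists_isFeedback {n m : ℕ} {G : Digraph (Fin n)}
    (e : Fin m ≃ {p : Fin n × Fin n // G.Adj p.1 p.2}) (hG : ∀ v, ¬ G.Adj v v) :
    ∃ F : Finset ℕ, (ofDigraph e hG).IsFeedback F ∧ F.card ≤ G.feedbackEdgeNumber := by
  classical
  obtain ⟨F₀, ⟨hF₀, hpf⟩, hcard⟩ := G.exists_isFeedbackEdgeSet_card
  refine ⟨((Finset.univ : Finset (Fin m)).filter fun i => (e i).1 ∈ F₀).image Fin.val, ?_, ?_⟩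
  · intro D hD ⟨i₀, hi₀⟩
    have hDm : ∀ i ∈ D, ∃ h : i < m, (e ⟨i, h⟩).1 ∉ F₀ := by
      intro i hi
      have h1 := Finset.mem_sdiff.1 (hD hi)
      have h2 : i < m := Finset.mem_range.1 h1.1
      refine ⟨h2, fun h3 => h1.2 (Finset.mem_image.2 ⟨⟨i, h2⟩, by simp [h3], rfl⟩)⟩
    -- the digraph formed by the edges in `D`
    let R : Fin n → Fin n → Prop := fun x y => ∃ i : Fin m, i.1 ∈ D ∧ (e i).1 = (x, y)
    have hR : ∀ x y, R x y → (G.removeEdges F₀).Adj x y := by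
      rintro x y ⟨i, hi, hxy⟩
      obtain ⟨h, h1⟩ := hDm _ hi
      have h2 := (e i).2
      rw [hxy] at h2
      exact ⟨h2, hxy ▸ h1⟩
    have hle : SimpleGraph.fromRel R ≤ (G.removeEdges F₀).toSimpleGraphInclusive := by
      intro x y hxy
      rw [SimpleGraph.fromRel_adj] at hxy
      rw [Digraph.toSimpleGraphInclusive, SimpleGraph.fromRel_adj]
      exact ⟨hxy.1, hxy.2.imp (hR _ _) (hR _ _)⟩
    obtain ⟨h₀, -⟩ := hDm _ hi₀
    obtain ⟨v, w, hw, huniq⟩ := (hpf.2.anti hle).exists_existsUnique_adj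
      (x := (e ⟨i₀, h₀⟩).1.1) (y := (e ⟨i₀, h₀⟩).1.2) (by
        rw [SimpleGraph.fromRel_adj]
        refine ⟨fun h => ?_, .inl ⟨⟨i₀, h₀⟩, hi₀, rfl⟩⟩
        have := (e ⟨i₀, h₀⟩).2
        rw [h] at this
        exact hG _ this)
    have hmem : ∀ i, i ∈ (ofDigraph e hG).star D v ↔
        ∃ h : i < m, i ∈ D ∧ ((e ⟨i, h⟩).1 = (v, w) ∨ (e ⟨i, h⟩).1 = (w, v)) := by
      intro i
      simp only [star, Finset.mem_filter]
      constructor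
      · rintro ⟨hi, h1⟩
        obtain ⟨h, -⟩ := hDm _ hi
        refine ⟨h, hi, ?_⟩
        simp only [ofDigraph, h, dif_pos] at h1
        have hadj : (SimpleGraph.fromRel R).Adj (e ⟨i, h⟩).1.1 (e ⟨i, h⟩).1.2 := by
          rw [SimpleGraph.fromRel_adj]
          refine ⟨fun h' => ?_, .inl ⟨⟨i, h⟩, hi, rfl⟩⟩
          have := (e ⟨i, h⟩).2
          rw [h'] at this
          exact hG _ this
        rcases h1 with h1 | h1
        · have h2 := Fin.ext h1
          rw [h2] at hadj
          exact .inl (Prod.ext h2 (huniq _ hadj))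
        · have h2 := Fin.ext h1
          rw [h2] at hadj
          exact .inr (Prod.ext (huniq _ hadj.symm) h2)
      · rintro ⟨h, hi, h1 | h1⟩ <;> refine ⟨hi, ?_⟩ <;> simp [ofDigraph, h, h1]
    have hanti : ¬ (R v w ∧ R w v) := fun h => hpf.1 _ _ (hR _ _ h.1) (hR _ _ h.2)
    have hone : ∃ i, (ofDigraph e hG).star D v = {i} := by
      rw [SimpleGraph.fromRel_adj] at hw
      rcases hw.2 with ⟨i, hi, h1⟩ | ⟨i, hi, h1⟩
      · refine ⟨i, Finset.ext fun i' => ?_⟩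
        rw [hmem, Finset.mem_singleton]
        constructor
        · rintro ⟨h, hi', h2 | h2⟩
          · exact congrArg Fin.val (e.injective (Subtype.ext (h2.trans h1.symm)))
          · exact (hanti ⟨⟨i, hi, h1⟩, ⟨_, h⟩, hi', h2⟩).elim
        · rintro rfl
          exact ⟨i.2, hi, .inl h1⟩
      · refine ⟨i, Finset.ext fun i' => ?_⟩
        rw [hmem, Finset.mem_singleton]
        constructor
        · rintro ⟨h, hi', h2 | h2⟩
          · exact (hanti ⟨⟨⟨_, h⟩, hi', h2⟩, i, hi, h1⟩).elim
          · exact congrArg Fin.val (e.injective (Subtype.ext (h2.trans h1.symm)))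
        · rintro rfl
          exact ⟨i.2, hi, .inr h1⟩
    obtain ⟨i, hi⟩ := hone
    exact ⟨v, v.2, by rw [degree, hi, Finset.card_singleton]⟩
  · rw [← hcard, Finset.card_image_of_injective _ Fin.val_injective]
    refine Finset.card_le_card_of_injOn (fun i => (e i).1) (fun i hi => ?_) ?_
    · simpa using hi
    · exact fun i _ j _ h => e.injective (Subtype.ext h)

/-! ### Summation along a forest -/

namespace RealRAM

-- Weakest preconditions of concrete programs are computed by `simp`.
attribute [simp] wp WordExpr.eval WordOp.eval WordExpr.Fits RealExpr.eval RealExpr.Fits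
  Memory.setN Memory.putN Memory.setR Memory.putR

/-- Sequential composition of programs. -/
infixr:60 "⨟" => Prog.seq

/-- The word variable `n`. -/
abbrev xn : WordExpr := .var 0
/-- The word variable `m`. -/
abbrev xm : WordExpr := .var 1
/-- The word variable `q`. -/
abbrev xq : WordExpr := .var 2
/-- The word variable `k`. -/
abbrev xk : WordExpr := .var 3
/-- The word variable `i`. -/
abbrev xi : WordExpr := .var 4
/-- The word variable `j`. -/
abbrev xj : WordExpr := .var 5
/-- The word variable `l`. -/
abbrev xl : WordExpr := .var 6
/-- The word variable `u`. -/
abbrev xu : WordExpr := .var 7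
/-- The word variable `e`. -/
abbrev xe : WordExpr := .var 8
/-- The word variable `w`. -/
abbrev xw : WordExpr := .var 9
/-- The word variable `b`. -/
abbrev xb : WordExpr := .var 10
/-- The word variable `flip`. -/
abbrev xflip : WordExpr := .var 11
/-- The word variable `flag`. -/
abbrev xflag : WordExpr := .var 12
/-- The constant `1`. -/
abbrev one : WordExpr := .const 1

/-- Replace the row of `B` that starts at `b` by the sums over the sets reachable in the forest,
in two passes over the elimination order. An edge counts as directed from `cu j` to `cw j` if
`cd j` differs from `flip`. -/
def propagate : Prog :=
  Prog.for 5 2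
    (.ite (.eq (.get 7 xj) xflip)
      (.putN 10 (xb + .get 6 xj) (.get 10 (xb + .get 6 xj) + .get 10 (xb + .get 5 xj)))
      .skip) ⨟
  Prog.for 5 2
    (.setN 8 (xq - (xj + one)) ⨟
    .ite (.eq (.get 7 xe) xflip)
      .skip
      (.putN 10 (xb + .get 5 xe) (.get 10 (xb + .get 5 xe) + .get 10 (xb + .get 6 xe))))

/-- The forest stored in the memory is `T`, when an edge counts as directed from `cu j` to `cw j`
if `cd j` differs from `flip`. With `flip = 1` the reversed forest is read from the same arrays. -/
structure Memory.HasForest (μ : Memory) (T : ElimForest) (flip : ℕ) : Prop where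
  n_eq : T.n = μ.n
  q_eq : T.q = μ.q
  cu_eq : ∀ j < T.q, T.cu j = μ.cu j
  cw_eq : ∀ j < T.q, T.cw j = μ.cw j
  up_iff : ∀ j < T.q, T.up j ↔ μ.cd j ≠ flip
  cd_le : ∀ j < T.q, μ.cd j ≤ 1
  flip_le : flip ≤ 1

theorem update_add_left {α : Type*} (B : ℕ → α) (b w : ℕ) (x : α) :
    (fun v => Function.update B (b + w) x (b + v)) =
      Function.update (fun v => B (b + v)) w x := by
  funext v
  simp [Function.update_apply]

/-- The first pass runs through the invariant `Pass₁`, the second one through `Pass₂`. -/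
theorem exec_propagate {N c : ℕ} {μ : Memory} {T : ElimForest} (h : μ.HasForest T μ.flip)
    (hN : 2 < N) (hn : μ.n + 1 < N) (hb : μ.b + μ.n ≤ N) (hc : c < N)
    (hval : ∀ v < μ.n, T.val 0 (fun v => μ.B (μ.b + v)) v ≤ c) :
    Exec N propagate μ fun t μ' => t ≤ 200 * (μ.n + 1) ∧ ∃ B' e',
      μ' = { μ with B := B', e := e', j := μ.q } ∧
      (∀ v < μ.n, B' (μ.b + v) = T.val 0 (fun v => μ.B (μ.b + v)) v) ∧
      ∀ x, (∀ v < μ.n, x ≠ μ.b + v) → B' x = μ.B x := by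
  have hqn : μ.q ≤ μ.n := h.q_eq ▸ h.n_eq ▸ T.card_le
  have hflip := h.flip_le
  have hval' : ∀ v < T.n, T.val 0 (fun v => μ.B (μ.b + v)) v ≤ c := by rwa [h.n_eq]
  refine Exec.seq ((Exec.for_const (d := μ.q) (T := 50) (fun j μ' => ∃ B',
    μ' = { μ with B := B', j := j } ∧ T.Pass₁ (fun v => μ.B (μ.b + v)) j (fun v => B' (μ.b + v)) ∧
      ∀ x, (∀ v < μ.n, x ≠ μ.b + v) → B' x = μ.B x) (by omega) (by omega) ?_ ?_ ?_).mono ?_)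
  · rintro j _ ⟨B', rfl, -⟩
    exact ⟨rfl, rfl⟩
  · exact ⟨μ.B, rfl, T.pass₁_zero _, fun _ _ => rfl⟩
  · rintro j hj _ ⟨B', rfl, h1, h2⟩
    have hjT : j < T.q := h.q_eq ▸ hj
    have hcu := T.cu_lt j hjT
    have hcw := T.cw_lt j hjT
    have hcd := h.cd_le j hjT
    have hup := h.up_iff j hjT
    have hBu := T.le_of_add_bound hval' (.inl h1) hcu
    have hBw := T.le_of_add_bound hval' (.inl h1) hcw
    rw [h.cu_eq j hjT, h.n_eq] at hcu
    rw [h.cw_eq j hjT, h.n_eq] at hcw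
    refine (exec_of_wp (Q := fun μ' => ∃ B',
      μ' = { μ with B := B', j := j } ∧
      T.Pass₁ (fun v => μ.B (μ.b + v)) (j + 1) (fun v => B' (μ.b + v)) ∧
      ∀ x, (∀ v < μ.n, x ≠ μ.b + v) → B' x = μ.B x) ?_).mono ?_
    · by_cases hf : μ.cd j = μ.flip
      · have h3 := h1.down hjT (by simp [hup, hf])
        rw [← update_add_left, h.cu_eq j hjT, h.cw_eq j hjT] at h3
        have hBs := T.le_of_add_bound hval' (.inl h3) (v := μ.cw j) (by rwa [h.n_eq])
        simp only [Function.update_self] at hBs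
        rw [h.cu_eq j hjT] at hBu
        rw [h.cw_eq j hjT] at hBw
        simp [hf]
        constructorm* _ ∧ _ <;> try omega
        intro x hx
        rw [Function.update_of_ne (hx _ hcw), h2 x hx]
      · have h3 := h1.up hjT (by simp [hup, hf])
        simp [hf]
        constructorm* _ ∧ _ <;> try omega
    · rintro t _ ⟨ht, B'', rfl, h3, h4⟩
      exact ⟨ht.trans (by decide), rfl, B'', rfl, h3, h4⟩
  rintro t _ ⟨ht, B₁, rfl, hP, hB₁⟩
  refine (Exec.for_const (d := μ.q) (T := 50) (fun j μ' => ∃ B' e',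
    μ' = { μ with B := B', e := e', j := j } ∧
      T.Pass₂ (fun v => μ.B (μ.b + v)) (T.q - j) (fun v => B' (μ.b + v)) ∧
      ∀ x, (∀ v < μ.n, x ≠ μ.b + v) → B' x = μ.B x) (by omega) (by omega) ?_ ?_ ?_).mono ?_
  · rintro j _ ⟨B', e', rfl, -⟩
    exact ⟨rfl, rfl⟩
  · exact ⟨B₁, _, rfl, (h.q_eq ▸ hP : T.Pass₁ _ T.q _).pass₂, hB₁⟩
  · rintro i hi _ ⟨B', e', rfl, h1, h2⟩
    obtain ⟨j, hij, hj⟩ : ∃ j, μ.q - i = j + 1 ∧ μ.q - (i + 1) = j := ⟨_, by omega, rfl⟩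
    rw [h.q_eq, hij] at h1
    have hjT : j < T.q := by rw [h.q_eq]; omega
    have hcu := T.cu_lt j hjT
    have hcw := T.cw_lt j hjT
    have hcd := h.cd_le j hjT
    have hup := h.up_iff j hjT
    have hBu := T.le_of_add_bound hval' (.inr h1) hcu
    have hBw := T.le_of_add_bound hval' (.inr h1) hcw
    rw [h.cu_eq j hjT, h.n_eq] at hcu
    rw [h.cw_eq j hjT, h.n_eq] at hcw
    refine (exec_of_wp (Q := fun μ' => ∃ B' e',
      μ' = { μ with B := B', e := e', j := i } ∧
      T.Pass₂ (fun v => μ.B (μ.b + v)) j (fun v => B' (μ.b + v)) ∧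
      ∀ x, (∀ v < μ.n, x ≠ μ.b + v) → B' x = μ.B x) ?_).mono ?_
    · by_cases hf : μ.cd j = μ.flip
      · have h3 := h1.down hjT (by simp [hup, hf])
        simp [hj, hf]
        constructorm* _ ∧ _ <;> try omega
      · have h3 := h1.up hjT (by simp [hup, hf])
        rw [← update_add_left, h.cu_eq j hjT, h.cw_eq j hjT] at h3
        have hBs := T.le_of_add_bound hval' (.inr h3) (v := μ.cu j) (by rwa [h.n_eq])
        simp only [Function.update_self] at hBs
        rw [h.cu_eq j hjT] at hBu
        rw [h.cw_eq j hjT] at hBw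
        simp [hj, hf]
        constructorm* _ ∧ _ <;> try omega
        intro x hx
        rw [Function.update_of_ne (hx _ hcu), h2 x hx]
    · rintro t _ ⟨ht, B'', e'', rfl, h3, h4⟩
      exact ⟨ht.trans (by decide), rfl, B'', e'', rfl, (by rwa [h.q_eq, hj]), h4⟩
  · rintro t' _ ⟨ht', B₂, e₂, rfl, h1, h2⟩
    rw [h.q_eq, Nat.sub_self] at h1
    refine ⟨?_, B₂, e₂, rfl, fun v hv => h1.1 v (h.n_eq ▸ hv) (by simp), h2⟩
    omega

/-- Replace the real array `D` by the sums over the sets reachable in the forest. -/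
def propagateReal : Prog :=
  Prog.for 5 2
    (.ite (.get 7 xj)
      .skip
      (.putR 2 (.get 6 xj) (.add (.get 2 (.get 6 xj)) (.get 2 (.get 5 xj))))) ⨟
  Prog.for 5 2
    (.setN 8 (xq - (xj + one)) ⨟
    .ite (.get 7 xe)
      (.putR 2 (.get 5 xe) (.add (.get 2 (.get 5 xe)) (.get 2 (.get 6 xe))))
      .skip)

theorem exec_propagateReal {N : ℕ} {μ : Memory} {T : ElimForest} (h : μ.HasForest T 0)
    (hN : 2 < N) (hn : μ.n + 1 < N) :
    Exec N propagateReal μ fun t μ' => t ≤ 200 * (μ.n + 1) ∧ ∃ D' e',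
      μ' = { μ with D := D', e := e', j := μ.q } ∧
      (∀ v < μ.n, D' v = T.val 0 μ.D v) := by
  have hqn : μ.q ≤ μ.n := h.q_eq ▸ h.n_eq ▸ T.card_le
  refine Exec.seq ((Exec.for_const (d := μ.q) (T := 50) (fun j μ' => ∃ D',
    μ' = { μ with D := D', j := j } ∧ T.Pass₁ μ.D j D')
      (by omega) (by omega) ?_ ?_ ?_).mono ?_)
  · rintro j _ ⟨D', rfl, -⟩
    exact ⟨rfl, rfl⟩
  · exact ⟨μ.D, rfl, T.pass₁_zero _⟩
  · rintro j hj _ ⟨D', rfl, h1⟩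
    have hjT : j < T.q := h.q_eq ▸ hj
    have hcu := T.cu_lt j hjT
    have hcw := T.cw_lt j hjT
    have hcd := h.cd_le j hjT
    have hup := h.up_iff j hjT
    rw [h.cu_eq j hjT, h.n_eq] at hcu
    rw [h.cw_eq j hjT, h.n_eq] at hcw
    refine (exec_of_wp (Q := fun μ' => ∃ D',
      μ' = { μ with D := D', j := j } ∧ T.Pass₁ μ.D (j + 1) D') ?_).mono ?_
    · by_cases hf : μ.cd j = 0
      · have h3 := h1.down hjT (by simp [hup, hf])
        rw [h.cu_eq j hjT, h.cw_eq j hjT] at h3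
        simp [hf]
        constructorm* _ ∧ _ <;> try omega
      · have h3 := h1.up hjT (by simp [hup, hf])
        simp [hf]
        constructorm* _ ∧ _ <;> try omega
    · rintro t _ ⟨ht, D'', rfl, h3⟩
      exact ⟨ht.trans (by decide), rfl, D'', rfl, h3⟩
  rintro t _ ⟨ht, D₁, rfl, hP⟩
  refine (Exec.for_const (d := μ.q) (T := 50) (fun j μ' => ∃ D' e',
    μ' = { μ with D := D', e := e', j := j } ∧ T.Pass₂ μ.D (T.q - j) D')
    (by omega) (by omega) ?_ ?_ ?_).mono ?_
  · rintro j _ ⟨D', e', rfl, -⟩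
    exact ⟨rfl, rfl⟩
  · exact ⟨D₁, _, rfl, (h.q_eq ▸ hP : T.Pass₁ _ T.q _).pass₂⟩
  · rintro i hi _ ⟨D', e', rfl, h1⟩
    obtain ⟨j, hij, hj⟩ : ∃ j, μ.q - i = j + 1 ∧ μ.q - (i + 1) = j := ⟨_, by omega, rfl⟩
    rw [h.q_eq, hij] at h1
    have hjT : j < T.q := by rw [h.q_eq]; omega
    have hcu := T.cu_lt j hjT
    have hcw := T.cw_lt j hjT
    have hcd := h.cd_le j hjT
    have hup := h.up_iff j hjT
    rw [h.cu_eq j hjT, h.n_eq] at hcu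
    rw [h.cw_eq j hjT, h.n_eq] at hcw
    refine (exec_of_wp (Q := fun μ' => ∃ D' e',
      μ' = { μ with D := D', e := e', j := i } ∧ T.Pass₂ μ.D j D') ?_).mono ?_
    · by_cases hf : μ.cd j = 0
      · have h3 := h1.down hjT (by simp [hup, hf])
        simp [hj, hf]
        constructorm* _ ∧ _ <;> try omega
      · have h3 := h1.up hjT (by simp [hup, hf])
        rw [h.cu_eq j hjT, h.cw_eq j hjT] at h3
        simp [hj, hf]
        constructorm* _ ∧ _ <;> try omega
    · rintro t _ ⟨ht, D'', e'', rfl, h3⟩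
      exact ⟨ht.trans (by decide), rfl, D'', e'', rfl, (by rwa [h.q_eq, hj])⟩
  · rintro t' _ ⟨ht', D₂, e₂, rfl, h1⟩
    rw [h.q_eq, Nat.sub_self] at h1
    refine ⟨?_, D₂, e₂, rfl, fun v hv => h1.1 v (h.n_eq ▸ hv) (by simp)⟩
    omega

end RealRAM

/-! ### Stripping leaves -/

namespace EdgeList

variable {G : EdgeList} {A : Finset ℕ} {e v : ℕ}

/-- Addition modulo `m`, as it is computed by the machine. -/
theorem addMod_eq {m x y : ℕ} (hx : x < m) (hy : y ≤ m) :
    x + y - (if m ≤ x + y then m else 0) = (x + y) % m := by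
  split_ifs with h
  · rw [Nat.mod_eq_sub_mod (by omega), Nat.mod_eq_of_lt (by omega)]
  · rw [Nat.mod_eq_of_lt (by omega)]
    omega

/-- The arrays `deg` and `xs` hold, for the edge set `A`, the degree of every vertex, and the sum
modulo `m` of the numbers of the edges at every vertex. At a vertex of degree one, the latter is
the number of the only edge. -/
structure DegInv (G : EdgeList) (A : Finset ℕ) (deg xs : ℕ → ℕ) : Prop where
  deg_eq : ∀ v < G.n, deg v = G.degree A v
  xs_eq : ∀ v < G.n, xs v = (∑ e ∈ G.star A v, e) % G.m

theorem mem_star : e ∈ G.star A v ↔ e ∈ A ∧ (G.tl e = v ∨ G.hd e = v) := Finset.mem_filter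

theorem star_erase : G.star (A.erase e) v = (G.star A v).erase e := Finset.filter_erase ..

theorem star_insert : G.star (insert e A) v =
    if G.tl e = v ∨ G.hd e = v then insert e (G.star A v) else G.star A v :=
  Finset.filter_insert ..

theorem DegInv.insert {deg xs deg' xs' : ℕ → ℕ} (h : G.DegInv A deg xs) (he : e ∉ A)
    (hdeg : ∀ v < G.n, deg' v = if G.tl e = v ∨ G.hd e = v then deg v + 1 else deg v)
    (hxs : ∀ v < G.n, xs' v = if G.tl e = v ∨ G.hd e = v then (xs v + e) % G.m else xs v) :
    G.DegInv (insert e A) deg' xs' := by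
  constructor
  · intro v hv
    rw [hdeg v hv, h.deg_eq v hv, degree, degree, star_insert]
    split_ifs with h1
    · rw [Finset.card_insert_of_notMem fun h2 => he (mem_star.1 h2).1]
    · rfl
  · intro v hv
    rw [hxs v hv, h.xs_eq v hv, star_insert]
    split_ifs with h1
    · rw [Finset.sum_insert fun h2 => he (mem_star.1 h2).1, Nat.mod_add_mod, add_comm]
    · rfl

theorem degree_erase (he : e ∈ A) : G.degree (A.erase e) v =
    if G.tl e = v ∨ G.hd e = v then G.degree A v - 1 else G.degree A v := by
  rw [degree, degree, star_erase]
  split_ifs with h1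
  · rw [Finset.card_erase_of_mem (mem_star.2 ⟨he, h1⟩)]
  · rw [Finset.erase_eq_of_notMem fun h2 => h1 (mem_star.1 h2).2]

theorem DegInv.erase {deg xs deg' xs' : ℕ → ℕ} (h : G.DegInv A deg xs) (he : e ∈ A)
    (hem : e < G.m)
    (hdeg : ∀ v < G.n, deg' v = if G.tl e = v ∨ G.hd e = v then deg v - 1 else deg v)
    (hxs : ∀ v < G.n, xs' v =
      if G.tl e = v ∨ G.hd e = v then (xs v + (G.m - e)) % G.m else xs v) :
    G.DegInv (A.erase e) deg' xs' := by
  constructor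
  · intro v hv
    rw [hdeg v hv, h.deg_eq v hv, degree_erase he]
  · intro v hv
    rw [hxs v hv, h.xs_eq v hv, star_erase]
    split_ifs with h1
    · rw [← Finset.add_sum_erase _ _ (mem_star.2 ⟨he, h1⟩), Nat.mod_add_mod]
      have h2 : e + ∑ x ∈ (G.star A v).erase e, x + (G.m - e) =
          ∑ x ∈ (G.star A v).erase e, x + G.m := by omega
      rw [h2, Nat.add_mod_right]
    · rw [Finset.erase_eq_of_notMem fun h2 => h1 (mem_star.1 h2).2]

theorem DegInv.xs_lt {deg xs : ℕ → ℕ} (h : G.DegInv A deg xs) (hm : 0 < G.m) (hv : v < G.n) :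
    xs v < G.m := by
  rw [h.xs_eq v hv]
  exact Nat.mod_lt _ hm

theorem DegInv.star_eq {deg xs : ℕ → ℕ} (h : G.DegInv A deg xs) (hA : A ⊆ Finset.range G.m)
    (hv : v < G.n) (h1 : deg v = 1) : G.star A v = {xs v} := by
  rw [h.deg_eq v hv] at h1
  obtain ⟨e, he⟩ := Finset.card_eq_one.1 h1
  have h2 : e ∈ G.star A v := by simp [he]
  have h3 := Finset.mem_range.1 (hA (mem_star.1 h2).1)
  rw [he, h.xs_eq v hv, he, Finset.sum_singleton, Nat.mod_eq_of_lt h3]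

theorem degree_le_card : G.degree A v ≤ A.card := Finset.card_filter_le _ _

end EdgeList

namespace RealRAM

/-- `x + y` modulo `m`, for `x < m` and `y ≤ m`. -/
abbrev addMod (x y : WordExpr) : WordExpr := (x + y) - xm * .lt xm (x + y + one)

/-- Compute degrees and sums of edge numbers. -/
def initDegrees : Prog :=
  Prog.for 4 1
    (.setN 7 (.get 0 xi) ⨟
    .putN 2 xu (.get 2 xu + one) ⨟
    .putN 3 xu (addMod (.get 3 xu) xi) ⨟
    .setN 7 (.get 1 xi) ⨟
    .putN 2 xu (.get 2 xu + one) ⨟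
    .putN 3 xu (addMod (.get 3 xu) xi))

/-- Delete the edge `e` and update the data of its ends. -/
def deleteEdge : Prog :=
  .putN 4 xe one ⨟
  .setN 9 (.get 0 xe) ⨟
  .putN 2 xw (.get 2 xw - one) ⨟
  .putN 3 xw (addMod (.get 3 xw) (xm - xe)) ⨟
  .setN 9 (.get 1 xe) ⨟
  .putN 2 xw (.get 2 xw - one) ⨟
  .putN 3 xw (addMod (.get 3 xw) (xm - xe))

/-- While `u` has degree one, delete its edge, record it as a forest edge, and move to its other
end. The number of that edge is read off from `xs`, so no adjacency lists are needed. -/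
def stripChain : Prog :=
  .loop (.eq (.get 2 xu) one)
    (.setN 8 (.get 3 xu) ⨟
    .putN 5 xq xu ⨟
    .putN 6 xq (.get 0 xe + .get 1 xe - xu) ⨟
    .putN 7 xq (.eq (.get 0 xe) xu) ⨟
    deleteEdge ⨟
    .setN 7 (.get 6 xq) ⨟
    .setN 2 (xq + one))

/-- Strip leaves until none is left. Then, as long as there are edges, record one as an extra
edge, delete it, and strip the leaves which arise at its ends. -/
def buildForest : Prog :=
  initDegrees ⨟
  Prog.for 4 0 (.setN 7 xi ⨟ stripChain) ⨟
  Prog.for 4 1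
    (.ite (.get 4 xi) .skip
      ((.setN 8 xi ⨟
        .putN 8 xk (.get 0 xi) ⨟
        .putN 9 xk (.get 1 xi) ⨟
        .setN 3 (xk + one) ⨟
        deleteEdge ⨟
        .setN 7 (.get 0 xi)) ⨟
      stripChain ⨟ .setN 7 (.get 1 xi) ⨟ stripChain))

/-- The part of the memory which describes the digraph and the remaining edges `A`. -/
structure Memory.Alive (μ : Memory) (G : EdgeList) (A : Finset ℕ) : Prop where
  n_eq : μ.n = G.n
  m_eq : μ.m = G.m
  tl_eq : μ.tl = G.tl
  hd_eq : μ.hd = G.hd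
  sub : A ⊆ Finset.range G.m
  dead_eq : ∀ e < G.m, μ.dead e = if e ∈ A then 0 else 1
  inv : G.DegInv A μ.deg μ.xs

/-- The digraph is stored in the memory, and the other cells whose initial values matter are
zero. -/
structure Memory.IsInput (μ : Memory) (G : EdgeList) : Prop where
  n_eq : μ.n = G.n
  m_eq : μ.m = G.m
  tl_eq : μ.tl = G.tl
  hd_eq : μ.hd = G.hd
  q_eq : μ.q = 0
  k_eq : μ.k = 0
  deg_eq : μ.deg = fun _ => 0
  xs_eq : μ.xs = fun _ => 0
  dead_eq : μ.dead = fun _ => 0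
  B_eq : μ.B = fun _ => 0
  fin_eq : μ.fin = fun _ => 0

theorem exec_initDegrees {N : ℕ} {μ : Memory} {G : EdgeList} (h : μ.IsInput G)
    (hN : 2 * G.m + G.n + 2 < N) :
    Exec N initDegrees μ fun t μ' => t ≤ 100 * (G.m + 1) ∧ ∃ i' u' deg' xs',
      μ' = { μ with i := i', u := u', deg := deg', xs := xs' } ∧
      μ'.Alive G (Finset.range G.m) := by
  refine (Exec.for_const (d := G.m) (T := 70) (fun i μ' => ∃ u' deg' xs',
    μ' = { μ with i := i, u := u', deg := deg', xs := xs' } ∧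
      G.DegInv (Finset.range i) deg' xs') (by omega) (by omega) ?_ ?_ ?_).mono ?_
  · rintro i _ ⟨u', deg', xs', rfl, -⟩
    exact ⟨rfl, h.m_eq⟩
  · exact ⟨_, _, _, rfl, fun v _ => by simp [h.deg_eq, EdgeList.degree, EdgeList.star],
      fun v _ => by simp [h.xs_eq, EdgeList.star]⟩
  · rintro i hi _ ⟨u', deg', xs', rfl, h1⟩
    refine (exec_of_wp (Q := fun μ' => ∃ u' deg' xs',
      μ' = { μ with i := i, u := u', deg := deg', xs := xs' } ∧
      G.DegInv (Finset.range (i + 1)) deg' xs') ?_).mono ?_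
    · have hs := G.tl_lt i hi
      have ht := G.hd_lt i hi
      have hne := G.ne i hi
      have hm : 0 < G.m := by omega
      have hxs := h1.xs_lt hm hs
      have hxt := h1.xs_lt hm ht
      have hds := h1.deg_eq _ hs
      have hdt := h1.deg_eq _ ht
      have hcs := EdgeList.degree_le_card (G := G) (A := Finset.range i) (v := G.tl i)
      have hct := EdgeList.degree_le_card (G := G) (A := Finset.range i) (v := G.hd i)
      rw [Finset.card_range] at hcs hct
      have hms := EdgeList.addMod_eq hxs hi.le
      have hmt := EdgeList.addMod_eq hxt hi.le
      simp [h.tl_eq, h.hd_eq, h.m_eq, hne.symm]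
      constructorm* _ ∧ _ <;> try first | omega | (split_ifs <;> omega)
      rw [hms, hmt, Finset.range_add_one]
      refine h1.insert (by simp) (fun v hv => ?_) (fun v hv => ?_)
      · simp only [Function.update_apply]
        grind
      · simp only [Function.update_apply]
        grind
    · rintro t _ ⟨ht, u'', deg'', xs'', rfl, h3⟩
      exact ⟨ht.trans (by decide), rfl, u'', deg'', xs'', rfl, h3⟩
  · rintro t _ ⟨ht, u', deg', xs', rfl, h1⟩
    refine ⟨by omega, _, _, _, _, rfl, ⟨h.n_eq, h.m_eq, h.tl_eq, h.hd_eq, le_rfl, ?_, h1⟩⟩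
    intro e he
    simp [h.dead_eq, he]

theorem wp_deleteEdge {N : ℕ} {μ : Memory} {G : EdgeList} {A : Finset ℕ} (h : μ.Alive G A)
    (he : μ.e ∈ A) (hN : 2 * G.m + G.n + 2 < N) :
    wp N deleteEdge (fun μ' => ∃ w' dead' deg' xs',
      μ' = { μ with w := w', dead := dead', deg := deg', xs := xs' } ∧
      μ'.Alive G (A.erase μ.e)) μ := by
  have hem := Finset.mem_range.1 (h.sub he)
  have hs := G.tl_lt _ hem
  have ht := G.hd_lt _ hem
  have hne := G.ne _ hem
  have hm : 0 < G.m := by omega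
  have hxs := h.inv.xs_lt hm hs
  have hxt := h.inv.xs_lt hm ht
  have hds := h.inv.deg_eq _ hs
  have hdt := h.inv.deg_eq _ ht
  have hcs := EdgeList.degree_le_card (G := G) (A := A) (v := G.tl μ.e)
  have hct := EdgeList.degree_le_card (G := G) (A := A) (v := G.hd μ.e)
  have hA := Finset.card_le_card h.sub
  rw [Finset.card_range] at hA
  have hms := EdgeList.addMod_eq hxs (Nat.sub_le G.m μ.e)
  have hmt := EdgeList.addMod_eq hxt (Nat.sub_le G.m μ.e)
  simp [deleteEdge, h.tl_eq, h.hd_eq, h.m_eq, hne.symm]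
  constructorm* _ ∧ _ <;> try first | omega | (split_ifs <;> omega)
  rw [hms, hmt]
  refine ⟨h.n_eq, rfl, rfl, rfl, (Finset.erase_subset _ _).trans h.sub,
    fun e he => ?_, h.inv.erase he hem (fun v hv => ?_) (fun v hv => ?_)⟩
  · have := h.dead_eq e he
    simp only [Function.update_apply, Finset.mem_erase]
    grind
  · simp only [Function.update_apply]
    grind
  · simp only [Function.update_apply]
    grind

end RealRAM

namespace RealRAM

/-- The parts of the memory whose values are still needed are not touched while leaves are
stripped. -/
structure Memory.Frame (μ μ' : Memory) : Prop where
  i_eq : μ'.i = μ.i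
  k_eq : μ'.k = μ.k
  B_eq : μ'.B = μ.B
  fin_eq : μ'.fin = μ.fin
  a_eq : μ'.a = μ.a

/-- The edges of `G` are divided into the remaining edges `A`, forest edges in an elimination
order, and extra edges. -/
structure Memory.Strip (μ : Memory) (G : EdgeList) (A : Finset ℕ) : Prop extends
    μ.Alive G A where
  cu_lt : ∀ j < μ.q, μ.cu j < G.n
  cw_lt : ∀ j < μ.q, μ.cw j < G.n
  cd_le : ∀ j < μ.q, μ.cd j ≤ 1
  degree_cu : ∀ j < μ.q, G.degree A (μ.cu j) = 0
  cu_ne_cu : ∀ i j, i < j → j < μ.q → μ.cu i ≠ μ.cu j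
  cu_ne_cw : ∀ i j, i ≤ j → j < μ.q → μ.cu i ≠ μ.cw j
  card_eq : μ.q + μ.k + A.card = G.m
  es_lt : ∀ j < μ.k, μ.es j < G.n
  et_lt : ∀ j < μ.k, μ.et j < G.n
  edge_iff : ∀ x y, (∃ e < G.m, x = G.tl e ∧ y = G.hd e) ↔
    (∃ e ∈ A, x = G.tl e ∧ y = G.hd e) ∨
    (∃ j < μ.q, (μ.cd j ≠ 0 ∧ x = μ.cu j ∧ y = μ.cw j) ∨
      (μ.cd j = 0 ∧ x = μ.cw j ∧ y = μ.cu j)) ∨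
    ∃ j < μ.k, x = μ.es j ∧ y = μ.et j

variable {N : ℕ} {μ μ' : Memory} {G : EdgeList} {A : Finset ℕ} {e u : ℕ}

theorem exists_mem_erase_iff {p : ℕ → Prop} (he : e ∈ A) :
    (∃ x ∈ A, p x) ↔ p e ∨ ∃ x ∈ A.erase e, p x := by
  rw [← Finset.exists_mem_insert, Finset.insert_erase he]

theorem exists_lt_update_iff {k : ℕ} {p p' : ℕ → Prop} (hp : ∀ j < k, p' j ↔ p j) :
    (∃ j < k + 1, p' j) ↔ p' k ∨ ∃ j < k, p j := by
  constructor
  · rintro ⟨j, hj, h⟩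
    rcases Nat.lt_succ_iff_lt_or_eq.1 hj with hj | rfl
    · exact .inr ⟨j, hj, (hp j hj).1 h⟩
    · exact .inl h
  · rintro (h | ⟨j, hj, h⟩)
    · exact ⟨k, by omega, h⟩
    · exact ⟨j, by omega, (hp j hj).2 h⟩

/-- A leaf `u` is stripped. -/
theorem Memory.Strip.strip (h : μ.Strip G A) (hu : u < G.n) (he : G.star A u = {e})
    (hA : μ'.Alive G (A.erase e)) (hq : μ'.q = μ.q + 1) (hk : μ'.k = μ.k)
    (hcu : μ'.cu = Function.update μ.cu μ.q u)
    (hcw : μ'.cw = Function.update μ.cw μ.q (G.tl e + G.hd e - u))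
    (hcd : μ'.cd = Function.update μ.cd μ.q (if G.tl e = u then 1 else 0))
    (hes : μ'.es = μ.es) (het : μ'.et = μ.et) : μ'.Strip G (A.erase e) := by
  obtain ⟨heA, heu⟩ := EdgeList.mem_star.1 (he ▸ Finset.mem_singleton_self e)
  have hem := Finset.mem_range.1 (h.sub heA)
  have hs := G.tl_lt _ hem
  have ht := G.hd_lt _ hem
  have hne := G.ne _ hem
  have hcard := Finset.card_erase_of_mem heA
  have hpos := Finset.card_pos.2 ⟨e, heA⟩
  have hce := h.card_eq
  have hdu : ∀ j < μ.q, μ.cu j ≠ G.tl e ∧ μ.cu j ≠ G.hd e := by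
    intro j hj
    have h1 := Finset.card_eq_zero.1 (h.degree_cu j hj)
    constructor <;> intro h2 <;> refine Finset.notMem_empty e (h1 ▸ EdgeList.mem_star.2 ⟨heA, ?_⟩)
    · exact .inl h2.symm
    · exact .inr h2.symm
  have hue : G.degree (A.erase e) u = 0 := by
    rw [EdgeList.degree, EdgeList.star_erase, he]
    simp
  have hup : ∀ {f : ℕ → ℕ} {x j : ℕ}, j < μ.q → Function.update f μ.q x j = f j :=
    fun hj => Function.update_of_ne (by omega) _ _
  refine { hA with
    cu_lt := ?_, cw_lt := ?_, cd_le := ?_, degree_cu := ?_, cu_ne_cu := ?_, cu_ne_cw := ?_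
    card_eq := by omega, es_lt := by rw [hk, hes]; exact h.es_lt
    et_lt := by rw [hk, het]; exact h.et_lt, edge_iff := ?_ }
  · intro j hj
    rw [hcu]
    rcases Nat.lt_succ_iff_lt_or_eq.1 (hq ▸ hj) with hj | rfl
    · rw [hup hj]
      exact h.cu_lt j hj
    · rwa [Function.update_self]
  · intro j hj
    rw [hcw]
    rcases Nat.lt_succ_iff_lt_or_eq.1 (hq ▸ hj) with hj | rfl
    · rw [hup hj]
      exact h.cw_lt j hj
    · rw [Function.update_self]
      omega
  · intro j hj
    rw [hcd]
    rcases Nat.lt_succ_iff_lt_or_eq.1 (hq ▸ hj) with hj | rfl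
    · rw [hup hj]
      exact h.cd_le j hj
    · rw [Function.update_self]
      split_ifs <;> omega
  · intro j hj
    rw [hcu]
    rcases Nat.lt_succ_iff_lt_or_eq.1 (hq ▸ hj) with hj | rfl
    · rw [hup hj]
      have h1 := h.degree_cu j hj
      have h2 := G.degree_mono (Finset.erase_subset e A) (μ.cu j)
      omega
    · rwa [Function.update_self]
  · intro i j hij hj
    rw [hcu]
    rcases Nat.lt_succ_iff_lt_or_eq.1 (hq ▸ hj) with hj | rfl
    · rw [hup hj, hup (by omega)]
      exact h.cu_ne_cu i j hij hj
    · rw [Function.update_self, hup hij]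
      have := hdu i hij
      grind
  · intro i j hij hj
    rw [hcu, hcw]
    rcases Nat.lt_succ_iff_lt_or_eq.1 (hq ▸ hj) with hj | rfl
    · rw [hup hj, hup (by omega)]
      exact h.cu_ne_cw i j hij hj
    · rw [Function.update_self]
      rcases Nat.eq_or_lt_of_le hij with rfl | hij
      · rw [Function.update_self]
        omega
      · rw [hup hij]
        have := hdu i hij
        grind
  · intro x y
    rw [h.edge_iff, exists_mem_erase_iff heA, hq, hk, hes, het, hcu, hcw, hcd,
      exists_lt_update_iff (k := μ.q) (p := fun j => (μ.cd j ≠ 0 ∧ x = μ.cu j ∧ y = μ.cw j) ∨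
      (μ.cd j = 0 ∧ x = μ.cw j ∧ y = μ.cu j))
      (fun j hj => by rw [hup hj, hup hj, hup hj])]
    simp only [Function.update_self]
    have h1 : (x = G.tl e ∧ y = G.hd e) ↔
        ((if G.tl e = u then 1 else 0) ≠ 0 ∧ x = u ∧ y = G.tl e + G.hd e - u) ∨
        ((if G.tl e = u then 1 else 0) = 0 ∧ x = G.tl e + G.hd e - u ∧ y = u) := by
      split_ifs with h2
      · subst h2
        simp
      · have h3 : G.hd e = u := heu.resolve_left h2
        subst h3
        simp
    rw [h1]
    exact or_assoc.trans (or_left_comm.trans (or_congr_right or_assoc.symm))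

/-- An edge is declared an extra edge. -/
theorem Memory.Strip.pick (h : μ.Strip G A) (heA : e ∈ A)
    (hA : μ'.Alive G (A.erase e)) (hq : μ'.q = μ.q) (hk : μ'.k = μ.k + 1)
    (hcu : μ'.cu = μ.cu) (hcw : μ'.cw = μ.cw) (hcd : μ'.cd = μ.cd)
    (hes : μ'.es = Function.update μ.es μ.k (G.tl e))
    (het : μ'.et = Function.update μ.et μ.k (G.hd e)) : μ'.Strip G (A.erase e) := by
  have hem := Finset.mem_range.1 (h.sub heA)
  have hs := G.tl_lt _ hem
  have ht := G.hd_lt _ hem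
  have hcard := Finset.card_erase_of_mem heA
  have hpos := Finset.card_pos.2 ⟨e, heA⟩
  have hce := h.card_eq
  have hup : ∀ {f : ℕ → ℕ} {x j : ℕ}, j < μ.k → Function.update f μ.k x j = f j :=
    fun hj => Function.update_of_ne (by omega) _ _
  refine { hA with
    cu_lt := by rw [hq, hcu]; exact h.cu_lt
    cw_lt := by rw [hq, hcw]; exact h.cw_lt
    cd_le := by rw [hq, hcd]; exact h.cd_le
    degree_cu := ?_
    cu_ne_cu := by rw [hq, hcu]; exact h.cu_ne_cu
    cu_ne_cw := by rw [hq, hcu, hcw]; exact h.cu_ne_cw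
    card_eq := by omega
    es_lt := ?_, et_lt := ?_, edge_iff := ?_ }
  · intro j hj
    have h1 := h.degree_cu j (hq ▸ hj)
    have h2 := G.degree_mono (Finset.erase_subset e A) (μ.cu j)
    rw [hcu]
    omega
  · intro j hj
    rw [hes]
    rcases Nat.lt_succ_iff_lt_or_eq.1 (hk ▸ hj) with hj | rfl
    · rw [hup hj]
      exact h.es_lt j hj
    · rwa [Function.update_self]
  · intro j hj
    rw [het]
    rcases Nat.lt_succ_iff_lt_or_eq.1 (hk ▸ hj) with hj | rfl
    · rw [hup hj]
      exact h.et_lt j hj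
    · rwa [Function.update_self]
  · intro x y
    rw [h.edge_iff, exists_mem_erase_iff heA, hq, hk, hes, het, hcu, hcw, hcd,
      exists_lt_update_iff (k := μ.k) (p := fun j => x = μ.es j ∧ y = μ.et j)
      (fun j hj => by rw [hup hj, hup hj])]
    simp only [Function.update_self]
    rw [or_assoc]
    exact or_left_comm.trans (or_congr_right or_left_comm)

/-- If all leaves except possibly `u` satisfy `L`, then all leaves which are left satisfy `L`. The
time is charged to the edges which are deleted. -/
theorem exec_stripChain (L : ℕ → Prop) (h : μ.Strip G A) (hu : μ.u < G.n)
    (hL : ∀ x < G.n, x ≠ μ.u → G.degree A x = 1 → L x) (hN : 2 * G.m + 2 * G.n + 2 < N) :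
    Exec N stripChain μ fun t μ' => ∃ A' ⊆ A, μ'.Strip G A' ∧ μ.Frame μ' ∧
      (∀ x < G.n, G.degree A' x = 1 → L x) ∧ t + 200 * A'.card ≤ 200 * A.card + 5 := by
  refine (Exec.loop (fun t μ' => ∃ A' ⊆ A, μ'.Strip G A' ∧ μ.Frame μ' ∧ μ'.u < G.n ∧
    (∀ x < G.n, x ≠ μ'.u → G.degree A' x = 1 → L x) ∧ t + 200 * A'.card ≤ 200 * A.card)
    (fun μ' => G.m - μ'.q) ?_ (t₀ := 0)
    ⟨A, le_rfl, h, ⟨rfl, rfl, rfl, rfl, rfl⟩, hu, hL, by omega⟩).mono ?_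
  · rintro t μ' ⟨A', hA', h', hF, hu', hL', ht⟩
    have hdu := h'.inv.deg_eq _ hu'
    have hAm := Finset.card_le_card h'.sub
    rw [Finset.card_range] at hAm
    have hdc := EdgeList.degree_le_card (G := G) (A := A') (v := μ'.u)
    refine ⟨?_, fun h0 => ?_⟩
    · by_cases h1 : μ'.deg μ'.u = 1 <;> simp [h1] <;> omega
    have h1 : μ'.deg μ'.u = 1 := by
      by_contra h1
      simp [h1] at h0
    have hstar := h'.inv.star_eq h'.sub hu' h1
    obtain ⟨heA, heu⟩ := EdgeList.mem_star.1 (hstar ▸ Finset.mem_singleton_self (μ'.xs μ'.u))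
    have hem := Finset.mem_range.1 (h'.sub heA)
    have hs := G.tl_lt _ hem
    have htl := G.hd_lt _ hem
    have hcard := Finset.card_erase_of_mem heA
    have hpos := Finset.card_pos.2 ⟨_, heA⟩
    have hce := h'.card_eq
    refine (exec_of_wp (Q := fun μ'' => μ''.Strip G (A'.erase (μ'.xs μ'.u)) ∧ μ.Frame μ'' ∧
      μ''.u = G.tl (μ'.xs μ'.u) + G.hd (μ'.xs μ'.u) - μ'.u ∧ μ''.q = μ'.q + 1) ?_).mono ?_
    · simp [h'.tl_eq, h'.hd_eq]
      constructorm* _ ∧ _ <;> try first | omega | (split_ifs <;> omega)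
      refine wp_mono ?_ (wp_deleteEdge (G := G) (A := A') ⟨h'.n_eq, h'.m_eq, rfl, rfl, h'.sub,
        h'.dead_eq, h'.inv⟩ heA (by omega))
      rintro _ ⟨w', dead', deg', xs', rfl, hAl⟩
      simp
      constructorm* _ ∧ _ <;> try omega
      · refine h'.strip hu' hstar ⟨hAl.n_eq, hAl.m_eq, hAl.tl_eq, hAl.hd_eq, hAl.sub,
          hAl.dead_eq, hAl.inv⟩ rfl rfl rfl rfl ?_ rfl rfl
        simp
      · exact ⟨hF.i_eq, hF.k_eq, hF.B_eq, hF.fin_eq, hF.a_eq⟩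
    · rintro t' μ'' ⟨ht', h3, h4, h5, h6⟩
      have ht'' : t' ≤ 150 := ht'.trans (by decide)
      refine ⟨by omega, _, (Finset.erase_subset _ _).trans hA', h3, h4, by omega,
        fun x hx hxu hx1 => ?_, ?_⟩
      · have h7 : x ≠ μ'.u := by
          rintro rfl
          rw [EdgeList.degree, EdgeList.star_erase, hstar] at hx1
          simp at hx1
        refine hL' x hx h7 ?_
        rw [EdgeList.degree_erase heA, if_neg] at hx1
        · exact hx1
        · grind
      · simp only [WordExpr.cost]
        omega
  · rintro t μ' ⟨h0, t₁, ⟨A', hA', h', hF, hu', hL', ht⟩, ht₁⟩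
    simp only [WordExpr.cost] at ht₁
    refine ⟨A', hA', h', hF, fun x hx hx1 => ?_, by omega⟩
    by_cases hxu : x = μ'.u
    · rw [← h'.inv.deg_eq _ hx, hxu] at hx1
      simp [hx1] at h0
    · exact hL' x hx hxu hx1

end RealRAM

namespace RealRAM

variable {N : ℕ} {μ μ' : Memory} {G : EdgeList} {A F : Finset ℕ}

theorem Memory.Strip.set_i_u (h : μ.Strip G A) (i' u' : ℕ) :
    Memory.Strip { μ with i := i', u := u' } G A :=
  ⟨⟨h.n_eq, h.m_eq, h.tl_eq, h.hd_eq, h.sub, h.dead_eq, h.inv⟩, h.cu_lt, h.cw_lt, h.cd_le,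
    h.degree_cu, h.cu_ne_cu, h.cu_ne_cw, h.card_eq, h.es_lt, h.et_lt, h.edge_iff⟩

/-- One round through all vertices suffices: stripping a chain from `i` leaves no leaf below
`i + 1`. -/
theorem exec_stripLeaves (h : μ.Strip G A) (hN : 2 * G.m + 2 * G.n + 2 < N) :
    Exec N (Prog.for 4 0 (.setN 7 xi ⨟ stripChain)) μ fun t μ' =>
      ∃ A' ⊆ A, μ'.Strip G A' ∧ Memory.Frame { μ with i := μ'.i } μ' ∧ G.Leafless A' ∧
        t ≤ 200 * A.card + 20 * G.n + 6 := by
  refine (Exec.for (d := G.n) (fun i t μ' => i ≤ G.n ∧ ∃ A' ⊆ A, μ'.Strip G A' ∧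
    Memory.Frame { μ with i := i } μ' ∧ (∀ x < G.n, G.degree A' x = 1 → i ≤ x) ∧
      t + 200 * A'.card ≤ 200 * A.card + 20 * i + 2) (by omega) (by omega) ?_ ?_ ?_).mono ?_
  · rintro i t μ' ⟨hi, A', -, h', hF, -⟩
    exact ⟨hi, hF.i_eq, h'.n_eq⟩
  · exact ⟨Nat.zero_le _, A, le_rfl, h.set_i_u _ _, ⟨rfl, rfl, rfl, rfl, rfl⟩,
      fun _ _ _ => Nat.zero_le _, by omega⟩
  · rintro i hi t μ₁ ⟨-, A₁, hA₁, h₁, hF₁, hL₁, ht₁⟩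
    have hi₁ : μ₁.i = i := hF₁.i_eq
    refine Exec.seq (Exec.setN (by omega) (by simp; omega) ?_)
    refine (exec_stripChain (G := G) (A := A₁) (fun x => i + 1 ≤ x) (h₁.set_i_u μ₁.i μ₁.i)
      (hi₁ ▸ hi) (fun x hx hxi hx1 => ?_) hN).mono ?_
    · have h2 := hL₁ x hx hx1
      have h3 : x ≠ i := hi₁ ▸ hxi
      omega
    · rintro t' μ' ⟨A', hA', h', hF', hL', ht'⟩
      refine ⟨hF'.i_eq.trans hi₁, hi, A', hA'.trans hA₁, h'.set_i_u _ _,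
        ⟨rfl, hF'.k_eq.trans hF₁.k_eq, hF'.B_eq.trans hF₁.B_eq, hF'.fin_eq.trans hF₁.fin_eq,
          hF'.a_eq.trans hF₁.a_eq⟩, hL', ?_⟩
      simp only [WordExpr.cost]
      omega
  · rintro t μ' ⟨t', -, rfl, -, A', hA', h', hF', hL', ht'⟩
    have hi' : μ'.i = G.n := hF'.i_eq
    refine ⟨A', hA', h', hi' ▸ hF', fun x hx hx1 => ?_, by omega⟩
    have := hL' x hx hx1
    omega

/-- In every round the remaining edge set is leafless, and the number of extra edges plus the
potential of the remaining edges stays at most `2 * F.card`, since picking an edge decreases the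
potential. -/
theorem exec_buildForest (h : μ.IsInput G) (hF : G.IsFeedback F)
    (hN : 2 * G.m + 2 * G.n + 2 < N) :
    Exec N buildForest μ fun t μ' => t ≤ 1000 * (G.m + G.n + 1) ∧ μ'.Strip G ∅ ∧
      μ'.k ≤ 2 * F.card ∧ μ'.B = μ.B ∧ μ'.fin = μ.fin ∧ μ'.a = μ.a := by
  refine Exec.seq ((exec_initDegrees h (by omega)).mono ?_)
  rintro t₀ _ ⟨ht₀, i₀, u₀, deg₀, xs₀, rfl, h₀⟩
  have hS : Memory.Strip { μ with i := i₀, u := u₀, deg := deg₀, xs := xs₀ } G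
      (Finset.range G.m) := by
    refine ⟨h₀, ?_, ?_, ?_, ?_, ?_, ?_, ?_, ?_, ?_, ?_⟩ <;> simp [h.q_eq, h.k_eq]
  refine Exec.seq ((exec_stripLeaves hS hN).mono ?_)
  rintro t₁ μ₁ ⟨A₁, hA₁, h₁, hF₁, hL₁, ht₁⟩
  have hk₁ : μ₁.k = 0 := hF₁.k_eq.trans h.k_eq
  refine (Exec.for (d := G.m) (fun i t μ' => i ≤ G.m ∧ ∃ A, μ'.Strip G A ∧ μ'.i = i ∧
    μ'.B = μ.B ∧ μ'.fin = μ.fin ∧ μ'.a = μ.a ∧ G.Leafless A ∧ (∀ e ∈ A, i ≤ e) ∧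
    μ'.k + A.card + (A ∩ F).card ≤ 2 * F.card + (G.support A).card ∧
    t + 200 * A.card ≤ 200 * G.m + 300 * i + 2) (by omega) (by omega) ?_ ?_ ?_).mono ?_
  · rintro i t μ' ⟨hi, A, h', hi', -⟩
    exact ⟨hi, hi', h'.m_eq⟩
  · have h2 := Finset.card_le_card h₁.sub
    rw [Finset.card_range] at h2
    refine ⟨Nat.zero_le _, A₁, h₁.set_i_u _ _, rfl, hF₁.B_eq, hF₁.fin_eq, hF₁.a_eq, hL₁,
      fun _ _ => Nat.zero_le _, ?_, by omega⟩
    have h3 := EdgeList.potential_le hF h₁.sub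
    have h4 : (μ₁.setN 4 0).k = 0 := hk₁
    omega
  · rintro i hi t μ₂ ⟨-, A, h₂, rfl, hB, hfin, ha, hL, hge, hpot, ht⟩
    have hdi := h₂.dead_eq μ₂.i hi
    refine Exec.ite ?_ (fun h0 => ?_) (fun h0 => ?_)
    · simp [hdi]
      split_ifs <;> omega
    · have hiA : μ₂.i ∉ A := fun hiA => h0 (by simp [hdi, hiA])
      refine ⟨_, _, .skip _, rfl, hi, A, h₂.set_i_u _ _, rfl, hB, hfin, ha, hL, fun e he => ?_,
        hpot, ?_⟩
      · have h3 := hge e he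
        have h4 : e ≠ μ₂.i := fun h => hiA (h ▸ he)
        omega
      · simp only [WordExpr.cost]
        omega
    · have hiA : μ₂.i ∈ A := by
        by_contra hiA
        simp [hdi, hiA] at h0
      have hs := G.tl_lt _ hi
      have htl := G.hd_lt _ hi
      have hce := h₂.card_eq
      have hpos := Finset.card_pos.2 ⟨_, hiA⟩
      have hcard := Finset.card_erase_of_mem hiA
      refine Exec.seq ((exec_of_wp (Q := fun μ' => μ'.Strip G (A.erase μ₂.i) ∧
        Memory.Frame { μ₂ with k := μ₂.k + 1 } μ' ∧ μ'.u = G.tl μ₂.i) ?_).mono ?_)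
      · simp [h₂.tl_eq, h₂.hd_eq]
        constructorm* _ ∧ _ <;> try omega
        refine wp_mono ?_ (wp_deleteEdge (G := G) (A := A) ⟨h₂.n_eq, h₂.m_eq, rfl, rfl, h₂.sub,
          h₂.dead_eq, h₂.inv⟩ hiA (by omega))
        rintro _ ⟨w', dead', deg', xs', rfl, hAl⟩
        simp
        constructorm* _ ∧ _ <;> try omega
        · exact h₂.pick hiA ⟨hAl.n_eq, hAl.m_eq, hAl.tl_eq, hAl.hd_eq, hAl.sub,
            hAl.dead_eq, hAl.inv⟩ rfl rfl rfl rfl rfl rfl rfl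
        · exact ⟨rfl, rfl, rfl, rfl, rfl⟩
      · rintro t₃ μ₃ ⟨ht₃, h₃, hF₃, hu₃⟩
        have ht₃' : t₃ ≤ 150 := ht₃.trans (by decide)
        -- new leaves can arise only at the two ends of the deleted edge
        refine Exec.seq ((exec_stripChain (fun x => x = G.hd μ₂.i) h₃ (hu₃ ▸ hs)
          (fun x hx hxu hx1 => ?_) hN).mono ?_)
        · by_contra hne
          rw [EdgeList.degree_erase hiA, if_neg] at hx1
          · exact hL x hx hx1
          · rw [hu₃] at hxu
            grind
        rintro t₄ μ₄ ⟨A₄, hA₄, h₄, hF₄, hL₄, ht₄⟩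
        have hi₄ : μ₄.i = μ₂.i := hF₄.i_eq.trans hF₃.i_eq
        refine Exec.seq (Exec.setN (by omega) ?_ ?_)
        · simp [hi₄, h₄.hd_eq]
          omega
        have hu₄ : (WordExpr.get 1 xi).eval μ₄.toState = G.hd μ₂.i := by
          simp [hi₄, h₄.hd_eq]
        rw [hu₄]
        refine (exec_stripChain (fun _ => False) (h₄.set_i_u μ₄.i (G.hd μ₂.i)) htl
          (fun x hx hxu hx1 => hxu (hL₄ x hx hx1)) hN).mono ?_
        rintro t₅ μ₅ ⟨A₅, hA₅, h₅, hF₅, hL₅, ht₅⟩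
        have hsub : A₅ ⊆ A.erase μ₂.i := hA₅.trans hA₄
        have hss : A₅ ⊂ A := lt_of_le_of_lt hsub (Finset.erase_ssubset hiA)
        have hk₅ : μ₅.k = μ₂.k + 1 := hF₅.k_eq.trans (hF₄.k_eq.trans hF₃.k_eq)
        have hlt := hL.potential_lt hF h₂.sub hss
        refine ⟨hF₅.i_eq.trans hi₄, hi, A₅, h₅.set_i_u _ _, rfl,
          hF₅.B_eq.trans (hF₄.B_eq.trans (hF₃.B_eq.trans hB)),
          hF₅.fin_eq.trans (hF₄.fin_eq.trans (hF₃.fin_eq.trans hfin)),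
          hF₅.a_eq.trans (hF₄.a_eq.trans (hF₃.a_eq.trans ha)), hL₅, fun e he => ?_, ?_, ?_⟩
        · have h6 := Finset.mem_erase.1 (hsub he)
          have h7 := hge e h6.2
          have h8 := h6.1
          omega
        · have : (μ₅.setN 4 (μ₂.i + 1)).k = μ₂.k + 1 := hk₅
          omega
        · simp only [WordExpr.cost]
          omega
  · rintro t μ' ⟨t', -, rfl, -, A, h', -, hB, hfin, ha, hL, hge, hpot, ht'⟩
    have hA : A = ∅ := by
      refine Finset.eq_empty_of_forall_notMem fun e he => ?_
      have h3 := hge e he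
      have h4 := Finset.mem_range.1 (h'.sub he)
      omega
    subst hA
    have h5 := hL.card_support_le h'.sub
    rw [Finset.card_empty] at h5 hpot
    rw [Finset.card_range] at ht₁
    exact ⟨by omega, h', by omega, hB, hfin, ha⟩

/-- The forest which is found when all edges are processed. -/
def Memory.Strip.forest (h : μ.Strip G ∅) : ElimForest where
  n := G.n
  q := μ.q
  cu := μ.cu
  cw := μ.cw
  up j := μ.cd j ≠ 0
  cu_lt := h.cu_lt
  cw_lt := h.cw_lt
  cu_ne_cu := h.cu_ne_cu
  cu_ne_cw := h.cu_ne_cw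

theorem Memory.Strip.edge_iff_forest (h : μ.Strip G ∅) (x y : ℕ) :
    (∃ e < G.m, x = G.tl e ∧ y = G.hd e) ↔
      h.forest.Edge 0 x y ∨ ∃ j < μ.k, x = μ.es j ∧ y = μ.et j := by
  rw [h.edge_iff, ElimForest.Edge]
  simp [forest]

end RealRAM

/-! ### Which extra edges are reachable -/

namespace RealRAM

open Classical in
/-- The truth value of a proposition as a machine word. -/
noncomputable def bit (p : Prop) : ℕ := if p then 1 else 0

@[simp] theorem bit_eq_zero {p : Prop} : bit p = 0 ↔ ¬ p := by
  unfold bit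
  split_ifs with h <;> simp [h]

theorem bit_le_one (p : Prop) : bit p ≤ 1 := by
  unfold bit
  split_ifs <;> simp

theorem bit_true {p : Prop} (hp : p) : bit p = 1 := if_pos hp

theorem bit_congr {p q : Prop} (h : p ↔ q) : bit p = bit q := by rw [propext h]

theorem bit_inj {p q : Prop} : bit p = bit q ↔ (p ↔ q) := by
  refine ⟨fun h => ?_, bit_congr⟩
  rw [← not_iff_not, ← bit_eq_zero, ← bit_eq_zero, h]

theorem row_lt {n i j v : ℕ} (h : j < i) (hv : v < n) : j * n + v < i * n := by
  have h1 : (j + 1) * n ≤ i * n := Nat.mul_le_mul_right n h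
  rw [Nat.succ_mul] at h1
  omega

theorem row_inj {n i j v w : ℕ} (hv : v < n) (hw : w < n) :
    i * n + v = j * n + w ↔ i = j ∧ v = w := by
  refine ⟨fun h => ?_, by rintro ⟨rfl, rfl⟩; rfl⟩
  rcases lt_trichotomy i j with h1 | rfl | h1
  · have := row_lt h1 hv
    omega
  · exact ⟨rfl, by omega⟩
  · have := row_lt h1 hw
    omega

theorem _root_.ElimForest.val_update_single (T : ElimForest) {s : ℕ} (hs : s < T.n) (v : ℕ) :
    T.val 0 (Function.update (fun _ => 0) s 1) v = bit (T.Reach 0 v s) := by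
  classical
  unfold ElimForest.val bit
  simp only [Function.update_apply, Finset.sum_ite_eq', Finset.mem_filter, Finset.mem_range]
  simp [hs]

/-- In row `i < k` of `B`, mark the vertices from which `es i` is reachable inside the forest. -/
def forestRows : Prog :=
  .setN 11 (.const 0) ⨟
  Prog.for 4 3
    ((.setN 10 (xi * xn) ⨟
    .putN 10 (xb + .get 8 xi) one) ⨟
    propagate)

/-- Warshall's closure: admit the extra edges one after the other. When the edge `i` is admitted,
the entry of row `j` at the vertex `l` becomes `1` if `l` reaches the tail of `i` and the head of
`i` reaches the tail of `j`. -/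
def closeRows : Prog :=
  Prog.for 4 3 (Prog.for 5 3 (Prog.for 6 0
    (.ite (.get 10 (xi * xn + xl) * .get 10 (xj * xn + .get 9 xi))
      (.putN 10 (xj * xn + xl) one)
      .skip)))

variable {N : ℕ} {μ : Memory} {T : ElimForest}

theorem exec_forestRows (h : μ.HasForest T 0) (hB : μ.B = fun _ => 0)
    (hes : ∀ j < μ.k, μ.es j < μ.n) (hN : μ.k * μ.n + μ.n + 2 < N) (hk : μ.k < N) :
    Exec N forestRows μ fun t μ' => t ≤ 300 * (μ.k + 1) * (μ.n + 1) ∧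
      ∃ flip' i' j' e' b' B',
      μ' = { μ with flip := flip', i := i', j := j', e := e', b := b', B := B' } ∧
      ∀ j < μ.k, ∀ v < μ.n, B' (j * μ.n + v) = bit (T.Reach 0 v (μ.es j)) := by
  refine Exec.seq (Exec.setN (by omega) (by simp; omega) ?_)
  refine (Exec.for_const (d := μ.k) (T := 20 + 200 * (μ.n + 1)) (fun i μ' => ∃ j' e' b' B',
    μ' = { μ with flip := 0, i := i, j := j', e := e', b := b', B := B' } ∧
    (∀ j < i, ∀ v < μ.n, B' (j * μ.n + v) = bit (T.Reach 0 v (μ.es j))) ∧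
    ∀ x, i * μ.n ≤ x → B' x = 0) (by omega) (by omega) ?_ ?_ ?_).mono ?_
  · rintro i _ ⟨j', e', b', B', rfl, -⟩
    exact ⟨rfl, rfl⟩
  · exact ⟨_, _, _, _, rfl, by simp, by simp [hB]⟩
  · rintro i hi _ ⟨j', e', b', B', rfl, h1, h2⟩
    have hei := hes i hi
    have hrow := row_lt hi hei
    have hrow' : i * μ.n ≤ μ.k * μ.n := Nat.mul_le_mul_right _ hi.le
    refine Exec.seq ((exec_of_wp (Q := fun μ' => μ' = { μ with
      flip := 0, i := i, j := j', e := e', b := i * μ.n,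
      B := Function.update B' (i * μ.n + μ.es i) 1 }) ?_).mono ?_)
    · simp
      omega
    · rintro t _ ⟨ht, rfl⟩
      have hst : (fun v => Function.update B' (i * μ.n + μ.es i) 1 (i * μ.n + v)) =
          Function.update (fun _ => 0) (μ.es i) 1 := by
        rw [update_add_left]
        congr 1
        funext v
        exact h2 _ (by omega)
      have hval : ∀ v, T.val 0 (fun v => Function.update B' (i * μ.n + μ.es i) 1 (i * μ.n + v)) v =
          bit (T.Reach 0 v (μ.es i)) := fun v => by
        rw [hst, ElimForest.val_update_single T (by rwa [h.n_eq])]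
      refine (exec_propagate (T := T) (c := 1) (μ := { μ with
        flip := 0, i := i, j := j', e := e', b := i * μ.n,
        B := Function.update B' (i * μ.n + μ.es i) 1 })
        ⟨h.n_eq, h.q_eq, h.cu_eq, h.cw_eq, h.up_iff, h.cd_le, h.flip_le⟩ (by omega) (by simp; omega)
        (by simp; omega) (by omega)
        (fun v hv => (hval v).trans_le (bit_le_one _))).mono ?_
      rintro t' _ ⟨ht', B'', e'', rfl, h3, h4⟩
      have ht20 : t ≤ 20 := ht.trans (by decide)
      refine ⟨add_le_add ht20 ht', rfl, _, _, _, _, rfl, fun j hj v hv => ?_, fun x hx => ?_⟩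
      · rcases Nat.lt_succ_iff_lt_or_eq.1 hj with hj | rfl
        · have h5 := row_lt hj hv
          refine (h4 _ (fun w _ => ?_)).trans ((Function.update_of_ne ?_ _ _).trans (h1 j hj v hv))
          · simp
            omega
          · omega
        · exact (h3 v hv).trans (hval v)
      · rw [Nat.succ_mul] at hx
        refine (h4 x (fun w hw => ?_)).trans ((Function.update_of_ne ?_ _ _).trans (h2 x ?_))
        · simp at hw ⊢
          omega
        · omega
        · omega
  · rintro t _ ⟨ht, j', e', b', B', rfl, h1, -⟩
    refine ⟨?_, _, _, _, _, _, _, rfl, h1⟩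
    simp only [WordExpr.cost]
    nlinarith

/-- The rows of `B` while the extra edge `i` is admitted: all entries before entry `l` of row `j`
take the new edge into account. -/
def RowsInv (T : ElimForest) (es et : ℕ → ℕ) (n k i j l : ℕ) (B : ℕ → ℕ) : Prop :=
  ∀ r < k, ∀ v < n, B (r * n + v) =
    bit (T.ExtReach es et (if r < j ∨ (r = j ∧ v < l) then i + 1 else i) v (es r))

/-- One step of the transitive closure. The entries that are read do not change while
the extra edge `i` is admitted, so it does not matter whether they are updated already. -/
theorem RowsInv.step {es et : ℕ → ℕ} {n k i j l : ℕ} {B : ℕ → ℕ}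
    (h : RowsInv T es et n k i j l B) (hi : i < k) (hj : j < k) (hl : l < n) (het : et i < n) :
    (B (i * n + l) * B (j * n + et i) ≠ 0 →
      RowsInv T es et n k i j (l + 1) (Function.update B (j * n + l) 1)) ∧
    (B (i * n + l) * B (j * n + et i) = 0 → RowsInv T es et n k i j (l + 1) B) := by
  have h1 : B (i * n + l) = bit (T.ExtReach es et i l (es i)) := by
    rw [h i hi l hl]
    split_ifs
    · refine bit_congr ?_
      rw [ElimForest.extReach_succ]
      tauto
    · rfl
  have h2 : B (j * n + et i) = bit (T.ExtReach es et i (et i) (es j)) := by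
    rw [h j hj _ het]
    split_ifs
    · refine bit_congr ?_
      rw [ElimForest.extReach_succ]
      tauto
    · rfl
  have h3 := h j hj l hl
  rw [if_neg (by omega)] at h3
  have h4 : ∀ r < k, ∀ v < n, ¬ (r = j ∧ v = l) → B (r * n + v) =
      bit (T.ExtReach es et (if r < j ∨ (r = j ∧ v < l + 1) then i + 1 else i) v (es r)) := by
    intro r hr v hv hne
    rw [h r hr v hv]
    have h5 : (r < j ∨ (r = j ∧ v < l)) ↔ (r < j ∨ (r = j ∧ v < l + 1)) := by omega
    simp only [h5]
  have h6 : B (i * n + l) * B (j * n + et i) = 0 ↔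
      ¬ (T.ExtReach es et i l (es i) ∧ T.ExtReach es et i (et i) (es j)) := by
    rw [h1, h2, mul_eq_zero, bit_eq_zero, bit_eq_zero, not_and_or]
  refine ⟨fun h0 r hr v hv => ?_, fun h0 r hr v hv => ?_⟩
  · rw [Ne, h6, not_not] at h0
    by_cases hne : r = j ∧ v = l
    · obtain ⟨rfl, rfl⟩ := hne
      rw [Function.update_self, if_pos (by omega), bit_true]
      exact (ElimForest.extReach_succ _ _).2 (.inr h0)
    · rw [Function.update_of_ne (by rwa [Ne, row_inj hv hl]), h4 r hr v hv hne]
  · rw [h6] at h0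
    by_cases hne : r = j ∧ v = l
    · obtain ⟨rfl, rfl⟩ := hne
      rw [h3, if_pos (by omega)]
      refine bit_congr ?_
      rw [ElimForest.extReach_succ]
      tauto
    · exact h4 r hr v hv hne

theorem exec_closeRows (het : ∀ j < μ.k, μ.et j < μ.n)
    (hB : ∀ j < μ.k, ∀ v < μ.n, μ.B (j * μ.n + v) = bit (T.Reach 0 v (μ.es j)))
    (hN : μ.k * μ.n + μ.n + 2 < N) (hk : μ.k < N) :
    Exec N closeRows μ fun t μ' => t ≤ 100 * (μ.k + 1) * (μ.k + 1) * (μ.n + 1) ∧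
      ∃ i' j' l' B', μ' = { μ with i := i', j := j', l := l', B := B' } ∧
      ∀ j < μ.k, ∀ v < μ.n,
        B' (j * μ.n + v) = bit (T.ExtReach μ.es μ.et μ.k v (μ.es j)) := by
  refine (Exec.for_const (d := μ.k) (T := μ.k * (μ.n * (40 + 8) + 6 + 8) + 6)
    (fun i μ' => ∃ j' l' B', μ' = { μ with i := i, j := j', l := l', B := B' } ∧
      RowsInv T μ.es μ.et μ.n μ.k i 0 0 B') (by omega) (by omega) ?_ ?_ ?_).mono ?_
  · rintro i _ ⟨j', l', B', rfl, -⟩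
    exact ⟨rfl, rfl⟩
  · refine ⟨_, _, _, rfl, fun j hj v hv => ?_⟩
    rw [hB j hj v hv, if_neg (by omega)]
    exact bit_congr (ElimForest.extReach_zero _ _).symm
  · rintro i hi _ ⟨j', l', B', rfl, hR⟩
    refine (Exec.for_const (d := μ.k) (T := μ.n * (40 + 8) + 6)
      (fun j μ' => ∃ l' B', μ' = { μ with i := i, j := j, l := l', B := B' } ∧
        RowsInv T μ.es μ.et μ.n μ.k i j 0 B') (by omega) (by omega) ?_ ⟨_, _, rfl, hR⟩ ?_).mono ?_
    · rintro j _ ⟨l', B', rfl, -⟩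
      exact ⟨rfl, rfl⟩
    · rintro j hj _ ⟨l', B', rfl, hR⟩
      refine (Exec.for_const (d := μ.n) (T := 40)
        (fun l μ' => ∃ B', μ' = { μ with i := i, j := j, l := l, B := B' } ∧
          RowsInv T μ.es μ.et μ.n μ.k i j l B') (by omega) (by omega) ?_ ⟨_, rfl, hR⟩ ?_).mono ?_
      · rintro l _ ⟨B', rfl, -⟩
        exact ⟨rfl, rfl⟩
      · rintro l hl _ ⟨B', rfl, hR⟩
        have hstep := hR.step hi hj hl (het i hi)
        have hil := row_lt hi hl
        have hjl := row_lt hj hl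
        have hjt := row_lt hj (het i hi)
        have hti := het i hi
        have hb1 : B' (i * μ.n + l) ≤ 1 := (hR i hi l hl).trans_le (bit_le_one _)
        have hb2 : B' (j * μ.n + μ.et i) ≤ 1 := (hR j hj _ hti).trans_le (bit_le_one _)
        have hb3 : B' (i * μ.n + l) * B' (j * μ.n + μ.et i) ≤ 1 := Nat.mul_le_mul hb1 hb2
        refine (exec_of_wp (Q := fun μ' => ∃ B', μ' = { μ with i := i, j := j, l := l, B := B' } ∧
          RowsInv T μ.es μ.et μ.n μ.k i j (l + 1) B') ?_).mono ?_
        · simp only [wp]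
          refine ⟨?_, fun h0 => ?_, fun h0 => ⟨_, rfl, hstep.2 h0⟩⟩
          · simp
            omega
          · refine ⟨by omega, ?_, ?_, _, rfl, hstep.1 h0⟩
            · simp
              omega
            · simp
              omega
        · rintro t _ ⟨ht, B'', rfl, hR'⟩
          exact ⟨ht.trans (by decide), rfl, B'', rfl, hR'⟩
      · rintro t _ ⟨ht, B'', rfl, hR'⟩
        refine ⟨ht, rfl, _, _, rfl, fun r hr v hv => ?_⟩
        refine (hR' r hr v hv).trans ?_
        have h5 : (r < j ∨ (r = j ∧ v < μ.n)) ↔ (r < j + 1 ∨ (r = j + 1 ∧ v < 0)) := by omega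
        simp only [h5]
    · rintro t _ ⟨ht, l'', B'', rfl, hR'⟩
      refine ⟨ht, rfl, _, _, _, rfl, fun r hr v hv => ?_⟩
      refine (hR' r hr v hv).trans ?_
      rw [if_pos (by omega), if_neg (by omega)]
  · rintro t _ ⟨ht, j', l', B', rfl, hR⟩
    refine ⟨?_, _, _, _, _, rfl, fun j hj v hv => ?_⟩
    · nlinarith [Nat.zero_le (μ.k * μ.n), Nat.zero_le (μ.k * μ.k), Nat.zero_le (μ.k * μ.k * μ.n)]
    · rw [hR j hj v hv, if_neg (by omega)]

end RealRAM

/-! ### The sums over reachable sets -/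

namespace RealRAM

/-- In row `k` of `B`, mark the vertices which are reachable in the forest from the head of some
extra edge whose tail is reachable from the vertex `i`. A mark is any number different from zero;
it counts heads, so it is at most `n`. -/
def markRow : Prog :=
  .setN 10 (xk * xn) ⨟
  Prog.for 5 0 (.putN 10 (xb + xj) (.const 0)) ⨟
  Prog.for 5 3
    (.ite (.get 10 (xj * xn + xi)) (.putN 10 (xb + .get 9 xj) one) .skip) ⨟
  .setN 11 one ⨟
  propagate

/-- Compute in `W` the total weight of the marked vertices, and in `D` the weight of the unmarked
vertices which are reachable in the forest. -/
def sumWeights : Prog :=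
  .setR 0 .zero ⨟
  Prog.for 5 0
    (.ite (.get 10 (xb + xj))
      (.setR 0 (.add (.var 0) (.get 0 xj)) ⨟ .putR 2 xj .zero)
      (.putR 2 xj (.get 0 xj))) ⨟
  propagateReal

/-- Store the results for all vertices which reach the same extra edges as `i` does. -/
def storeResults : Prog :=
  Prog.for 5 0
    (.setN 12 (.const 0) ⨟
    Prog.for 6 3
      (.ite (.eq (.get 10 (xl * xn + xi)) (.get 10 (xl * xn + xj))) .skip (.setN 12 one)) ⨟
    .ite xflag .skip (.putN 11 xj one ⨟ .putR 1 xj (.add (.var 0) (.get 2 xj))))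

/-- Treat every vertex which is not solved yet, together with all vertices that reach the same
extra edges. -/
def solve : Prog :=
  Prog.for 4 0 (.ite (.get 11 xi) .skip (markRow ⨟ sumWeights ⨟ storeResults))

variable {N : ℕ} {μ : Memory} {T : ElimForest}

/-- The forest, the extra edges and their rows are stored in the memory. -/
structure Memory.Ready (μ : Memory) (T : ElimForest) : Prop where
  forest : μ.HasForest T 0
  et_lt : ∀ j < μ.k, μ.et j < μ.n
  row_eq : ∀ j < μ.k, ∀ v < μ.n, μ.B (j * μ.n + v) = bit (T.ExtReach μ.es μ.et μ.k v (μ.es j))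

/-- The vertices which are reachable in the forest from the head of some extra edge whose tail is
reachable from `v`. -/
def Memory.Marked (μ : Memory) (T : ElimForest) (v y : ℕ) : Prop :=
  ∃ j ∈ T.column μ.es μ.et μ.k v, T.Reach 0 (μ.et j) y

theorem Memory.HasForest.reverse (h : μ.HasForest T 0) : μ.HasForest T.reverse 1 where
  n_eq := h.n_eq
  q_eq := h.q_eq
  cu_eq := h.cu_eq
  cw_eq := h.cw_eq
  up_iff j hj := by
    have h1 := h.cd_le j hj
    have h2 := h.up_iff j hj
    change ¬ T.up j ↔ _
    rw [h2]
    omega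
  cd_le := h.cd_le
  flip_le := le_rfl

/-- The marks are found by summing the heads along the reversed forest. -/
theorem exec_markRow (h : μ.Ready T) (hi : μ.i < μ.n)
    (hN : (μ.k + 1) * μ.n + μ.n + 2 < N) (hk : μ.k < N) :
    Exec N markRow μ fun t μ' => t ≤ 400 * (μ.n + μ.k + 1) ∧ ∃ b' j' e' flip' B',
      μ' = { μ with b := b', j := j', e := e', flip := flip', B := B' } ∧ μ'.Ready T ∧
      b' = μ.k * μ.n ∧
      ∀ y < μ.n, B' (μ.k * μ.n + y) ≤ μ.n ∧ (B' (μ.k * μ.n + y) ≠ 0 ↔ μ.Marked T μ.i y) := by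
  classical
  rw [Nat.succ_mul] at hN
  refine Exec.seq (Exec.setN (by omega) (by simp; omega) ?_)
  -- the row is cleared
  refine Exec.seq ((Exec.for_const (d := μ.n) (T := 20) (fun l μ' => ∃ B',
    μ' = { μ with b := μ.k * μ.n, j := l, B := B' } ∧
    (∀ j < μ.k, ∀ v < μ.n, B' (j * μ.n + v) = μ.B (j * μ.n + v)) ∧
    ∀ v < l, B' (μ.k * μ.n + v) = 0) (by omega) (by omega) ?_ ?_ ?_).mono ?_)
  · rintro l _ ⟨B', rfl, -⟩
    exact ⟨rfl, rfl⟩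
  · exact ⟨_, rfl, fun _ _ _ _ => rfl, by simp⟩
  · rintro l hl _ ⟨B', rfl, h1, h2⟩
    refine (exec_of_wp (Q := fun μ' =>
      μ' = { μ with b := μ.k * μ.n, j := l, B := Function.update B' (μ.k * μ.n + l) 0 }) ?_).mono ?_
    · simp
      omega
    · rintro t _ ⟨ht, rfl⟩
      refine ⟨ht.trans (by decide), rfl, _, rfl, fun j hj v hv => ?_, fun v hv => ?_⟩
      · refine (Function.update_of_ne ?_ _ _).trans (h1 j hj v hv)
        have := row_lt hj hv
        omega
      · refine (Function.update_apply ..).trans ?_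
        split_ifs
        · rfl
        · exact h2 v (by omega)
  rintro t₁ _ ⟨ht₁, B₁, rfl, hB₁, hz₁⟩
  -- the heads are marked
  let M (l v : ℕ) : Prop := ∃ j < l, T.ExtReach μ.es μ.et μ.k μ.i (μ.es j) ∧ μ.et j = v
  refine Exec.seq ((Exec.for_const (d := μ.k) (T := 40) (fun l μ' => ∃ B',
    μ' = { μ with b := μ.k * μ.n, j := l, B := B' } ∧
    (∀ j < μ.k, ∀ v < μ.n, B' (j * μ.n + v) = μ.B (j * μ.n + v)) ∧
    ∀ v < μ.n, B' (μ.k * μ.n + v) = bit (M l v)) (by omega) (by omega) ?_ ?_ ?_).mono ?_)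
  · rintro l _ ⟨B', rfl, -⟩
    exact ⟨rfl, rfl⟩
  · refine ⟨_, rfl, hB₁, fun v hv => (hz₁ v hv).trans (Eq.symm ?_)⟩
    rw [bit_eq_zero]
    rintro ⟨j, hj, -⟩
    omega
  · rintro l hl _ ⟨B', rfl, h1, h2⟩
    have hli := row_lt hl hi
    have htl := h.et_lt l hl
    have hval : B' (l * μ.n + μ.i) = bit (T.ExtReach μ.es μ.et μ.k μ.i (μ.es l)) := by
      rw [h1 l hl _ hi, h.row_eq l hl _ hi]
    have hle : B' (l * μ.n + μ.i) ≤ 1 := hval.trans_le (bit_le_one _)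
    refine (exec_of_wp (Q := fun μ' => ∃ B',
      μ' = { μ with b := μ.k * μ.n, j := l, B := B' } ∧
      (∀ j < μ.k, ∀ v < μ.n, B' (j * μ.n + v) = μ.B (j * μ.n + v)) ∧
      ∀ v < μ.n, B' (μ.k * μ.n + v) = bit (M (l + 1) v)) ?_).mono ?_
    · simp only [wp]
      refine ⟨?_, fun h0 => ?_, fun h0 => ⟨_, rfl, h1, fun v hv => ?_⟩⟩
      · simp
        omega
      · have h3 : T.ExtReach μ.es μ.et μ.k μ.i (μ.es l) := by
          by_contra h3
          exact h0 (hval.trans (bit_eq_zero.2 h3))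
        refine ⟨by omega, ?_, ?_, _, rfl, fun j hj v hv => ?_, fun v hv => ?_⟩
        · simp
          omega
        · simp
          omega
        · refine (Function.update_of_ne ?_ _ _).trans (h1 j hj v hv)
          have := row_lt hj hv
          simp
          omega
        · refine (congrFun (update_add_left B' (μ.k * μ.n) (μ.et l) 1) v).trans ?_
          rw [Function.update_apply]
          split_ifs with h4
          · exact (bit_true ⟨l, by omega, h3, h4.symm⟩).symm
          · rw [h2 v hv]
            refine bit_congr ⟨fun ⟨j, hj, h5⟩ => ⟨j, by omega, h5⟩, fun ⟨j, hj, h5⟩ => ⟨j, ?_, h5⟩⟩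
            have : j ≠ l := fun h6 => h4 (h6 ▸ h5.2.symm)
            omega
      · have h3 : ¬ T.ExtReach μ.es μ.et μ.k μ.i (μ.es l) := bit_eq_zero.1 (hval.symm.trans h0)
        refine (h2 v hv).trans (bit_congr ⟨fun ⟨j, hj, h5⟩ => ⟨j, by omega, h5⟩,
          fun ⟨j, hj, h5⟩ => ⟨j, ?_, h5⟩⟩)
        have : j ≠ l := fun h6 => h3 (h6 ▸ h5.1)
        omega
    · rintro t _ ⟨ht, B'', rfl, h3, h4⟩
      exact ⟨ht.trans (by decide), rfl, _, rfl, h3, h4⟩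
  rintro t₂ _ ⟨ht₂, B₂, rfl, hB₂, hM₂⟩
  refine Exec.seq (Exec.setN (by omega) (by simp; omega) ?_)
  have hF := h.forest
  have hsum : ∀ y, T.reverse.val 0 (fun v => B₂ (μ.k * μ.n + v)) y =
      ∑ x ∈ (Finset.range μ.n).filter (fun x => T.Reach 0 x y), bit (M μ.k x) := by
    intro y
    rw [ElimForest.val]
    have hn : T.reverse.n = μ.n := hF.n_eq
    refine Finset.sum_congr (Finset.ext fun x => ?_) fun x hx => ?_
    · simp only [Finset.mem_filter, hn, T.reverse_reach]
    · exact hM₂ x (Finset.mem_range.1 (Finset.mem_filter.1 hx).1)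
  have hle : ∀ y, T.reverse.val 0 (fun v => B₂ (μ.k * μ.n + v)) y ≤ μ.n := by
    intro y
    rw [hsum]
    refine (Finset.sum_le_card_nsmul _ _ 1 fun x _ => bit_le_one _).trans ?_
    rw [smul_eq_mul, mul_one]
    exact (Finset.card_filter_le _ _).trans (Finset.card_range _).le
  have hne : ∀ y, T.reverse.val 0 (fun v => B₂ (μ.k * μ.n + v)) y ≠ 0 ↔ μ.Marked T μ.i y := by
    intro y
    rw [hsum, Ne, Finset.sum_eq_zero_iff]
    push Not
    constructor
    · rintro ⟨x, hx, h1⟩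
      rw [Ne, bit_eq_zero, not_not] at h1
      obtain ⟨j, hj, h2, rfl⟩ := h1
      exact ⟨j, ⟨hj, h2⟩, (Finset.mem_filter.1 hx).2⟩
    · rintro ⟨j, ⟨hj, h1⟩, h2⟩
      refine ⟨μ.et j, Finset.mem_filter.2 ⟨Finset.mem_range.2 (h.et_lt j hj), h2⟩, ?_⟩
      rw [Ne, bit_eq_zero, not_not]
      exact ⟨j, hj, h1, rfl⟩
  refine (exec_propagate (T := T.reverse) (c := μ.n)
    (μ := { μ with b := μ.k * μ.n, j := μ.k, flip := 1, B := B₂ }) ?_ (by omega) (by simp; omega)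
    (by simp; omega) (by omega) fun v _ => hle v).mono ?_
  · have hr := hF.reverse
    exact ⟨hr.n_eq, hr.q_eq, hr.cu_eq, hr.cw_eq, hr.up_iff, hr.cd_le, hr.flip_le⟩
  · rintro t₃ _ ⟨ht₃, B₃, e₃, rfl, h1, h2⟩
    refine ⟨?_, _, _, _, _, _, rfl, ⟨⟨hF.n_eq, hF.q_eq, hF.cu_eq, hF.cw_eq, hF.up_iff, hF.cd_le,
      hF.flip_le⟩, h.et_lt, fun j hj v (hv : v < μ.n) => ?_⟩, rfl,
      fun y hy => ?_⟩
    · simp only [WordExpr.cost]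
      have h3 : t₃ ≤ 200 * (μ.n + 1) := ht₃
      omega
    · refine (h2 _ fun w _ => ?_).trans ((hB₂ j hj v hv).trans (h.row_eq j hj v hv))
      have h3 : j * μ.n + v < μ.k * μ.n := row_lt hj hv
      change j * μ.n + v ≠ μ.k * μ.n + w
      omega
    · have h3 : B₃ (μ.k * μ.n + y) = _ := h1 y hy
      rw [h3]
      exact ⟨hle y, hne y⟩

open Classical in
/-- The sum over the vertices which are marked or reachable from `v` in the forest is split into
the marked part, which does not depend on `v`, and the rest. -/
theorem exec_sumWeights (h : μ.Ready T) {U : ℕ → Prop}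
    (hU : ∀ y < μ.n, μ.B (μ.b + y) ≠ 0 ↔ U y) (hle : ∀ y < μ.n, μ.B (μ.b + y) ≤ μ.n)
    (hN : μ.b + μ.n + 2 < N) :
    Exec N sumWeights μ fun t μ' => t ≤ 400 * (μ.n + 1) ∧ ∃ W' D' e' j',
      μ' = { μ with W := W', D := D', e := e', j := j' } ∧ μ'.Ready T ∧
      ∀ v < μ.n, W' + D' v = ∑ y ∈ (Finset.range μ.n).filter
        (fun y => U y ∨ T.Reach 0 v y), μ.a y := by
  have hn := h.forest.n_eq
  have hF := h.forest
  refine Exec.seq ((exec_of_wp (Q := fun μ' => μ' = { μ with W := 0 }) (by simp)).mono ?_)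
  rintro t₀ _ ⟨ht₀, rfl⟩
  refine Exec.seq ((Exec.for_const (d := μ.n) (T := 40) (fun l μ' => ∃ W' D',
    μ' = { μ with W := W', D := D', j := l } ∧
    W' = ∑ y ∈ Finset.range l, (if U y then μ.a y else 0) ∧
    ∀ v < l, D' v = if U v then 0 else μ.a v) (by omega) (by omega) ?_ ?_ ?_).mono ?_)
  · rintro l _ ⟨W', D', rfl, -⟩
    exact ⟨rfl, rfl⟩
  · exact ⟨_, _, rfl, by simp, by simp⟩
  · rintro l hl _ ⟨W', D', rfl, h1, h2⟩
    have hUl := hU l hl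
    have hll := hle l hl
    refine (exec_of_wp (Q := fun μ' => ∃ W' D',
      μ' = { μ with W := W', D := D', j := l } ∧
      W' = ∑ y ∈ Finset.range (l + 1), (if U y then μ.a y else 0) ∧
      ∀ v < l + 1, D' v = if U v then 0 else μ.a v) ?_).mono ?_
    · by_cases h0 : μ.B (μ.b + l) = 0
      · have hUl' : ¬ U l := fun h => hUl.2 h h0
        have h3 : ∀ v < l + 1, Function.update D' l (μ.a l) v = if U v then 0 else μ.a v := by
          intro v hv
          rw [Function.update_apply]
          split_ifs with h4 h5 h5
          · exact (hUl' (h4 ▸ h5)).elim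
          · rw [h4]
          · exact (h2 v (by omega)).trans (if_pos h5)
          · exact (h2 v (by omega)).trans (if_neg h5)
        simp only [wp]
        refine ⟨?_, fun h => (h h0).elim, fun _ => ⟨by omega, ?_, ?_, W', _, rfl, ?_, h3⟩⟩
        · simp
          omega
        · simp
          omega
        · simp
          omega
        · rw [Finset.sum_range_succ, if_neg hUl', add_zero, h1]
      · have hUl' : U l := hUl.1 h0
        have h3 : ∀ v < l + 1, Function.update D' l 0 v = if U v then 0 else μ.a v := by
          intro v hv
          rw [Function.update_apply]
          split_ifs with h4 h5 h5
          · rfl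
          · exact (h5 (h4 ▸ hUl')).elim
          · exact (h2 v (by omega)).trans (if_pos h5)
          · exact (h2 v (by omega)).trans (if_neg h5)
        simp only [wp]
        refine ⟨?_, fun _ => ⟨by omega, ?_, by omega, ?_, trivial, W' + μ.a l, _, rfl, ?_, h3⟩,
          fun h => (h0 h).elim⟩
        · simp
          omega
        · simp
          omega
        · simp
          omega
        · rw [Finset.sum_range_succ, if_pos hUl', h1]
    · rintro t _ ⟨ht, W'', D'', rfl, h3, h4⟩
      exact ⟨ht.trans (by decide), rfl, _, _, rfl, h3, h4⟩
  rintro t₁ _ ⟨ht₁, W₁, D₁, rfl, hW₁, hD₁⟩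
  have hF₁ : Memory.HasForest { μ with W := W₁, D := D₁, j := μ.n } T 0 :=
    ⟨hF.n_eq, hF.q_eq, hF.cu_eq, hF.cw_eq, hF.up_iff, hF.cd_le, hF.flip_le⟩
  refine (exec_propagateReal hF₁ (by omega) (by simp; omega)).mono ?_
  rintro t₂ _ ⟨ht₂, D₂, e₂, rfl, hD₂⟩
  refine ⟨?_, _, _, _, _, rfl, ⟨⟨hF.n_eq, hF.q_eq, hF.cu_eq, hF.cw_eq, hF.up_iff, hF.cd_le,
    hF.flip_le⟩, h.et_lt, h.row_eq⟩, fun v hv => ?_⟩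
  · have h3 : t₂ ≤ 200 * (μ.n + 1) := ht₂
    have h4 : t₀ ≤ 10 := ht₀.trans (by decide)
    omega
  · rw [hD₂ v hv, ElimForest.val, hn, hW₁, Finset.sum_filter, Finset.sum_filter,
      ← Finset.sum_add_distrib]
    refine Finset.sum_congr rfl fun y hy => ?_
    have h5 := hD₁ y (Finset.mem_range.1 hy)
    simp only
    by_cases h6 : U y <;> by_cases h7 : T.Reach 0 v y <;> simp [h5, h6, h7]

/-- Columns are compared by the rows of `B`. -/
theorem column_eq_iff {es et : ℕ → ℕ} {k v w : ℕ} : T.column es et k v = T.column es et k w ↔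
    ∀ r < k, (T.ExtReach es et k v (es r) ↔ T.ExtReach es et k w (es r)) := by
  simp only [ElimForest.column, Set.ext_iff, Set.mem_ofPred_eq, and_congr_right_iff]

theorem exec_storeResults (h : μ.Ready T) (hi : μ.i < μ.n)
    (hN : μ.k * μ.n + μ.n + 2 < N) (hk : μ.k < N) :
    Exec N storeResults μ fun t μ' => t ≤ 100 * (μ.n + 1) * (μ.k + 1) ∧ ∃ j' l' flag' fin' res',
      μ' = { μ with j := j', l := l', flag := flag', fin := fin', res := res' } ∧ μ'.Ready T ∧
      ∀ v < μ.n,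
        (T.column μ.es μ.et μ.k μ.i = T.column μ.es μ.et μ.k v →
          fin' v = 1 ∧ res' v = μ.W + μ.D v) ∧
        (T.column μ.es μ.et μ.k μ.i ≠ T.column μ.es μ.et μ.k v →
          fin' v = μ.fin v ∧ res' v = μ.res v) := by
  have hF := h.forest
  refine (Exec.for_const (d := μ.n) (T := 40 + μ.k * (40 + 8)) (fun j μ' => ∃ l' flag' fin' res',
    μ' = { μ with j := j, l := l', flag := flag', fin := fin', res := res' } ∧
    ∀ v, (v < j ∧ T.column μ.es μ.et μ.k μ.i = T.column μ.es μ.et μ.k v →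
        fin' v = 1 ∧ res' v = μ.W + μ.D v) ∧
      (¬ (v < j ∧ T.column μ.es μ.et μ.k μ.i = T.column μ.es μ.et μ.k v) →
        fin' v = μ.fin v ∧ res' v = μ.res v)) (by omega) (by omega) ?_ ?_ ?_).mono ?_
  · rintro j _ ⟨l', flag', fin', res', rfl, -⟩
    exact ⟨rfl, rfl⟩
  · exact ⟨_, _, _, _, rfl, fun v => ⟨fun h => by omega, fun _ => ⟨rfl, rfl⟩⟩⟩
  · rintro j hj _ ⟨l', flag', fin', res', rfl, h1⟩
    refine Exec.seq (Exec.setN (by omega) (by simp; omega) ?_)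
    -- the columns of `i` and `j` are compared
    refine Exec.seq ((Exec.for_const (d := μ.k) (T := 40) (fun l μ' => ∃ flag',
      μ' = { μ with j := j, l := l, flag := flag', fin := fin', res := res' } ∧
      flag' = bit (¬ ∀ r < l, (T.ExtReach μ.es μ.et μ.k μ.i (μ.es r) ↔
        T.ExtReach μ.es μ.et μ.k j (μ.es r)))) (by omega) (by omega) ?_ ?_ ?_).mono ?_)
    · rintro l _ ⟨flag', rfl, -⟩
      exact ⟨rfl, rfl⟩
    · exact ⟨_, rfl, (bit_eq_zero.2 (by simp)).symm⟩
    · rintro l hl _ ⟨flag', rfl, h2⟩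
      have hli := row_lt hl hi
      have hlj := row_lt hl hj
      have hvi := h.row_eq l hl _ hi
      have hvj := h.row_eq l hl _ hj
      have hbi := hvi.trans_le (bit_le_one _)
      have hbj := hvj.trans_le (bit_le_one _)
      refine (exec_of_wp (Q := fun μ' => ∃ flag',
        μ' = { μ with j := j, l := l, flag := flag', fin := fin', res := res' } ∧
        flag' = bit (¬ ∀ r < l + 1, (T.ExtReach μ.es μ.et μ.k μ.i (μ.es r) ↔
          T.ExtReach μ.es μ.et μ.k j (μ.es r)))) ?_).mono ?_
      · have hsucc : (∀ r < l + 1, (T.ExtReach μ.es μ.et μ.k μ.i (μ.es r) ↔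
            T.ExtReach μ.es μ.et μ.k j (μ.es r))) ↔
            μ.B (l * μ.n + μ.i) = μ.B (l * μ.n + j) ∧
            (∀ r < l, (T.ExtReach μ.es μ.et μ.k μ.i (μ.es r) ↔
              T.ExtReach μ.es μ.et μ.k j (μ.es r))) := by
          rw [hvi, hvj, bit_inj]
          refine ⟨fun h => ⟨h l (by omega), fun r hr => h r (by omega)⟩, fun h r hr => ?_⟩
          rcases Nat.lt_succ_iff_lt_or_eq.1 hr with hr | rfl
          · exact h.2 r hr
          · exact h.1
        rw [bit_congr (not_congr hsucc)]
        simp only [wp]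
        by_cases heq : μ.B (l * μ.n + μ.i) = μ.B (l * μ.n + j)
        · refine ⟨?_, fun _ => ⟨_, rfl, h2.trans (bit_congr (by tauto))⟩, fun h0 => ?_⟩
          · simp [heq]
            omega
          · simp [heq] at h0
        · refine ⟨?_, fun h0 => ?_, fun h0 => ⟨by omega, ?_, _, rfl, (bit_true (by tauto)).symm⟩⟩
          · simp [heq]
            omega
          · simp [heq] at h0
          · simp
            omega
      · rintro t _ ⟨ht, flag'', rfl, h3⟩
        exact ⟨ht.trans (by decide), rfl, _, rfl, h3⟩
    rintro t _ ⟨ht, flag'', rfl, h2⟩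
    rw [← column_eq_iff] at h2
    have hb := h2.trans_le (bit_le_one _)
    refine (exec_of_wp (Q := fun μ' => ∃ fin' res',
      μ' = { μ with j := j, l := μ.k, flag := flag'', fin := fin', res := res' } ∧
      ∀ v, (v < j + 1 ∧ T.column μ.es μ.et μ.k μ.i = T.column μ.es μ.et μ.k v →
          fin' v = 1 ∧ res' v = μ.W + μ.D v) ∧
        (¬ (v < j + 1 ∧ T.column μ.es μ.et μ.k μ.i = T.column μ.es μ.et μ.k v) →
          fin' v = μ.fin v ∧ res' v = μ.res v)) ?_).mono ?_
    · simp only [wp]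
      refine ⟨?_, fun h0 => ⟨_, _, rfl, fun v => ?_⟩, fun h0 => ⟨by omega, ?_, ?_, by omega, ?_, ?_,
        _, _, rfl, fun v => ?_⟩⟩
      · simp
        omega
      · have h3 : T.column μ.es μ.et μ.k μ.i ≠ T.column μ.es μ.et μ.k j := fun h3 =>
          h0 (h2.trans (bit_eq_zero.2 (not_not.2 h3)))
        have h4 : (v < j + 1 ∧ T.column μ.es μ.et μ.k μ.i = T.column μ.es μ.et μ.k v) ↔
            (v < j ∧ T.column μ.es μ.et μ.k μ.i = T.column μ.es μ.et μ.k v) := by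
          refine and_congr_left fun h5 => ?_
          have : v ≠ j := fun h6 => h3 (h6 ▸ h5)
          omega
        rw [h4]
        exact h1 v
      · simp
        omega
      · simp
        omega
      · simp
        omega
      · simp
        omega
      · have h3 : T.column μ.es μ.et μ.k μ.i = T.column μ.es μ.et μ.k j :=
          not_not.1 (bit_eq_zero.1 (h2.symm.trans h0))
        by_cases hv : v = j
        · subst hv
          exact ⟨fun _ => ⟨Function.update_self .., Function.update_self ..⟩,
            fun h5 => (h5 ⟨by omega, h3⟩).elim⟩
        · have h4 : v < j + 1 ↔ v < j := by omega
          rw [h4]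
          have h5 := h1 v
          refine ⟨fun h6 => ?_, fun h6 => ?_⟩
          · exact ⟨(Function.update_of_ne hv _ _).trans (h5.1 h6).1,
              (Function.update_of_ne hv _ _).trans (h5.1 h6).2⟩
          · exact ⟨(Function.update_of_ne hv _ _).trans (h5.2 h6).1,
              (Function.update_of_ne hv _ _).trans (h5.2 h6).2⟩
    · rintro t' _ ⟨ht', fin'', res'', rfl, h3⟩
      have ht'' : t' ≤ 30 := ht'.trans (by decide)
      refine ⟨?_, rfl, _, _, _, _, rfl, h3⟩
      simp only [WordExpr.cost]
      omega
  · rintro t _ ⟨ht, l', flag', fin', res', rfl, h1⟩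
    refine ⟨?_, _, _, _, _, _, rfl, ⟨⟨hF.n_eq, hF.q_eq, hF.cu_eq, hF.cw_eq, hF.up_iff, hF.cd_le,
      hF.flip_le⟩, h.et_lt, h.row_eq⟩, fun v hv => ⟨fun h2 => (h1 v).1 ⟨hv, h2⟩,
      fun h2 => (h1 v).2 fun h3 => h2 h3.2⟩⟩
    nlinarith [Nat.zero_le (μ.n * μ.k)]

end RealRAM

/-! ### The algorithm -/

namespace RealRAM

variable {N : ℕ} {μ : Memory} {T : ElimForest}

open Classical in
/-- Exactly the vertices which reach the same extra edges as some vertex below `i` are solved. -/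
def Memory.Solved (μ : Memory) (T : ElimForest) (i : ℕ) : Prop :=
  ∀ u < μ.n, μ.fin u ≤ 1 ∧
    (μ.fin u ≠ 0 ↔ ∃ v < i, T.column μ.es μ.et μ.k v = T.column μ.es μ.et μ.k u) ∧
    (μ.fin u ≠ 0 → μ.res u =
      ∑ y ∈ (Finset.range μ.n).filter (fun y => T.ExtReach μ.es μ.et μ.k u y), μ.a y)

/-- The vertices reachable from `u` by a path with extra edges depend only on the column of `u`. -/
theorem Memory.extReach_iff_marked {v u : ℕ}
    (h : T.column μ.es μ.et μ.k v = T.column μ.es μ.et μ.k u) (y : ℕ) :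
    T.ExtReach μ.es μ.et μ.k u y ↔ μ.Marked T v y ∨ T.Reach 0 u y := by
  rw [ElimForest.extReach_last, or_comm, Memory.Marked, h]
  simp only [ElimForest.column, Set.mem_ofPred_eq, and_assoc]

theorem exec_solveStep (h : μ.Ready T) (hi : μ.i < μ.n) (hS : μ.Solved T μ.i)
    (hN : (μ.k + 1) * μ.n + μ.n + 2 < N) (hk : μ.k < N) :
    Exec N (markRow ⨟ sumWeights ⨟ storeResults) μ fun t μ' =>
      t ≤ 900 * ((μ.n + 1) * (μ.k + 1)) ∧ ∃ b' j' e' flip' B' W' D' l' flag' fin' res',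
      μ' = { μ with b := b', j := j', e := e', flip := flip', B := B', W := W', D := D', l := l',
                    flag := flag', fin := fin', res := res' } ∧
      μ'.Ready T ∧ μ'.Solved T (μ.i + 1) := by
  have hN' := hN
  rw [Nat.succ_mul] at hN'
  refine Exec.seq ((exec_markRow h hi hN hk).mono ?_)
  rintro t₁ _ ⟨ht₁, b₁, j₁, e₁, flip₁, B₁, rfl, h₁, rfl, hB₁⟩
  refine Exec.seq ((exec_sumWeights h₁ (U := μ.Marked T μ.i) (fun y hy => (hB₁ y hy).2)
    (fun y hy => (hB₁ y hy).1) (by simp only; omega)).mono ?_)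
  rintro t₂ _ ⟨ht₂, W₂, D₂, e₂, j₂, rfl, h₂, hD₂⟩
  refine (exec_storeResults h₂ hi (by simp only; omega) hk).mono ?_
  rintro t₃ _ ⟨ht₃, j₃, l₃, flag₃, fin₃, res₃, rfl, h₃, hres⟩
  refine ⟨?_, _, _, _, _, _, _, _, _, _, _, _, rfl, h₃, fun u hu => ?_⟩
  · have h4 : t₂ ≤ 400 * (μ.n + 1) := ht₂
    have h5 : t₃ ≤ 100 * (μ.n + 1) * (μ.k + 1) := ht₃
    nlinarith [Nat.zero_le (μ.n * μ.k)]
  · have hu' : u < μ.n := hu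
    obtain ⟨h4, h5, h6⟩ := hS u hu'
    obtain ⟨h7, h8⟩ := hres u hu'
    have h9 : ∀ p : ℕ → Prop, (∃ v < μ.i + 1, p v) ↔ (∃ v < μ.i, p v) ∨ p μ.i := by
      intro p
      simp only [Nat.lt_succ_iff_lt_or_eq, or_and_right, exists_or, exists_eq_left]
    rw [h9]
    by_cases hc : T.column μ.es μ.et μ.k μ.i = T.column μ.es μ.et μ.k u
    · obtain ⟨h10, h11⟩ := h7 hc
      refine ⟨h10.le, ⟨fun _ => .inr hc, fun _ => by simp [h10]⟩, fun _ => ?_⟩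
      refine h11.trans ((hD₂ u hu').trans (Finset.sum_congr ?_ fun _ _ => rfl))
      ext y
      simp only [Finset.mem_filter, Memory.extReach_iff_marked hc]
    · obtain ⟨h10, h11⟩ := h8 hc
      have h10' : fin₃ u = μ.fin u := h10
      have h11' : res₃ u = μ.res u := h11
      simp only
      rw [h10', h11', or_iff_left hc]
      exact ⟨h4, h5, h6⟩

open Classical in
/-- Work is done only for the first vertex of each column, and there are at most `2 * k + 1`
columns. -/
theorem exec_solve (h : μ.Ready T) (hfin : μ.fin = fun _ => 0)
    (hN : (μ.k + 1) * μ.n + μ.n + 2 < N) (hk : μ.k < N) :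
    Exec N solve μ fun t μ' => t ≤ 2000 * ((μ.n + 1) * (μ.k + 1)) * (μ.k + 1) ∧ ∀ u < μ.n,
      μ'.res u =
        ∑ y ∈ (Finset.range μ.n).filter (fun y => T.ExtReach μ.es μ.et μ.k u y), μ.a y := by
  have hN' := hN
  rw [Nat.succ_mul] at hN'
  let col (i : ℕ) := T.column μ.es μ.et μ.k i
  refine (Exec.for (d := μ.n) (fun i t μ' => i ≤ μ.n ∧
    (∃ b' j' e' flip' B' W' D' l' flag' fin' res',
      μ' = { μ with i := i, b := b', j := j', e := e', flip := flip', B := B', W := W', D := D',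
                    l := l', flag := flag', fin := fin', res := res' }) ∧
    μ'.Ready T ∧ μ'.Solved T i ∧
    t ≤ 2 + 20 * i + 900 * ((μ.n + 1) * (μ.k + 1)) * ((Finset.range i).image col).card)
    (by omega) (by omega) ?_ ?_ ?_).mono ?_
  · rintro i t _ ⟨hi, ⟨_, _, _, _, _, _, _, _, _, _, _, rfl⟩, -⟩
    exact ⟨hi, rfl, rfl⟩
  · refine ⟨by omega, ⟨_, _, _, _, _, _, _, _, _, _, _, rfl⟩, ?_, ?_, by simp⟩
    · have hF := h.forest
      exact ⟨⟨hF.n_eq, hF.q_eq, hF.cu_eq, hF.cw_eq, hF.up_iff, hF.cd_le, hF.flip_le⟩, h.et_lt,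
        h.row_eq⟩
    · intro u hu
      simp [hfin]
  · rintro i hi t _ ⟨-, ⟨b', j', e', flip', B', W', D', l', flag', fin', res', rfl⟩, hR, hS, ht⟩
    have hmono : ((Finset.range i).image col).card ≤ ((Finset.range (i + 1)).image col).card :=
      Finset.card_le_card (Finset.image_subset_image (Finset.range_subset_range.2 (by omega)))
    obtain ⟨h1, h2, -⟩ := hS i hi
    have h1' : fin' i ≤ 1 := h1
    refine Exec.ite (by simp; omega) (fun h0 => ?_) (fun h0 => ?_)
    -- the column of `i` has occurred before, so nothing has to be done
    · have h0' : fin' i ≠ 0 := h0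
      obtain ⟨v, hv, hvi⟩ := h2.1 h0
      refine (exec_of_wp (Q := fun μ' => μ' = _) (by simp only [wp]; rfl)).mono ?_
      rintro t' _ ⟨ht', rfl⟩
      refine ⟨rfl, by omega, ⟨_, _, _, _, _, _, _, _, _, _, _, rfl⟩, ?_, fun u hu => ?_, ?_⟩
      · have hF := hR.forest
        exact ⟨⟨hF.n_eq, hF.q_eq, hF.cu_eq, hF.cw_eq, hF.up_iff, hF.cd_le, hF.flip_le⟩, hR.et_lt,
          hR.row_eq⟩
      · obtain ⟨h3, h4, h5⟩ := hS u hu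
        refine ⟨h3, h4.trans ⟨fun ⟨w, hw, h6⟩ => ⟨w, by omega, h6⟩, fun ⟨w, hw, h6⟩ => ?_⟩, h5⟩
        rcases Nat.lt_succ_iff_lt_or_eq.1 hw with hw | rfl
        · exact ⟨w, hw, h6⟩
        · exact ⟨v, hv, hvi.trans h6⟩
      · have ht'' : t' ≤ 1 := ht'
        have h3 := Nat.mul_le_mul_left (900 * ((μ.n + 1) * (μ.k + 1))) hmono
        simp only [WordExpr.cost]
        omega
    -- the column of `i` is new
    · have h0' : fin' i = 0 := h0
      have hnew : col i ∉ (Finset.range i).image col := by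
        rw [Finset.mem_image]
        rintro ⟨v, hv, hvi⟩
        exact h2.2 ⟨v, Finset.mem_range.1 hv, hvi⟩ h0
      refine (exec_solveStep hR hi hS hN hk).mono ?_
      rintro t' _ ⟨ht', b₁, j₁, e₁, flip₁, B₁, W₁, D₁, l₁, flag₁, fin₁, res₁, rfl, hR₁, hS₁⟩
      refine ⟨rfl, by omega, ⟨_, _, _, _, _, _, _, _, _, _, _, rfl⟩, ?_, hS₁, ?_⟩
      · have hF := hR₁.forest
        exact ⟨⟨hF.n_eq, hF.q_eq, hF.cu_eq, hF.cw_eq, hF.up_iff, hF.cd_le, hF.flip_le⟩, hR₁.et_lt,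
          hR₁.row_eq⟩
      · have ht'' : t' ≤ 900 * ((μ.n + 1) * (μ.k + 1)) := ht'
        have h3 := mul_add_one (900 * ((μ.n + 1) * (μ.k + 1))) ((Finset.range i).image col).card
        rw [Finset.range_add_one, Finset.image_insert, Finset.card_insert_of_notMem hnew]
        simp only [WordExpr.cost]
        omega
  · rintro t _ ⟨t', ht', rfl, -, ⟨b', j', e', flip', B', W', D', l', flag', fin', res', rfl⟩, -,
      hS, ht⟩
    obtain ⟨C, hC, hC'⟩ := T.exists_card_column_le μ.es μ.et μ.k
    have h1 : ((Finset.range μ.n).image col).card ≤ 2 * μ.k + 1 :=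
      (Finset.card_le_card (Finset.image_subset_iff.2 fun v _ => hC' v)).trans hC
    refine ⟨?_, fun u hu => (hS u hu).2.2 ((hS u hu).2.1.2 ⟨u, hu, rfl⟩)⟩
    have h2 := Nat.mul_le_mul_left (900 * ((μ.n + 1) * (μ.k + 1))) h1
    nlinarith [Nat.zero_le (μ.n * μ.k), Nat.zero_le (μ.n * μ.k * μ.k)]

/-- The algorithm: build the forest, find out which extra edges are reachable from which vertices,
and solve the vertices column by column. -/
def countDescendants : Prog := buildForest ⨟ forestRows ⨟ closeRows ⨟ solve

open Classical in
/-- Correctness and running time in terms of an arbitrary feedback edge set `F`, of which the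
program knows nothing. -/
theorem exec_countDescendants {G : EdgeList} {F : Finset ℕ} (h : μ.IsInput G)
    (hF : G.IsFeedback F) (hN : 2 * G.m + 2 * G.n + 2 < N)
    (hN' : (2 * F.card + 2) * (G.n + 1) < N) :
    Exec N countDescendants μ fun t μ' =>
      t ≤ 1000 * (G.m + G.n + 1) + 2400 * ((G.n + 1) * ((2 * F.card + 1) * (2 * F.card + 1))) ∧
      ∀ u < G.n, μ'.res u = ∑ y ∈ (Finset.range G.n).filter (fun y => Relation.ReflTransGen
        (fun x y => ∃ e < G.m, x = G.tl e ∧ y = G.hd e) u y), μ.a y := by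
  refine Exec.seq ((exec_buildForest h hF hN).mono ?_)
  rintro t₁ μ₁ ⟨ht₁, h₁, hk₁, hB₁, hfin₁, ha₁⟩
  have hn : μ₁.n = G.n := h₁.n_eq
  have hT : μ₁.HasForest h₁.forest 0 :=
    ⟨hn.symm, rfl, fun _ _ => rfl, fun _ _ => rfl, fun _ _ => Iff.rfl, h₁.cd_le, Nat.zero_le _⟩
  have hN₁ : (μ₁.k + 2) * (μ₁.n + 1) < N := by
    rw [hn]
    exact (Nat.mul_le_mul_right _ (by omega)).trans_lt hN'
  have hN₂ : (μ₁.k + 1) * μ₁.n + μ₁.n + 2 < N := by nlinarith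
  have hN₃ : μ₁.k * μ₁.n + μ₁.n + 2 < N := by nlinarith
  have hk₂ : μ₁.k < N := by nlinarith
  refine Exec.seq ((exec_forestRows hT (hB₁.trans h.B_eq)
    (fun j hj => (h₁.es_lt j hj).trans_eq hn.symm)
    hN₃ hk₂).mono ?_)
  rintro t₂ _ ⟨ht₂, flip₂, i₂, j₂, e₂, b₂, B₂, rfl, hB₂⟩
  have het : ∀ j < μ₁.k, μ₁.et j < μ₁.n := fun j hj => (h₁.et_lt j hj).trans_eq hn.symm
  refine Exec.seq ((exec_closeRows (T := h₁.forest) (N := N) (μ := { μ₁ with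
    flip := flip₂, i := i₂, j := j₂, e := e₂, b := b₂, B := B₂ }) het hB₂ hN₃ hk₂).mono ?_)
  rintro t₃ _ ⟨ht₃, i₃, j₃, l₃, B₃, rfl, hB₃⟩
  refine (exec_solve (T := h₁.forest) (N := N) (μ := { μ₁ with
    flip := flip₂, i := i₃, j := j₃, l := l₃, e := e₂, b := b₂, B := B₃ })
    ⟨⟨hT.n_eq, hT.q_eq, hT.cu_eq, hT.cw_eq, hT.up_iff, hT.cd_le, hT.flip_le⟩, het, hB₃⟩
    (hfin₁.trans h.fin_eq) hN₂ hk₂).mono ?_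
  rintro t₄ μ₄ ⟨ht₄, hres⟩
  refine ⟨?_, fun u hu => ?_⟩
  · have h2 : t₂ ≤ 300 * (μ₁.k + 1) * (μ₁.n + 1) := ht₂
    have h3 : t₃ ≤ 100 * (μ₁.k + 1) * (μ₁.k + 1) * (μ₁.n + 1) := ht₃
    have h4 : t₄ ≤ 2000 * ((μ₁.n + 1) * (μ₁.k + 1)) * (μ₁.k + 1) := ht₄
    have h5 : (G.n + 1) * ((μ₁.k + 1) * (μ₁.k + 1)) ≤
        (G.n + 1) * ((2 * F.card + 1) * (2 * F.card + 1)) :=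
      Nat.mul_le_mul_left _ (Nat.mul_le_mul (by omega) (by omega))
    rw [hn] at h2 h3 h4
    nlinarith [Nat.zero_le (G.n * μ₁.k), Nat.zero_le (G.n * μ₁.k * μ₁.k)]
  · refine (hres u (hu.trans_eq hn.symm)).trans ?_
    change ∑ y ∈ (Finset.range μ₁.n).filter _, μ₁.a y = _
    rw [hn, ha₁]
    refine Finset.sum_congr (Finset.filter_congr fun y _ => ?_) fun _ _ => rfl
    refine iff_of_eq (congrArg (fun r => Relation.ReflTransGen r u y) ?_)
    funext x y
    exact (propext (h₁.edge_iff_forest x y)).symm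

/-- The memory at the beginning of the computation. -/
noncomputable def Memory.initial {n m : ℕ} {G : Digraph (Fin n)}
    (e : Fin m ≃ {p : Fin n × Fin n // G.Adj p.1 p.2}) (a : Fin n → ℝ) (hG : ∀ v, ¬ G.Adj v v) :
    Memory where
  n := n
  m := m
  q := 0
  k := 0
  i := 0
  j := 0
  l := 0
  u := 0
  e := 0
  w := 0
  b := 0
  flip := 0
  flag := 0
  tl := (EdgeList.ofDigraph e hG).tl
  hd := (EdgeList.ofDigraph e hG).hd
  deg _ := 0
  xs _ := 0
  dead _ := 0
  cu _ := 0
  cw _ := 0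
  cd _ := 0
  es _ := 0
  et _ := 0
  B _ := 0
  fin _ := 0
  a v := if h : v < n then a ⟨v, h⟩ else 0
  res _ := 0
  D _ := 0
  W := 0

section

variable {n m : ℕ} {G : Digraph (Fin n)} (e : Fin m ≃ {p : Fin n × Fin n // G.Adj p.1 p.2})
  (a : Fin n → ℝ) (hG : ∀ v, ¬ G.Adj v v)

theorem Memory.toState_initial : (Memory.initial e a hG).toState = initialState e a := by
  simp only [Memory.toState, initialState, Memory.initial, EdgeList.ofDigraph, State.mk.injEq]
  refine ⟨?_, ?_, ?_, ?_⟩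
  · funext x
    split <;> simp_all
  · funext A i
    split <;> simp_all
  · funext x
    split <;> rfl
  · funext A i
    split <;> simp_all

theorem Memory.isInput_initial : (Memory.initial e a hG).IsInput (EdgeList.ofDigraph e hG) :=
  ⟨rfl, rfl, rfl, rfl, rfl, rfl, rfl, rfl, rfl, rfl, rfl⟩

theorem _root_.Digraph.reaches_iff_edgeList (u v : Fin n) : G.Reaches u v ↔ Relation.ReflTransGen
    (fun x y => ∃ i < (EdgeList.ofDigraph e hG).m,
      x = (EdgeList.ofDigraph e hG).tl i ∧ y = (EdgeList.ofDigraph e hG).hd i) (u : ℕ) v := by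
  have hadj : ∀ x y : ℕ, (∃ i < m, x = (EdgeList.ofDigraph e hG).tl i ∧
      y = (EdgeList.ofDigraph e hG).hd i) ↔ ∃ u v, G.Adj u v ∧ x = u ∧ y = v := by
    intro x y
    constructor
    · rintro ⟨i, hi, rfl, rfl⟩
      exact ⟨_, _, (e ⟨i, hi⟩).2, by simp [EdgeList.ofDigraph, hi]⟩
    · rintro ⟨u, v, h, rfl, rfl⟩
      refine ⟨e.symm ⟨(u, v), h⟩, Fin.is_lt _, ?_⟩
      simp [EdgeList.ofDigraph]
  change _ ↔ Relation.ReflTransGen (fun x y => ∃ i < m, _) _ _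
  constructor
  · intro h
    refine Relation.ReflTransGen.lift Fin.val (fun u v h => ?_) _ _ h
    exact (hadj _ _).2 ⟨u, v, h, rfl, rfl⟩
  · intro h
    generalize hy : (v : ℕ) = y at h
    induction h generalizing v with
    | refl => exact (Fin.ext hy) ▸ Relation.ReflTransGen.refl
    | tail _ h2 ih =>
      obtain ⟨u', v', h3, h4, h5⟩ := (hadj _ _).1 h2
      rw [Fin.ext (hy.trans h5)]
      exact (ih u' h4.symm).tail h3

end

end RealRAM

theorem mainTheorem2 :
    ∃ (P : RealRAM.Prog) (C : ℕ),
      ∀ (n m : ℕ) (G : Digraph (Fin n)) (e : Fin m ≃ {p : Fin n × Fin n // G.Adj p.1 p.2})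
        (a : Fin n → ℝ), 0 < n → (∀ v, ¬ G.Adj v v) →
        ∃ (time space : ℕ) (s : RealRAM.State),
          RealRAM.Run space P (RealRAM.initialState e a) time s ∧
          (∀ v : Fin n, s.rarr 1 v = G.weightedReachability a v) ∧
          time ≤ C * (max 1 G.feedbackEdgeNumber ^ 3 * n) ∧
          space ≤ C * (max 1 G.feedbackEdgeNumber * n) := by
  classical
  refine ⟨RealRAM.countDescendants, 50000, fun n m G e a hn hG => ?_⟩
  obtain ⟨F, hF, hFf⟩ := EdgeList.exists_isFeedback e hG
  have hFf' : F.card ≤ max 1 G.feedbackEdgeNumber := hFf.trans (le_max_right _ _)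
  have hf : 1 ≤ max 1 G.feedbackEdgeNumber := le_max_left _ _
  generalize max 1 G.feedbackEdgeNumber = f at hFf' hf ⊢
  -- there are at most `n + 2 * f` edges
  have hm : m ≤ 2 * F.card + n := by
    have h1 := EdgeList.potential_le hF (A := Finset.range m) subset_rfl
    have h2 := Finset.card_filter_le (Finset.range n)
      fun v => (EdgeList.ofDigraph e hG).degree (Finset.range m) v ≠ 0
    have h3 : ((EdgeList.ofDigraph e hG).support (Finset.range m)).card ≤ (Finset.range n).card :=
      h2
    rw [Finset.card_range] at h1 h3
    omega
  have hnf : 1 ≤ f * n := Nat.mul_pos hf hn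
  have hf1 : f ≤ f * n := Nat.le_mul_of_pos_right _ hn
  have hn1 : n ≤ f * n := Nat.le_mul_of_pos_left _ hf
  obtain ⟨t, μ, hrun, ht, hres⟩ := RealRAM.exec_countDescendants (N := 20 * (f * n))
    (RealRAM.Memory.isInput_initial e a hG) hF
    (by change 2 * m + 2 * n + 2 < _; omega)
    (by
      have h1 : (2 * F.card + 2) * (n + 1) ≤ (4 * f) * (2 * n) :=
        Nat.mul_le_mul (by omega) (by omega)
      have h2 : (4 * f) * (2 * n) = 8 * (f * n) := by ring
      change (2 * F.card + 2) * (n + 1) < _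
      omega)
  rw [RealRAM.Memory.toState_initial] at hrun
  refine ⟨t, _, _, hrun, fun v => ?_, ?_, Nat.mul_le_mul_right _ (by norm_num)⟩
  · refine (hres v v.2).trans ?_
    change ∑ y ∈ (Finset.range n).filter _, (RealRAM.Memory.initial e a hG).a y = _
    rw [Digraph.weightedReachability, Finset.sum_filter, Finset.sum_filter, Finset.sum_range]
    refine Finset.sum_congr rfl fun y _ => ?_
    simp only [Digraph.reaches_iff_edgeList e hG, RealRAM.Memory.initial, Fin.is_lt, dif_pos]
  · have ht' : t ≤ 1000 * (m + n + 1) +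
        2400 * ((n + 1) * ((2 * F.card + 1) * (2 * F.card + 1))) := ht
    have h1 : (n + 1) * ((2 * F.card + 1) * (2 * F.card + 1)) ≤ (2 * n) * ((3 * f) * (3 * f)) :=
      Nat.mul_le_mul (by omega) (Nat.mul_le_mul (by omega) (by omega))
    have h2 : (2 * n) * ((3 * f) * (3 * f)) = 18 * (f ^ 2 * n) := by ring
    have h3 : f * n ≤ f ^ 3 * n := Nat.mul_le_mul_right _ (Nat.le_self_pow (by norm_num) f)
    have h4 : f ^ 2 * n ≤ f ^ 3 * n :=
      Nat.mul_le_mul_right _ (Nat.pow_le_pow_right hf (by norm_num))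
    omega
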